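/- Let $F$ be a global field and $V$ a finite-dimensional $F$-vector space of dimension $d\ge 1$. **Norms.** For a place $v$ let $F_v$ be the completion, $|\cdot|$ its normalized absolute value (the usual one on $\mathbb R$, the square of the usual one on $\mathbb C$, $|a|=\sharp(O_v/aO_v)^{-1}$ for $0\ne a\in O_v$ if $v$ is non-archimedean), and $H_v=F_v\otimes_F H$ for an $F$-space $H$. A norm on a finite-dimensional $F_v$-space $H$ is a function of the form $\sum_i a_ie_i\mapsto (\sum_i r_i^2|a_i|^2)^{1/2}$ ($v$ real), $\sum_i r_i|a_i|$ ($v$ complex), $\max_i r_i|a_i|$ ($v$ non-archimedean), for a basis $(e_i)$ and real numbers $r_i>0$. The group $\mathrm{GL}_H(F_v)$ acts on norms by $g\mu=\mu\circ g^{-1}$. Let $X_H$ be the set of norms modulo scaling by $\mathbb R_{>0}$, with the quotient topology of the subspace topology in $\mathbb R^H$. For a norm $\mu$ given by $(e'_i),(r_i)$ and a basis $e$ with $e'=he$, put $|\mu:e|=|\det h|^{-1}\prod_i r_i$. A norm $\mu$ on $H$ induces a norm on a subquotient $H'/H''$ by $x\mapsto\inf\{\mu(\tilde x)\mid \tilde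 x\in H',\ \tilde x+H''=x\}$. **Spaces.** Parabolic subgroups $P$ of $\mathrm{PGL}_V$ correspond to flags $0=V_{-1}\subsetneq V_0\subsetneq\dots\subsetneq V_m=V$ of $F$-subspaces, and $P'\supset P$ means that the flag of $P'$ is contained in that of $P$. Let $\bar X_{F,v}$ be the set of pairs $(P,\mu)$ with $P$ parabolic and $\mu\in\prod_{i=0}^m X_{(V_i/V_{i-1})_v}$. For a nonempty finite set $S$ of places let $\bar X_{F,S}\subset\prod_{v\in S}\bar X_{F,v}$ be the set of families with a common parabolic subgroup. Let $\bar X_{F,v}(P)$, $\bar X_{F,S}(P)$ be the subsets of elements whose parabolic subgroup contains $P$, and set $\mathfrak Z_{F,v}(P)=\prod_{i=0}^m X_{(V_i/V_{i-1})_v}$, $\mathfrak Z_{F,S}(P)=\prod_{v\in S}\mathfrak Z_{F,v}(P)$, $P(\mathbb A_{F,S})=\prod_{v\in S}P(F_v)$, and $P_u(\mathbb A_{F,S})=\prod_{v\in S}P_u(F_v)$, where $P_u$ is the unipotent radical. **Maps.** Fix $P$ and, for every $i$ and every $v$ in question, a basis $e^{(i)}_v$ of $(V_i/V_{i-1})_v$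 (for instance coming from a basis of $V_i/V_{i-1}$); let $d_i=\dim(V_i/V_{i-1})$. Let $(P',\mu)\in\bar X_{F,v}(P)$, with flag $(V'_j)_j$. Define $\phi_{P,v}(P',\mu)=(\nu_i)_i\in\mathfrak Z_{F,v}(P)$, where $\nu_i$ is the class of the norm induced by $\mu_j$ on $(V_i/V_{i-1})_v$, with $j$ such that $V'_j\supset V_i\supsetneq V_{i-1}\supset V'_{j-1}$. Define $\phi'_{P,v}(P',\mu)=(t_i)_{1\le i\le m}\in\mathbb R_{\ge0}^m$ by $t_i=0$ if $V_{i-1}$ belongs to $(V'_j)_j$, and otherwise $t_i=|\tilde\mu_{j,i-1}:e^{(i-1)}_v|^{1/d_{i-1}}\,|\tilde\mu_{j,i}:e^{(i)}_v|^{-1/d_i}$, where $V'_j\supset V_i\supset V_{i-2}\supset V'_{j-1}$ and $\tilde\mu_{j,k}$ is the norm on $(V_k/V_{k-1})_v$ induced by one norm in the class $\mu_j$. Let $Y_0=(\mathbb R_{>0}^S\cup\{0\})^m\subset(\mathbb R^S_{\ge0})^m$, and let $\psi_{P,S}=(\phi_{P,S},\phi'_{P,S}):\bar X_{F,S}(P)\to\mathfrak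 Z_{F,S}(P)\times Y_0$ be given by the maps $\phi_{P,v}$ and $\phi'_{P,v}$ for $v\in S$. An element $g\in P(F_v)$ acts on $\bar X_{F,v}(P)$ and on $\mathfrak Z_{F,v}(P)$ through norms, and on $\mathbb R^m_{\ge0}$ by $t_i\mapsto|\det g_i|^{1/d_i}|\det g_{i-1}|^{-1/d_{i-1}}t_i$, where $g_i$ is induced on $(V_i/V_{i-1})_v$ by a lift of $g$ to $\mathrm{GL}_V(F_v)$. **Topologies.** For a basis $(e_k)_{1\le k\le d}$ of $V$ such that all $V_i$ are spanned by initial segments of it, let $\mathbb R^{d-1}_{\ge0}(P)$ be the set of $t\in\mathbb R^{d-1}_{\ge0}$ with $t_k>0$ unless $k=\dim V_i$ for some $i<m$. For such $t$, let $P_t\supset P$ be the parabolic subgroup whose flag consists of $0$, $V$ and the spans of $e_1,\dots,e_k$ for the $k$ with $t_k=0$; on a graded piece of this flag with basis $(e_j)_{a<j\le b}$, let $\mu_t$ be the class of the norm given by this basis and $r_j=\prod_{a<k<j}t_k^{-1}$. The Borel–Serre topology on $\bar X_{F,v}$ is the one for which, for all $P$ and all such bases, $\bar X_{F,v}(P)$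 is open and has the quotient topology of $P(F_v)\times\mathbb R^{d-1}_{\ge0}(P)$ under $(g,t)\mapsto g(P_t,\mu_t)$; that on $\bar X_{F,S}$ is induced from the product topology on $\prod_{v\in S}\bar X_{F,v}$. The Satake topology on $\bar X_{F,S}$ is the coarsest topology for which, for every $P$, the preimages of open sets under $\bar X_{F,S}(P)\to\mathfrak Z_{F,S}(P)\times\mathbb R^m_{\ge0}$, $x\mapsto(\phi_{P,S}(x),(\prod_{v\in S}t_{v,i})_i)$, where $(t_{v,i})_i$ is the image of the component $x_v$ under $\phi'_{P,v}$, are open in $\bar X_{F,S}$; the Satake topology on $\bar X_{F,v}$ is the case $S=\{v\}$. The weak topology on $Y_0$ is the product of the topologies on $\mathbb R^S_{>0}\cup\{0\}$ that extend the usual topology of $\mathbb R^S_{>0}$ and have the sets $\{t\in\mathbb R_{>0}^S\mid\prod_v t_v\le c\}\cup\{0\}$, $c>0$, as a base of neighborhoods of $0$. **Statement.** The induced functions in the definition of $\phi_{P,v}$ are norms. For every nonempty finite set $S$ of places, $\psi_{P,S}$ takes values in $\mathfrak Z_{F,S}(P)\times Y_0$ and induces a bijection $$P_u(\mathbb A_{F,S})\backslash\bar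 X_{F,S}(P)\xrightarrow{\ \sim\ }\mathfrak Z_{F,S}(P)\times Y_0$$ that is equivariant for the action of $P(\mathbb A_{F,S})$ and is a homeomorphism both for the Borel–Serre topology on $\bar X_{F,S}$ with the usual topology on $Y_0$ and for the Satake topology on $\bar X_{F,S}$ with the weak topology on $Y_0$. For every place $v$ of $F$, the map $(\phi_{P,v},\phi'_{P,v})$ induces a bijection $P_u(F_v)\backslash\bar X_{F,v}(P)\cong\mathfrak Z_{F,v}(P)\times\mathbb R^m_{\ge0}$ that is a homeomorphism for both the Borel–Serre and the Satake topology on $\bar X_{F,v}$. -/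

import Mathlib

open scoped NNReal TensorProduct Topology

noncomputable section

namespace RatCompact

/-! ### Local fields: normalized absolute value, norms, classes of norms -/

section LocalField

variable (E : Type*) [NormedField E]

/-- `E` is isomorphic to `ℝ` as a topological field. -/
def IsoReal : Prop := ∃ f : E ≃+* ℝ, Continuous f ∧ Continuous f.symm

/-- `E` is isomorphic to `ℂ` as a topological field. -/
def IsoComplex : Prop := ∃ f : E ≃+* ℂ, Continuous f ∧ Continuous f.symm

/-- The valuation ring of a nonarchimedean field `E`. The closed unit ball is then already a
subring; the closure only serves to write down a subring without that assumption. -/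
def valRing : Subring E := Subring.closure {x : E | ‖x‖ ≤ 1}

open Classical in
/-- The normalized absolute value of a local field: the usual one on `ℝ`, the square of the usual
one on `ℂ`, and for nonarchimedean `E` with valuation ring `O` the multiplicative function with
`|a| = [O : aO]⁻¹` for nonzero `a ∈ O`; for all `a` this is `[aO : aO ∩ O] / [O : aO ∩ O]`. -/
def nabs (a : E) : ℝ≥0 :=
  if h : IsoReal E then ‖h.choose a‖₊
  else if h : IsoComplex E then ‖h.choose a‖₊ ^ 2
  else
    let O : AddSubgroup E := (valRing E).toAddSubgroup
    let aO : AddSubgroup E := O.map (AddMonoidHom.mulLeft a)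
    (O.relIndex aO : ℝ≥0) / (aO.relIndex O : ℝ≥0)

variable {E} {H : Type*} [AddCommGroup H] [Module E H]

open Classical in
/-- The function on `H` given by the basis `b` and the tuple `r`. -/
def basisNorm {ι : Type*} [Fintype ι] (b : Module.Basis ι E H) (r : ι → ℝ≥0) (x : H) : ℝ≥0 :=
  if IsoReal E then NNReal.sqrt (∑ i, r i ^ 2 * nabs E (b.repr x i) ^ 2)
  else if IsoComplex E then ∑ i, r i * nabs E (b.repr x i)
  else Finset.univ.sup fun i => r i * nabs E (b.repr x i)

variable (E) in
/-- Norms on a finite-dimensional `E`-vector space: the functions given by a basis and a tuple of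
positive real numbers. -/
def IsNorm (μ : H → ℝ≥0) : Prop :=
  ∃ (b : Module.Basis (Fin (Module.finrank E H)) E H) (r : Fin (Module.finrank E H) → ℝ≥0),
    (∀ i, 0 < r i) ∧ basisNorm b r = μ

theorem basisNorm_reindex {ι κ : Type*} [Fintype ι] [Fintype κ] (b : Module.Basis ι E H)
    (r : ι → ℝ≥0) (f : ι ≃ κ) : basisNorm (b.reindex f) (r ∘ f.symm) = basisNorm b r := by
  classical
  funext x
  unfold basisNorm
  simp only [Module.Basis.repr_reindex_apply, Function.comp]
  rw [Equiv.sum_comp f.symm fun i => r i ^ 2 * nabs E (b.repr x i) ^ 2,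
    Equiv.sum_comp f.symm fun i => r i * nabs E (b.repr x i)]
  congr 2
  apply le_antisymm
  · exact Finset.sup_le fun i _ =>
      Finset.le_sup (f := fun i => r i * nabs E (b.repr x i)) (Finset.mem_univ (f.symm i))
  · refine Finset.sup_le fun i _ => ?_
    have := Finset.le_sup (f := fun i => r (f.symm i) * nabs E (b.repr x (f.symm i)))
      (Finset.mem_univ (f i))
    simpa using this

theorem isNorm_basisNorm {ι : Type*} [Fintype ι] (b : Module.Basis ι E H) (r : ι → ℝ≥0)
    (hr : ∀ i, 0 < r i) : IsNorm E (basisNorm b r) := by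
  have hc : Fintype.card ι = Module.finrank E H := (Module.finrank_eq_card_basis b).symm
  let f : ι ≃ Fin (Module.finrank E H) := Fintype.equivFinOfCardEq hc
  exact ⟨b.reindex f, r ∘ f.symm, fun i => hr _, basisNorm_reindex b r f⟩

theorem IsNorm.comp_equiv {H' : Type*} [AddCommGroup H'] [Module E H'] {μ : H → ℝ≥0}
    (h : IsNorm E μ) (f : H ≃ₗ[E] H') : IsNorm E (μ ∘ f.symm) := by
  obtain ⟨b, r, hr, rfl⟩ := h
  have : basisNorm b r ∘ f.symm = basisNorm (b.map f) r := by
    funext x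
    simp [basisNorm]
  rw [this]
  exact isNorm_basisNorm _ _ hr

variable (E H) in
/-- The norms on `H`, topologized as a subspace of `ℝ^H`. -/
abbrev NormOn := {μ : H → ℝ≥0 // IsNorm E μ}

variable (E H) in
/-- Two norms are equivalent if they differ by a positive real factor. -/
def normSetoid : Setoid (NormOn E H) where
  r μ ν := ∃ c : ℝ≥0, 0 < c ∧ ∀ x, ν.1 x = c * μ.1 x
  iseqv :=
    { refl := fun μ => ⟨1, one_pos, fun x => (one_mul _).symm⟩
      symm := by
        rintro μ ν ⟨c, hc, h⟩
        refine ⟨c⁻¹, inv_pos.2 hc, fun x => ?_⟩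
        rw [h, inv_mul_cancel_left₀ hc.ne']
      trans := by
        rintro μ ν ρ ⟨c, hc, h⟩ ⟨c', hc', h'⟩
        exact ⟨c' * c, mul_pos hc' hc, fun x => by rw [h', h, mul_assoc]⟩ }

variable (E H) in
/-- The space of equivalence classes of norms on `H`. -/
def NormClass := Quotient (normSetoid E H)

/-- The quotient topology of the subspace topology on the set of norms inside `ℝ^H`. -/
instance : TopologicalSpace (NormClass E H) :=
  inferInstanceAs (TopologicalSpace (Quotient (normSetoid E H)))

/-- The class of a norm. -/
def NormClass.mk (μ : NormOn E H) : NormClass E H := Quotient.mk (normSetoid E H) μ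

/-- A norm in a given class. -/
def NormClass.rep (c : NormClass E H) : H → ℝ≥0 := (Quotient.out (s := normSetoid E H) c).1

instance [FiniteDimensional E H] : Nonempty (NormClass E H) :=
  ⟨.mk ⟨_, isNorm_basisNorm (Module.finBasis E H) (fun _ => 1) fun _ => one_pos⟩⟩

open Classical in
/-- The class of a function `μ` that is a norm (an arbitrary class if `μ` is not a norm). -/
def NormClass.ofFun [FiniteDimensional E H] (μ : H → ℝ≥0) : NormClass E H :=
  if h : IsNorm E μ then .mk ⟨μ, h⟩ else Classical.arbitrary _

/-- Transport of classes of norms along a linear isomorphism: `μ ↦ μ ∘ f⁻¹`. -/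
def NormClass.map {H' : Type*} [AddCommGroup H'] [Module E H'] (f : H ≃ₗ[E] H') :
    NormClass E H → NormClass E H' :=
  Quotient.map' (fun μ => ⟨μ.1 ∘ f.symm, μ.2.comp_equiv f⟩)
    (fun _ _ ⟨c, hc, h⟩ => ⟨c, hc, fun x => h (f.symm x)⟩)

/-- `GL(H)` acts on classes of norms by `g μ = μ ∘ g⁻¹`. -/
instance : MulAction (H ≃ₗ[E] H) (NormClass E H) where
  smul g c := c.map g
  one_smul c := by
    induction c using Quotient.inductionOn
    rfl
  mul_smul g h c := by
    induction c using Quotient.inductionOn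
    rfl

open Classical in
/-- The absolute value `|μ : e|` of a norm `μ` relative to a basis `e`: if `μ` is given by a basis
`b` and a tuple `r`, and `h` takes `e` to `b`, it is `|det h|⁻¹ ∏ rᵢ`. -/
def absVal (e : Module.Basis (Fin (Module.finrank E H)) E H) (μ : H → ℝ≥0) : ℝ≥0 :=
  if h : IsNorm E μ then (nabs E (e.det h.choose))⁻¹ * ∏ i, h.choose_spec.choose i else 0

end LocalField

/-! ### Subquotients -/

section Subquotient

variable {E : Type*} [NormedField E] {M : Type*} [AddCommGroup M] [Module E M]

/-- The subquotient `B / A` for subspaces `A ≤ B`. -/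
abbrev SubQ (B A : Submodule E M) := ↥B ⧸ A.submoduleOf B

/-- For `A ≤ A' ≤ B' ≤ B`, the function on `B' / A'` induced by a norm `μ` on `B / A`: the infimum
of `μ` over the preimages in `B' / A`. -/
def subquotNorm {B A : Submodule E M} (B' A' : Submodule E M) (μ : SubQ B A → ℝ≥0)
    (x : SubQ B' A') : ℝ≥0 :=
  sInf {s | ∃ (y : M) (h' : y ∈ B') (h : y ∈ B),
    (A'.submoduleOf B').mkQ ⟨y, h'⟩ = x ∧ s = μ ((A.submoduleOf B).mkQ ⟨y, h⟩)}

/-- The automorphism of `B / A` induced by an automorphism that preserves `A` and `B`. -/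
def subqEquiv {B A : Submodule E M} (g : M ≃ₗ[E] M)
    (hB : B.map (g : M →ₗ[E] M) = B) (hA : A.map (g : M →ₗ[E] M) = A) :
    SubQ B A ≃ₗ[E] SubQ B A :=
  Submodule.Quotient.equiv _ _ (g.ofSubmodules B B hB) (by
    ext ⟨y, hy⟩
    simp only [Submodule.mem_map, Submodule.submoduleOf, Submodule.mem_comap]
    constructor
    · rintro ⟨⟨z, hz⟩, hzA, h⟩
      have h2 : g z = y := congrArg Subtype.val h
      change y ∈ A
      rw [← hA]
      exact ⟨z, hzA, h2⟩
    · intro h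
      change y ∈ A at h
      have hyA := h
      rw [← hA] at hyA
      obtain ⟨z, hz, hzy⟩ := hyA
      have hyB := hy
      rw [← hB] at hyB
      obtain ⟨z', hz', hzy'⟩ := hyB
      have : z' = z := g.injective (hzy'.trans hzy.symm)
      subst this
      exact ⟨⟨z', hz'⟩, hz, Subtype.ext hzy⟩)

@[simp] theorem subqEquiv_mk {B A : Submodule E M} (g : M ≃ₗ[E] M)
    (hB : B.map (g : M →ₗ[E] M) = B) (hA : A.map (g : M →ₗ[E] M) = A) (y : B) :
    subqEquiv g hB hA ((A.submoduleOf B).mkQ y) =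
      (A.submoduleOf B).mkQ (g.ofSubmodules B B hB y) := rfl

/-- If `B` and `A` are spanned by parts of a basis, the basis of `B / A` formed by the classes of the
basis vectors that belong to the part for `B` and not to the part for `A`. -/
def subqBasis {ι : Type*} (b : Module.Basis ι E M) {B A : Submodule E M} (u s : Set ι)
    (hB : B = Submodule.span E (b '' u)) (hA : A = Submodule.span E (b '' s)) :
    Module.Basis {j // j ∈ u ∧ j ∉ s} E (SubQ B A) :=
  Module.Basis.mk
    (v := fun j => (A.submoduleOf B).mkQ
      ⟨b j.1, hB ▸ Submodule.subset_span (Set.mem_image_of_mem b j.2.1)⟩)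
    (by
      have hli : LinearIndependent E (fun j : {j // j ∈ u ∧ j ∉ s} =>
          (⟨b j.1, hB ▸ Submodule.subset_span (Set.mem_image_of_mem b j.2.1)⟩ : B)) := by
        apply LinearIndependent.of_comp B.subtype
        exact b.linearIndependent.comp (fun j : {j // j ∈ u ∧ j ∉ s} => j.1)
          Subtype.val_injective
      refine hli.map ?_
      rw [Submodule.ker_mkQ, Submodule.disjoint_def]
      intro x hx hxA
      have h1 : (x : M) ∈ Submodule.span E (b '' {j | j ∈ u ∧ j ∉ s}) := by
        have := Submodule.mem_map_of_mem (f := B.subtype) hx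
        rw [Submodule.map_span] at this
        refine Submodule.span_mono ?_ this
        rintro _ ⟨_, ⟨j, rfl⟩, rfl⟩
        exact ⟨j.1, j.2, rfl⟩
      have h2 : (x : M) ∈ Submodule.span E (b '' s) := by
        rw [← hA]
        exact hxA
      have hd : Disjoint {j | j ∈ u ∧ j ∉ s} s :=
        Set.disjoint_left.2 fun j hj hjs => hj.2 hjs
      exact Subtype.ext
        (Submodule.disjoint_def.1 (b.linearIndependent.disjoint_span_image hd) x.1 h1 h2))
    (by
      have key : ∀ (x : M) (_ : x ∈ Submodule.span E (b '' u)) (hxB : x ∈ B),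
          (A.submoduleOf B).mkQ ⟨x, hxB⟩ ∈ Submodule.span E (Set.range
            fun j : {j // j ∈ u ∧ j ∉ s} => (A.submoduleOf B).mkQ
              ⟨b j.1, hB ▸ Submodule.subset_span (Set.mem_image_of_mem b j.2.1)⟩) := by
        intro x hx
        induction hx using Submodule.span_induction with
        | mem x h =>
          intro hxB
          obtain ⟨j, hj, rfl⟩ := h
          by_cases hjs : j ∈ s
          · have : (A.submoduleOf B).mkQ ⟨b j, hxB⟩ = 0 := by
              rw [Submodule.mkQ_apply, Submodule.Quotient.mk_eq_zero]
              change b j ∈ A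
              rw [hA]
              exact Submodule.subset_span (Set.mem_image_of_mem b hjs)
            rw [this]
            exact zero_mem _
          · exact Submodule.subset_span ⟨⟨j, hj, hjs⟩, rfl⟩
        | zero => 
          intro hxB
          have : (⟨0, hxB⟩ : B) = 0 := rfl
          rw [this, map_zero]
          exact zero_mem _
        | add x y hx hy ihx ihy =>
          intro hxB
          have hx' : x ∈ B := hB ▸ hx
          have hy' : y ∈ B := hB ▸ hy
          have : (⟨x + y, hxB⟩ : B) = ⟨x, hx'⟩ + ⟨y, hy'⟩ := rfl
          rw [this, map_add]
          exact add_mem (ihx hx') (ihy hy')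
        | smul a x hx ih =>
          intro hxB
          have hx' : x ∈ B := hB ▸ hx
          have : (⟨a • x, hxB⟩ : B) = a • ⟨x, hx'⟩ := rfl
          rw [this, map_smul]
          exact Submodule.smul_mem _ _ (ih hx')
      intro q _
      induction q using Submodule.Quotient.induction_on with
      | H x => exact key x.1 (hB ▸ x.2) x.2)

end Subquotient

/-! ### Flags, i.e. parabolic subgroups -/

section Flags

variable (F V : Type*) [Field F] [AddCommGroup V] [Module F V]

/-- A flag of subspaces of `V`: a set of subspaces containing `0` and `V` and totally ordered
under inclusion. Flags correspond to parabolic subgroups of `PGL_V` over `F`; the parabolic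
subgroup of `Q` contains the one of `P` if and only if `Q.carrier ⊆ P.carrier`. -/
structure ParFlag where
  carrier : Set (Submodule F V)
  bot_mem : ⊥ ∈ carrier
  top_mem : ⊤ ∈ carrier
  chain : IsChain (· ≤ ·) carrier

variable {F V} [FiniteDimensional F V]

theorem ParFlag.sInf_mem (P : ParFlag F V) {T : Set (Submodule F V)} (hT : T ⊆ P.carrier)
    (hne : T.Nonempty) : sInf T ∈ T := by
  obtain ⟨m, hm, hmin⟩ := WellFounded.has_min (wellFounded_lt (α := Submodule F V)) T hne
  have : IsLeast T m := by
    refine ⟨hm, fun x hx => ?_⟩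
    rcases P.chain.total (hT hm) (hT hx) with h | h
    · exact h
    · rcases h.eq_or_lt with h | h
      · exact h.ge
      · exact absurd h (hmin x hx)
  rw [this.isGLB.sInf_eq]
  exact hm

theorem ParFlag.sSup_mem (P : ParFlag F V) {T : Set (Submodule F V)} (hT : T ⊆ P.carrier)
    (hne : T.Nonempty) : sSup T ∈ T := by
  obtain ⟨m, hm, hmax⟩ := WellFounded.has_min (wellFounded_gt (α := Submodule F V)) T hne
  have : IsGreatest T m := by
    refine ⟨hm, fun x hx => ?_⟩
    rcases P.chain.total (hT hx) (hT hm) with h | h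
    · exact h
    · rcases h.eq_or_lt with h | h
      · exact h.ge
      · exact absurd h (hmax x hx)
  rw [this.isLUB.sSup_eq]
  exact hm

/-- The members `V_0 ⊊ ... ⊊ V_m = V` of the flag `0 = V_{-1} ⊊ V_0 ⊊ ... ⊊ V_m = V`. -/
abbrev ParFlag.Steps (P : ParFlag F V) := {W : Submodule F V // W ∈ P.carrier ∧ W ≠ ⊥}

/-- The members `V_0, ..., V_{m-1}`. A tuple `(t_i)_{1 ≤ i ≤ m}` is written as a function on this
set, with `t_i` the value at `V_{i-1}`. -/
abbrev ParFlag.Inner (P : ParFlag F V) :=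
  {W : Submodule F V // W ∈ P.carrier ∧ W ≠ ⊥ ∧ W ≠ ⊤}

/-- The predecessor in the flag: `V_{i-1}` for `W = V_i`. -/
def ParFlag.pred (P : ParFlag F V) (W : Submodule F V) : Submodule F V :=
  sSup {U | U ∈ P.carrier ∧ U < W}

theorem ParFlag.pred_mem (P : ParFlag F V) (W : P.Steps) : P.pred W.1 ∈ P.carrier :=
  (P.sSup_mem (T := {U | U ∈ P.carrier ∧ U < W.1}) (fun _ h => h.1)
    ⟨⊥, P.bot_mem, bot_lt_iff_ne_bot.2 W.2.2⟩).1

/-- `V_{i-1}`, seen as the upper term of the subquotient `V_{i-1} / V_{i-2}`. -/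
def ParFlag.lower (P : ParFlag F V) (W : P.Inner) : P.Steps := ⟨W.1, W.2.1, W.2.2.1⟩

/-- For `W = V_{i-1}` the next member `V_i`, upper term of the subquotient `V_i / V_{i-1}`. -/
def ParFlag.upper (P : ParFlag F V) (W : P.Inner) : P.Steps :=
  have h := P.sInf_mem (T := {U | U ∈ P.carrier ∧ W.1 < U}) (fun _ h => h.1)
    ⟨⊤, P.top_mem, lt_top_iff_ne_top.2 W.2.2.2⟩
  ⟨sInf {U | U ∈ P.carrier ∧ W.1 < U}, h.1, (bot_le.trans_lt h.2).ne'⟩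

/-- The smallest member of the flag that contains the nonzero subspace `W`. If `W = V_i` belongs to
a refinement `(V_i)` of the flag `(V'_j)`, this is the `V'_j` with
`V'_j ⊇ V_i ⊋ V_{i-1} ⊇ V'_{j-1}`. -/
def ParFlag.cover (Q : ParFlag F V) (W : Submodule F V) (hW : W ≠ ⊥) : Q.Steps :=
  have h := Q.sInf_mem (T := {U | U ∈ Q.carrier ∧ W ≤ U}) (fun _ h => h.1)
    ⟨⊤, Q.top_mem, le_top⟩
  ⟨sInf {U | U ∈ Q.carrier ∧ W ≤ U}, h.1, ((bot_lt_iff_ne_bot.2 hW).trans_le h.2).ne'⟩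

end Flags

/-! ### The spaces at one place -/

section OnePlace

variable (E : Type*) [NormedField E] {F V : Type*} [Field F] [AddCommGroup V] [Module F V]
  [FiniteDimensional F V] [Algebra F E]

/-- The subquotient `(V_i / V_{i-1})_v` for the member `W = V_i` of the flag, where `E = F_v`. -/
abbrev Gr (P : ParFlag F V) (W : P.Steps) :=
  SubQ (W.1.baseChange E) ((P.pred W.1).baseChange E)

/-- The group of `E`-points of the parabolic subgroup of `GL_V` attached to the flag: the stabilizer
of the flag in `GL(V_v)`. The `E`-points of the parabolic subgroup of `PGL_V` are the quotient of
this group by the scalars, and they act below through their lifts to this group. -/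
def Par (P : ParFlag F V) : Subgroup ((E ⊗[F] V) ≃ₗ[E] (E ⊗[F] V)) where
  carrier := {g | ∀ W ∈ P.carrier,
    (W.baseChange E).map (g : (E ⊗[F] V) →ₗ[E] (E ⊗[F] V)) = W.baseChange E}
  one_mem' := fun W _ => Submodule.map_id _
  mul_mem' := by
    intro g h hg hh W hW
    have : ((g * h : (E ⊗[F] V) ≃ₗ[E] (E ⊗[F] V)) : (E ⊗[F] V) →ₗ[E] (E ⊗[F] V)) =
        (g : (E ⊗[F] V) →ₗ[E] (E ⊗[F] V)) ∘ₗ (h : (E ⊗[F] V) →ₗ[E] (E ⊗[F] V)) := rfl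
    rw [this, Submodule.map_comp, hh W hW, hg W hW]
  inv_mem' := by
    intro g hg W hW
    have h1 : ((g⁻¹ : (E ⊗[F] V) ≃ₗ[E] (E ⊗[F] V)) : (E ⊗[F] V) →ₗ[E] (E ⊗[F] V)) ∘ₗ
        (g : (E ⊗[F] V) →ₗ[E] (E ⊗[F] V)) = LinearMap.id := by
      ext x
      exact congrArg (fun k : (E ⊗[F] V) ≃ₗ[E] (E ⊗[F] V) => k (1 ⊗ₜ[F] x)) (inv_mul_cancel g)
    conv_lhs => rw [← hg W hW]
    rw [← Submodule.map_comp, h1, Submodule.map_id]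

theorem Par_mono {P Q : ParFlag F V} (h : Q.carrier ⊆ P.carrier) : Par E P ≤ Par E Q :=
  fun _ hg W hW => hg W (h hW)

/-- The action of the parabolic group on a graded piece of the flag. -/
def grHom (P : ParFlag F V) (W : P.Steps) : Par E P →* (Gr E P W ≃ₗ[E] Gr E P W) where
  toFun g := subqEquiv g.1 (g.2 _ W.2.1) (g.2 _ (P.pred_mem W))
  map_one' := by
    ext x
    induction x using Submodule.Quotient.induction_on
    rfl
  map_mul' g h := by
    ext x
    induction x using Submodule.Quotient.induction_on
    rfl

/-- For a flag `Q` contained in the flag `P`, the action of the group of `P` on a graded piece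
of `Q`. -/
def grHomOf {P Q : ParFlag F V} (h : Q.carrier ⊆ P.carrier) (W : Q.Steps) :
    Par E P →* (Gr E Q W ≃ₗ[E] Gr E Q W) :=
  (grHom E Q W).comp (Subgroup.inclusion (Par_mono E h))

/-- The group of `E`-points of the unipotent radical: the elements acting trivially on the graded
pieces of the flag. It is mapped isomorphically to the unipotent radical in `PGL_V`. -/
def UniRad (P : ParFlag F V) : Subgroup (Par E P) := ⨅ W : P.Steps, (grHom E P W).ker

variable (F V) in
/-- The set `X̄_{F,v}`, with `E = F_v`: pairs of a flag of `F`-subspaces and a family of classes of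
norms on the graded pieces `(V_i / V_{i-1})_v`. -/
@[ext] structure XBar where
  flag : ParFlag F V
  cls : ∀ W : flag.Steps, NormClass E (Gr E flag W)

/-- The subset `X̄_{F,v}(P)`. -/
abbrev XBarP (P : ParFlag F V) := {x : XBar E F V // x.flag.carrier ⊆ P.carrier}

/-- The action of `P(F_v)` on `X̄_{F,v}(P)`. -/
instance (P : ParFlag F V) : MulAction (Par E P) (XBarP E P) where
  smul g x := ⟨⟨x.1.flag, fun W => grHomOf E x.2 W g • x.1.cls W⟩, x.2⟩
  one_smul x := Subtype.ext (congrArg (XBar.mk x.1.flag) (funext fun W =>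
    (congrArg (fun k : Gr E x.1.flag W ≃ₗ[E] Gr E x.1.flag W => k • x.1.cls W)
      (MonoidHom.map_one (grHomOf E x.2 W))).trans (one_smul _ (x.1.cls W))))
  mul_smul g h x := Subtype.ext (congrArg (XBar.mk x.1.flag) (funext fun W =>
    (congrArg (fun k : Gr E x.1.flag W ≃ₗ[E] Gr E x.1.flag W => k • x.1.cls W)
      (MonoidHom.map_mul (grHomOf E x.2 W) g h)).trans (mul_smul _ _ (x.1.cls W))))

/-- The space `𝔷_{F,v}(P)`, the product of the spaces of classes of norms on the graded pieces. -/
abbrev ZSp (P : ParFlag F V) := ∀ W : P.Steps, NormClass E (Gr E P W)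

/-- The function on `(V_i / V_{i-1})_v`, for `W = V_i`, induced by a norm in the class that `x` has
on `(V'_j / V'_{j-1})_v`, where `U = V'_j`. -/
def XBar.induced (x : XBar E F V) (U : x.flag.Steps) (P : ParFlag F V) (W : P.Steps) :
    Gr E P W → ℝ≥0 :=
  subquotNorm (W.1.baseChange E) ((P.pred W.1).baseChange E) (x.cls U).rep

/-- The map `φ_{P,v}`. -/
def phi (P : ParFlag F V) (x : XBarP E P) : ZSp E P :=
  fun W => NormClass.ofFun (x.1.induced E (x.1.flag.cover W.1 W.2.2) P W)

/-- A choice of bases of all graded pieces `(V_i / V_{i-1})_v`. -/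
abbrev GrBases (P : ParFlag F V) :=
  ∀ W : P.Steps, Module.Basis (Fin (Module.finrank E (Gr E P W))) E (Gr E P W)

open Classical in
/-- The map `φ'_{P,v}`. -/
def phi' (P : ParFlag F V) (e : GrBases E P) (x : XBarP E P) (W : P.Inner) : ℝ≥0 :=
  if W.1 ∈ x.1.flag.carrier then 0
  else
    let U := x.1.flag.cover (P.upper W).1 (P.upper W).2.2
    absVal (e (P.lower W)) (x.1.induced E U P (P.lower W)) ^
        (1 / (Module.finrank E (Gr E P (P.lower W)) : ℝ)) *
      absVal (e (P.upper W)) (x.1.induced E U P (P.upper W)) ^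
        (-1 / (Module.finrank E (Gr E P (P.upper W)) : ℝ))

/-- The factor by which `g ∈ P(F_v)` multiplies the coordinate `t_i`, where `W = V_{i-1}`. -/
def tFactor (P : ParFlag F V) (g : Par E P) (W : P.Inner) : ℝ≥0 :=
  nabs E (LinearMap.det (grHom E P (P.upper W) g : Gr E P (P.upper W) →ₗ[E] Gr E P (P.upper W))) ^
      (1 / (Module.finrank E (Gr E P (P.upper W)) : ℝ)) *
    nabs E (LinearMap.det (grHom E P (P.lower W) g : Gr E P (P.lower W) →ₗ[E] Gr E P (P.lower W))) ^
      (-1 / (Module.finrank E (Gr E P (P.lower W)) : ℝ))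

end OnePlace

/-! ### The Borel–Serre topology at one place -/

section BorelSerre

variable {F V : Type*} [Field F] [AddCommGroup V] [Module F V] [FiniteDimensional F V]

/-- The span of the first `k` vectors of a basis of `V`. -/
def stdSub (e : Module.Basis (Fin (Module.finrank F V)) F V) (k : ℕ) : Submodule F V :=
  Submodule.span F (e '' {i | i.1 < k})

theorem stdSub_mono (e : Module.Basis (Fin (Module.finrank F V)) F V) {k l : ℕ} (h : k ≤ l) :
    stdSub e k ≤ stdSub e l :=
  Submodule.span_mono (Set.image_mono fun _ hi => lt_of_lt_of_le hi h)

theorem stdSub_zero (e : Module.Basis (Fin (Module.finrank F V)) F V) : stdSub e 0 = ⊥ := by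
  simp [stdSub]

theorem stdSub_finrank (e : Module.Basis (Fin (Module.finrank F V)) F V) :
    stdSub e (Module.finrank F V) = ⊤ := by
  have : {i : Fin (Module.finrank F V) | i.1 < Module.finrank F V} = Set.univ := by
    ext i
    simp
  rw [stdSub, this, Set.image_univ, e.span_eq]

/-- The flag attached to `t ∈ ℝ_{≥0}^{d-1}`: its members other than `0` and `V` are the spans of the
first `k` basis vectors for the `k` in `{1, ..., d-1}` with `t_k = 0`. Here and below, the
coordinate `t_k` is the value at `k - 1` of a function on `{0, ..., d-2}`. -/
def flagOf (e : Module.Basis (Fin (Module.finrank F V)) F V)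
    (t : Fin (Module.finrank F V - 1) → ℝ≥0) : ParFlag F V where
  carrier := {U | U = ⊥ ∨ U = ⊤ ∨ ∃ k, t k = 0 ∧ U = stdSub e (k.1 + 1)}
  bot_mem := Or.inl rfl
  top_mem := Or.inr (Or.inl rfl)
  chain := by
    rintro U hU U' hU' -
    rcases hU with rfl | rfl | ⟨k, -, rfl⟩
    · exact Or.inl bot_le
    · exact Or.inr le_top
    rcases hU' with rfl | rfl | ⟨l, -, rfl⟩
    · exact Or.inr bot_le
    · exact Or.inl le_top
    rcases le_total k.1 l.1 with h | h
    · exact Or.inl (stdSub_mono e (by omega))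
    · exact Or.inr (stdSub_mono e (by omega))

theorem flagOf_eq_span (e : Module.Basis (Fin (Module.finrank F V)) F V)
    (t : Fin (Module.finrank F V - 1) → ℝ≥0) {U : Submodule F V} (hU : U ∈ (flagOf e t).carrier) :
    U = Submodule.span F (e '' {i | e i ∈ U}) := by
  have key : ∀ k, stdSub e k = Submodule.span F (e '' {i | e i ∈ stdSub e k}) := by
    intro k
    apply le_antisymm
    · refine Submodule.span_mono (Set.image_mono fun i hi => ?_)
      exact Submodule.subset_span (Set.mem_image_of_mem e hi)
    · rw [Submodule.span_le]
      rintro _ ⟨i, hi, rfl⟩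
      exact hi
  rcases hU with rfl | rfl | ⟨k, -, rfl⟩
  · rw [← stdSub_zero e]
    exact key _
  · rw [← stdSub_finrank e]
    exact key _
  · exact key _

variable (E : Type*) [NormedField E] [Algebra F E]

theorem baseChange_eq_span (e : Module.Basis (Fin (Module.finrank F V)) F V)
    (t : Fin (Module.finrank F V - 1) → ℝ≥0) {U : Submodule F V} (hU : U ∈ (flagOf e t).carrier) :
    U.baseChange E = Submodule.span E (e.baseChange E '' {i | e i ∈ U}) := by
  conv_lhs => rw [flagOf_eq_span e t hU]
  rw [Submodule.baseChange_span, ← Set.image_comp]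
  congr 1
  refine Set.image_congr fun i _ => ?_
  simp

/-- The basis of `(V_i / V_{i-1})_v` formed by the classes of the basis vectors `e_j` that belong to
`W = V_i` and not to `V_{i-1}`. -/
def grBasis (e : Module.Basis (Fin (Module.finrank F V)) F V)
    (t : Fin (Module.finrank F V - 1) → ℝ≥0) (W : (flagOf e t).Steps) :
    Module.Basis {j // e j ∈ W.1 ∧ e j ∉ (flagOf e t).pred W.1} E (Gr E (flagOf e t) W) :=
  subqBasis (e.baseChange E) {j | e j ∈ W.1} {j | e j ∈ (flagOf e t).pred W.1}
    (baseChange_eq_span E e t W.2.1) (baseChange_eq_span E e t ((flagOf e t).pred_mem W))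

theorem weight_factor_pos (e : Module.Basis (Fin (Module.finrank F V)) F V)
    (t : Fin (Module.finrank F V - 1) → ℝ≥0) (W : (flagOf e t).Steps)
    (j : {j // e j ∈ W.1 ∧ e j ∉ (flagOf e t).pred W.1}) (k : Fin (Module.finrank F V - 1))
    (hk : ¬ stdSub e (k.1 + 1) ≤ (flagOf e t).pred W.1) (hkj : k.1 < j.1.1) : 0 < (t k)⁻¹ := by
  rw [inv_pos]
  refine pos_of_ne_zero fun h0 => hk ?_
  have hmem : stdSub e (k.1 + 1) ∈ (flagOf e t).carrier := Or.inr (Or.inr ⟨k, h0, rfl⟩)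
  have hj : ¬ W.1 ≤ stdSub e (k.1 + 1) := by
    intro hle
    have h1 := hle j.2.1
    rw [stdSub, e.mem_span_image, e.repr_self, Finsupp.support_single _ one_ne_zero] at h1
    have h2 : j.1.1 < k.1 + 1 := h1 (by simp)
    omega
  rcases (flagOf e t).chain.total hmem W.2.1 with h | h
  · exact le_sSup ⟨hmem, lt_of_le_not_ge h hj⟩
  · exact absurd h hj

open Classical in
/-- The tuple `r_j = ∏_{c(i-1) < k < j} t_k⁻¹` for `c(i-1) < j ≤ c(i)`, where `W = V_i` and
`c(i) = dim V_i`; both `j` and `k` are shifted by one, and `c(i-1) < k` means that the span of the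
first `k` basis vectors is not contained in `V_{i-1}`. -/
def weight (e : Module.Basis (Fin (Module.finrank F V)) F V)
    (t : Fin (Module.finrank F V - 1) → ℝ≥0) (W : (flagOf e t).Steps)
    (j : {j // e j ∈ W.1 ∧ e j ∉ (flagOf e t).pred W.1}) : ℝ≥0 :=
  ∏ k ∈ Finset.univ.filter fun k : Fin (Module.finrank F V - 1) =>
    ¬ stdSub e (k.1 + 1) ≤ (flagOf e t).pred W.1 ∧ k.1 < j.1.1, (t k)⁻¹

theorem weight_pos (e : Module.Basis (Fin (Module.finrank F V)) F V)
    (t : Fin (Module.finrank F V - 1) → ℝ≥0) (W : (flagOf e t).Steps)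
    (j : {j // e j ∈ W.1 ∧ e j ∉ (flagOf e t).pred W.1}) : 0 < weight e t W j := by
  classical
  refine Finset.prod_pos fun k hk => ?_
  obtain ⟨-, h1, h2⟩ := Finset.mem_filter.1 hk
  exact weight_factor_pos e t W j k h1 h2

open Classical in
/-- The element `(P_t, μ_t)` of `X̄_{F,v}` attached to `t ∈ ℝ_{≥0}^{d-1}`. -/
def stdPoint (e : Module.Basis (Fin (Module.finrank F V)) F V)
    (t : Fin (Module.finrank F V - 1) → ℝ≥0) : XBar E F V :=
  ⟨flagOf e t, fun W => .mk ⟨basisNorm (grBasis E e t W) (weight e t W),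
    isNorm_basisNorm _ _ (weight_pos e t W)⟩⟩

/-- `P` is standard with respect to the basis `e`, i.e. contains the upper triangular Borel
subgroup: each member of the flag is spanned by an initial segment of `e`. -/
def Adapted (e : Module.Basis (Fin (Module.finrank F V)) F V) (P : ParFlag F V) : Prop :=
  ∀ U ∈ P.carrier, ∃ k, U = stdSub e k

/-- The set `ℝ_{≥0}^{d-1}(P)`: the coordinate `t_k` is nonzero unless the span of the first `k`
basis vectors belongs to the flag. -/
abbrev RSp (e : Module.Basis (Fin (Module.finrank F V)) F V) (P : ParFlag F V) :=
  {t : Fin (Module.finrank F V - 1) → ℝ≥0 // ∀ k, t k = 0 → stdSub e (k.1 + 1) ∈ P.carrier}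

theorem flagOf_subset (e : Module.Basis (Fin (Module.finrank F V)) F V) (P : ParFlag F V)
    (t : RSp e P) : (flagOf e t.1).carrier ⊆ P.carrier := by
  rintro U (rfl | rfl | ⟨k, hk, rfl⟩)
  · exact P.bot_mem
  · exact P.top_mem
  · exact t.2 k hk

/-- The map `(g, t) ↦ g (P_t, μ_t)` from `P(F_v) × ℝ_{≥0}^{d-1}(P)` to `X̄_{F,v}(P) ⊆ X̄_{F,v}`. -/
def piBar (e : Module.Basis (Fin (Module.finrank F V)) F V) (P : ParFlag F V)
    (y : Par E P × RSp e P) : XBar E F V :=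
  (y.1 • (⟨stdPoint E e y.2.1, flagOf_subset e P y.2⟩ : XBarP E P)).1

/-- The topology of `P(F_v)` as a group of matrices over `E = F_v`. -/
@[reducible] def parTop (e : Module.Basis (Fin (Module.finrank F V)) F V) (P : ParFlag F V) :
    TopologicalSpace (Par E P) :=
  TopologicalSpace.induced
    (fun g => LinearMap.toMatrix (e.baseChange E) (e.baseChange E)
      (g.1 : (E ⊗[F] V) →ₗ[E] (E ⊗[F] V))) inferInstance

variable (F V) in
/-- The Borel–Serre topology on `X̄_{F,v}`: a set is open if and only if its preimage in
`P(F_v) × ℝ_{≥0}^{d-1}(P)` is open for every parabolic `P` and every basis `e` adapted to `P`.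
Taking the preimages in the stabilizer of the flag in `GL(V_v)` instead of its quotient by the
scalars makes no difference, as the map to that quotient is open. If there is a topology for which
all the `X̄_{F,v}(P)` are open and carry the quotient topologies from
`P(F_v) × ℝ_{≥0}^{d-1}(P)`, it is this one. -/
@[reducible] def bsTop : TopologicalSpace (XBar E F V) :=
  ⨆ (P : ParFlag F V) (e : Module.Basis (Fin (Module.finrank F V)) F V) (_ : Adapted e P),
    TopologicalSpace.coinduced (piBar E e P)
      (@instTopologicalSpaceProd _ _ (parTop E e P) inferInstance)

end BorelSerre

/-! ### The spaces for finitely many places -/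

section ManyPlaces

variable {S : Type*} (E : S → Type*) [∀ v, NormedField (E v)] {F V : Type*} [Field F]
  [AddCommGroup V] [Module F V] [FiniteDimensional F V] [∀ v, Algebra F (E v)]

variable (F V) in
/-- The set `X̄_{F,S}`: families of elements of the `X̄_{F,v}` with a common flag. -/
abbrev XBarS := {x : ∀ v, XBar (E v) F V // ∀ v w, (x v).flag = (x w).flag}

/-- The subset `X̄_{F,S}(P)`. -/
abbrev XBarSP (P : ParFlag F V) := {x : XBarS E F V // ∀ v, (x.1 v).flag.carrier ⊆ P.carrier}

/-- The component at `v` of an element of `X̄_{F,S}(P)`. -/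
def XBarSP.comp {E : S → Type*} [∀ v, NormedField (E v)] [∀ v, Algebra F (E v)]
    {P : ParFlag F V} (x : XBarSP E P) (v : S) : XBarP (E v) P := ⟨x.1.1 v, x.2 v⟩

/-- The group `P(𝔸_{F,S}) = ∏_{v ∈ S} P(F_v)`. -/
abbrev ParS (P : ParFlag F V) := ∀ v, Par (E v) P

/-- The subgroup `P_u(𝔸_{F,S}) = ∏_{v ∈ S} P_u(F_v)`. -/
def UniRadS (P : ParFlag F V) : Subgroup (ParS E P) :=
  Subgroup.pi Set.univ fun v => UniRad (E v) P

/-- The componentwise action of `P(𝔸_{F,S})` on `X̄_{F,S}(P)`. -/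
instance (P : ParFlag F V) : MulAction (ParS E P) (XBarSP E P) where
  smul g x := ⟨⟨fun v => (g v • x.comp v).1, fun v w => x.1.2 v w⟩, fun v => x.2 v⟩
  one_smul x := by
    apply Subtype.ext
    apply Subtype.ext
    funext v
    exact congrArg Subtype.val (one_smul (Par (E v) P) (x.comp v))
  mul_smul g h x := by
    apply Subtype.ext
    apply Subtype.ext
    funext v
    exact congrArg Subtype.val (mul_smul (g v) (h v) (x.comp v))

variable (F V) in
/-- The Borel–Serre topology on `X̄_{F,S}`: the subspace topology of the product topology. -/
@[reducible] def bsTopS : TopologicalSpace (XBarS E F V) :=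
  TopologicalSpace.induced Subtype.val
    (@Pi.topologicalSpace S (fun v => XBar (E v) F V) fun v => bsTop F V (E v))

/-- The space `𝔷_{F,S}(P)`. -/
abbrev ZSpS (P : ParFlag F V) := ∀ v, ZSp (E v) P

/-- The map `φ_{P,S}`. -/
def phiS (P : ParFlag F V) (x : XBarSP E P) : ZSpS E P := fun v => phi (E v) P (x.comp v)

variable (F V) in
/-- The Satake topology on `X̄_{F,S}`: the coarsest topology for which all the preimages of open sets
under the maps `X̄_{F,S}(P) → 𝔷_{F,S}(P) × ℝ_{≥0}^m` with second component
`(∏_{v ∈ S} t_{v,i})_i` are open. (These preimages do not depend on the choice of bases.) -/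
@[reducible] def satakeTopS [Fintype S] : TopologicalSpace (XBarS E F V) :=
  TopologicalSpace.generateFrom
    {U | ∃ (P : ParFlag F V) (e : ∀ v, GrBases (E v) P) (O : Set (ZSpS E P × (P.Inner → ℝ≥0))),
      IsOpen O ∧ U = Subtype.val ''
        {x : XBarSP E P | (phiS E P x, fun W => ∏ v, phi' (E v) P (e v) (x.comp v) W) ∈ O}}

/-- The quotient `P_u(𝔸_{F,S}) \ X̄_{F,S}(P)`. -/
abbrev QuotSP (P : ParFlag F V) := Quotient (MulAction.orbitRel (UniRadS E P) (XBarSP E P))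

/-- The class of an element of `X̄_{F,S}(P)` in `P_u(𝔸_{F,S}) \ X̄_{F,S}(P)`. -/
def QuotSP.mk {E : S → Type*} [∀ v, NormedField (E v)] [∀ v, Algebra F (E v)] {P : ParFlag F V}
    (x : XBarSP E P) : QuotSP E P := Quotient.mk _ x

/-- For a topology on `X̄_{F,S}`, the quotient topology on `P_u(𝔸_{F,S}) \ X̄_{F,S}(P)` of the
subspace topology on `X̄_{F,S}(P)`. -/
@[reducible] def quotTopS (P : ParFlag F V) (T : TopologicalSpace (XBarS E F V)) :
    TopologicalSpace (QuotSP E P) :=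
  TopologicalSpace.coinduced QuotSP.mk (TopologicalSpace.induced Subtype.val T)

end ManyPlaces

section OnePlaceSatake

variable (E : Type*) [NormedField E] {F V : Type*} [Field F]
  [AddCommGroup V] [Module F V] [FiniteDimensional F V] [Algebra F E]

variable (F V) in
/-- The Satake topology on `X̄_{F,v}`, which is `X̄_{F,S}` for `S = {v}`. -/
@[reducible] def satakeTop : TopologicalSpace (XBar E F V) :=
  TopologicalSpace.induced
    (fun x => (⟨fun _ => x, fun _ _ => rfl⟩ : XBarS (fun _ : Unit => E) F V))
    (satakeTopS (fun _ : Unit => E) F V)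

/-- The quotient `P_u(F_v) \ X̄_{F,v}(P)`. -/
abbrev QuotP (P : ParFlag F V) := Quotient (MulAction.orbitRel (UniRad E P) (XBarP E P))

/-- The class of an element of `X̄_{F,v}(P)` in `P_u(F_v) \ X̄_{F,v}(P)`. -/
def QuotP.mk {E : Type*} [NormedField E] [Algebra F E] {P : ParFlag F V} (x : XBarP E P) :
    QuotP E P := Quotient.mk _ x

/-- For a topology on `X̄_{F,v}`, the quotient topology on `P_u(F_v) \ X̄_{F,v}(P)` of the subspace
topology on `X̄_{F,v}(P)`. -/
@[reducible] def quotTop (P : ParFlag F V) (T : TopologicalSpace (XBar E F V)) :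
    TopologicalSpace (QuotP E P) :=
  TopologicalSpace.coinduced QuotP.mk (TopologicalSpace.induced Subtype.val T)

end OnePlaceSatake

/-! ### The space `Y_0` -/

section YSpace

/-- The set `ℝ_{>0}^S ∪ {(0)_{v ∈ S}}`. -/
def YFac (S : Type*) := {t : S → ℝ≥0 // (∀ v, 0 < t v) ∨ t = 0}

/-- The usual topology. -/
@[reducible] def YFac.usual (S : Type*) : TopologicalSpace (YFac S) :=
  inferInstanceAs (TopologicalSpace {t : S → ℝ≥0 // (∀ v, 0 < t v) ∨ t = 0})

/-- The weak topology: it restricts to the usual topology on `ℝ_{>0}^S`, and the sets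
`{t ∈ ℝ_{>0}^S | ∏ t_v ≤ c} ∪ {0}` with `c > 0` form a base of neighborhoods of `0`. -/
@[reducible] def YFac.weak (S : Type*) [Fintype S] : TopologicalSpace (YFac S) where
  IsOpen U := @IsOpen _ (YFac.usual S) {t | t ∈ U ∧ t.1 ≠ 0} ∧
    ((∃ t ∈ U, t.1 = 0) → ∃ c : ℝ≥0, 0 < c ∧ ∀ t : YFac S, t.1 = 0 ∨ ∏ v, t.1 v ≤ c → t ∈ U)
  isOpen_univ := by
    refine ⟨?_, fun _ => ⟨1, one_pos, fun _ _ => Set.mem_univ _⟩⟩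
    have h : IsOpen {x : S → ℝ≥0 | x ≠ 0} := isOpen_ne
    have := h.preimage (continuous_subtype_val (p := fun t : S → ℝ≥0 => (∀ v, 0 < t v) ∨ t = 0))
    simpa using! this
  isOpen_inter U U' hU hU' := by
    refine ⟨?_, ?_⟩
    · let _ : TopologicalSpace (YFac S) := YFac.usual S
      have := IsOpen.inter hU.1 hU'.1
      convert this using 1
      ext t
      simp only [Set.mem_inter_iff, Set.mem_ofPred_eq]
      tauto
    · rintro ⟨t, ⟨ht, ht'⟩, h0⟩
      obtain ⟨c, hc, h⟩ := hU.2 ⟨t, ht, h0⟩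
      obtain ⟨c', hc', h'⟩ := hU'.2 ⟨t, ht', h0⟩
      refine ⟨min c c', lt_min hc hc', fun x hx => ⟨h x ?_, h' x ?_⟩⟩
      · exact hx.imp_right fun hx => hx.trans (min_le_left _ _)
      · exact hx.imp_right fun hx => hx.trans (min_le_right _ _)
  isOpen_sUnion T hT := by
    refine ⟨?_, ?_⟩
    · have : {t | t ∈ ⋃₀ T ∧ t.1 ≠ 0} = ⋃ U ∈ T, {t : YFac S | t ∈ U ∧ t.1 ≠ 0} := by
        ext t
        simp only [Set.mem_sUnion, Set.mem_ofPred_eq, Set.mem_iUnion]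
        tauto
      rw [this]
      exact @isOpen_biUnion _ _ (YFac.usual S) _ _ fun U hU => (hT U hU).1
    · rintro ⟨t, ⟨U, hU, ht⟩, h0⟩
      obtain ⟨c, hc, h⟩ := (hT U hU).2 ⟨t, ht, h0⟩
      exact ⟨c, hc, fun x hx => ⟨U, hU, h x hx⟩⟩

/-- The set `Y_0 = (ℝ_{>0}^S ∪ {0})^m`, for the flag `P`. -/
abbrev YSp (S : Type*) {F V : Type*} [Field F] [AddCommGroup V] [Module F V] (P : ParFlag F V) :=
  P.Inner → YFac S

/-- For a topology on `ℝ_{>0}^S ∪ {0}`, the product topology on `Z × Y_0`. -/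
@[reducible] def prodTop {S F V : Type*} [Field F] [AddCommGroup V] [Module F V] (P : ParFlag F V)
    (Z : Type*) [TopologicalSpace Z] (T : TopologicalSpace (YFac S)) :
    TopologicalSpace (Z × YSp S P) :=
  @instTopologicalSpaceProd Z (YSp S P) inferInstance (@Pi.topologicalSpace P.Inner _ fun _ => T)

end YSpace

/-! ### Global fields and their places -/

section Global

/-- A global field: a number field, or a function field in one variable over a finite field, i.e.
a finite extension of `𝔽_p(T)` for a prime `p`. -/
def IsGlobalField (F : Type*) [Field F] : Prop :=
  NumberField F ∨ ∃ (p : ℕ) (_ : Fact p.Prime) (_ : Algebra (RatFunc (ZMod p)) F),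
    FiniteDimensional (RatFunc (ZMod p)) F

/-- Equivalence of nontrivial absolute values. -/
def placeSetoid (F : Type*) [Field F] : Setoid {v : AbsoluteValue F ℝ // v.IsNontrivial} where
  r v w := v.1.IsEquiv w.1
  iseqv :=
    { refl := fun _ => AbsoluteValue.IsEquiv.rfl
      symm := fun h => h.symm
      trans := fun h h' => h.trans h' }

/-- A place of `F`: an equivalence class of nontrivial absolute values. -/
def Place (F : Type*) [Field F] : Type _ := Quotient (placeSetoid F)

variable {F : Type*} [Field F]

/-- An absolute value representing the place. -/
def Place.abs (v : Place F) : AbsoluteValue F ℝ := (Quotient.out (s := placeSetoid F) v).1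

/-- The completion `F_v`. -/
abbrev Place.Compl (v : Place F) := v.abs.Completion

end Global

end RatCompact

end

open RatCompact

noncomputable section

open scoped NNReal TensorProduct Topology

namespace RatCompact

set_option linter.unusedSectionVars false

/-! ### Diagonal norms on coordinate spaces -/

section Diagonal

variable (E : Type*) [NormedField E]

/-! The proof rests on simultaneous diagonalization. Over a local field, every norm on a space with
an ordered basis `e` is diagonal in a translate of `e` by a unipotent upper triangular matrix
(`exists_UT`, a form of the Iwasawa decomposition), and its weights are then unique
(`weights_eq_of_UT`). The three kinds of norms are treated together through the axioms of
`LocField`; the essential one, `rotate`, is Gram–Schmidt in a plane. Uniqueness of the weights makes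
|μ : e| independent of choices (`absVal_basisNorm`). Moreover, the parametrization `utNorm` of norms
by unitriangular matrices and weights is a proper surjection (`isProperMap_utNorm`), and passage to
classes is an open quotient map. Hence the spaces 𝔷 are quotients of explicit spaces of matrices and
weights, even after products with another space, and continuity on them can be tested on matrices.

For a basis adapted to `P`, every point of X̄(P) is a unitriangular translate of a point with
diagonal norms (`exists_frame`). Passing to a subquotient of a diagonal norm just discards basis
vectors (`subquotNorm_subqBasis`). So φ sees the diagonal blocks of the matrix and the weights of
each block up to scaling, and φ' sees the relative scale of neighboring blocks, with the value 0
marking the members of the flag. The entries outside the diagonal blocks are removed by P_u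
(`exists_uniRad_block`). Two points with equal φ and φ' therefore have the same flag and, after a
move by P_u, norms that differ by one scalar on each graded piece of it (`exists_uniRad_smul_pt`);
this is injectivity. For surjectivity, a coordinate of φ' on a Borel–Serre chart is the chart
coordinate times a positive continuous factor (`phi'_chart`); dividing by that factor gives an
explicit preimage (`invPoint`).

By `isHomeomorph_of_section` it remains to see that ψ and this explicit section are continuous. Near
a point with flag `R` only flags contained in `R` occur. There φ_P is a continuous function of φ_R,
and each coordinate of φ'_P is either a positive continuous function of φ_R or such a function times
a coordinate of φ'_R (`phi_eq_phi_ptOf`, `phi'_eq_of_notMem`, `phi'_eq_of_mem`). This settles the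
Borel–Serre case. It also explains the weak topology: at the point, the coordinates belonging to `R`
vanish, and of these the Satake topology records only the product over the places, whereas the
remaining coordinates are determined place by place by φ_R. The Satake case of a single place is
deduced from a one-element index set.

That completions of global fields satisfy `LocField` is `locField_compl`. An archimedean completion
is ℝ or ℂ by Ostrowski's theorem and the classification of finite field extensions of ℝ. A
nonarchimedean one is locally compact because it contains a dense finite extension of ℚ or 𝔽_p(T),
and its normalized absolute value is a power of the norm (`exists_nabs_eq_rpow`). -/

open Classical in
/-- The sum of two values of norms on the two terms of an orthogonal decomposition. -/
def oadd (a b : ℝ≥0) : ℝ≥0 :=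
  if IsoReal E then NNReal.sqrt (a ^ 2 + b ^ 2) else if IsoComplex E then a + b else max a b

open Classical in
/-- The iterated version of `oadd`. -/
def osum {ι : Type*} (T : Finset ι) (f : ι → ℝ≥0) : ℝ≥0 :=
  if IsoReal E then NNReal.sqrt (∑ i ∈ T, f i ^ 2)
  else if IsoComplex E then ∑ i ∈ T, f i else T.sup f

theorem oadd_assoc (a b c : ℝ≥0) : oadd E (oadd E a b) c = oadd E a (oadd E b c) := by
  unfold oadd
  split_ifs
  · simp [add_assoc]
  · exact add_assoc _ _ _
  · exact max_assoc _ _ _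

variable {ι κ : Type*}

theorem osum_insert [DecidableEq ι] {T : Finset ι} {i : ι} (hi : i ∉ T) (f : ι → ℝ≥0) :
    osum E (insert i T) f = oadd E (f i) (osum E T f) := by
  unfold osum oadd
  split_ifs
  · simp [Finset.sum_insert hi]
  · simp [Finset.sum_insert hi]
  · simp

theorem osum_congr {T : Finset ι} {f g : ι → ℝ≥0} (h : ∀ i ∈ T, f i = g i) :
    osum E T f = osum E T g := by
  unfold osum
  rw [Finset.sum_congr rfl fun i hi => by rw [h i hi], Finset.sum_congr rfl h,
    Finset.sup_congr rfl h]

theorem osum_mono {T T' : Finset ι} {f g : ι → ℝ≥0} (hT : T ⊆ T') (h : ∀ i ∈ T, f i ≤ g i) :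
    osum E T f ≤ osum E T' g := by
  have h' : ∀ i ∈ T, f i ^ 2 ≤ g i ^ 2 := fun i hi => pow_le_pow_left₀ zero_le (h i hi) 2
  unfold osum
  split_ifs
  · exact NNReal.sqrt_le_sqrt.2 ((Finset.sum_le_sum h').trans (Finset.sum_le_sum_of_subset hT))
  · exact (Finset.sum_le_sum h).trans (Finset.sum_le_sum_of_subset hT)
  · exact (Finset.sup_mono_fun h).trans (Finset.sup_mono hT)

theorem osum_subset {T T' : Finset ι} {f : ι → ℝ≥0} (hT : T ⊆ T')
    (h : ∀ i ∈ T', i ∉ T → f i = 0) : osum E T f = osum E T' f := by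
  unfold osum
  rw [Finset.sum_subset hT fun i hi hi' => by rw [h i hi hi']; simp, Finset.sum_subset hT h]
  congr 2
  refine le_antisymm (Finset.sup_mono hT) (Finset.sup_le fun i hi => ?_)
  by_cases hi' : i ∈ T
  · exact Finset.le_sup hi'
  · rw [h i hi hi']
    exact zero_le

theorem osum_singleton (i : ι) (f : ι → ℝ≥0) : osum E {i} f = f i := by
  unfold osum
  split_ifs <;> simp

theorem le_osum {T : Finset ι} {i : ι} (hi : i ∈ T) (f : ι → ℝ≥0) : f i ≤ osum E T f := by
  rw [← osum_singleton E i f]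
  exact osum_mono E (by simpa) fun _ _ => le_rfl

theorem osum_le_sum (T : Finset ι) (f : ι → ℝ≥0) : osum E T f ≤ ∑ i ∈ T, f i := by
  classical
  unfold osum
  split_ifs
  · rw [NNReal.sqrt_le_iff_le_sq]
    exact Finset.sum_sq_le_sq_sum_of_nonneg fun _ _ => zero_le
  · exact le_rfl
  · exact Finset.sup_le fun i hi => Finset.single_le_sum (f := f) (fun _ _ => zero_le) hi

theorem mul_osum (c : ℝ≥0) (T : Finset ι) (f : ι → ℝ≥0) :
    c * osum E T f = osum E T fun i => c * f i := by
  unfold osum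
  split_ifs
  · simp_rw [mul_pow, ← Finset.mul_sum, NNReal.sqrt_mul, NNReal.sqrt_sq]
  · rw [Finset.mul_sum]
  · rw [NNReal.mul_finset_sup]

theorem osum_map (g : ι ↪ κ) (T : Finset ι) (f : κ → ℝ≥0) :
    osum E (T.map g) f = osum E T fun i => f (g i) := by
  unfold osum
  simp only [Finset.sum_map, Finset.sup_map]
  rfl

theorem osum_subtype (p : ι → Prop) [Fintype {i // p i}] [Fintype ι] [DecidablePred p]
    (f : ι → ℝ≥0) :
    osum E Finset.univ (fun i : {i // p i} => f i) = osum E (Finset.univ.filter p) f := by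
  refine (osum_map E (Function.Embedding.subtype p) Finset.univ f).symm.trans ?_
  congr 1
  ext i
  simp

/-- An iterated sum is determined by the partial sums over the fibers of a map. -/
theorem osum_fiberwise [DecidableEq κ] (b : ι → κ) (T : Finset ι) {f g : ι → ℝ≥0}
    (h : ∀ k ∈ T.image b,
      osum E (T.filter (b · = k)) f = osum E (T.filter (b · = k)) g) :
    osum E T f = osum E T g := by
  have hm : ∀ i ∈ T, b i ∈ T.image b := fun i hi => Finset.mem_image_of_mem b hi
  unfold osum at h ⊢
  split_ifs with h1 h2
  · simp only [if_pos h1] at h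
    rw [← Finset.sum_fiberwise_of_maps_to hm, ← Finset.sum_fiberwise_of_maps_to hm (fun i => g i ^ 2),
      Finset.sum_congr rfl fun k hk => NNReal.sqrt.injective (h k hk)]
  · simp only [if_neg h1, if_pos h2] at h
    rw [← Finset.sum_fiberwise_of_maps_to hm, ← Finset.sum_fiberwise_of_maps_to hm g,
      Finset.sum_congr rfl fun k hk => h k hk]
  · simp only [if_neg h1, if_neg h2] at h
    apply le_antisymm
    · refine Finset.sup_le fun i hi => ?_
      have h3 : f i ≤ (T.filter (b · = b i)).sup f := Finset.le_sup (by simpa using hi)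
      rw [h _ (hm i hi)] at h3
      exact h3.trans (Finset.sup_mono (Finset.filter_subset _ _))
    · refine Finset.sup_le fun i hi => ?_
      have h3 : g i ≤ (T.filter (b · = b i)).sup g := Finset.le_sup (by simpa using hi)
      rw [← h _ (hm i hi)] at h3
      exact h3.trans (Finset.sup_mono (Finset.filter_subset _ _))

theorem continuous_osum (T : Finset ι) : Continuous (osum E T) := by
  unfold osum
  split_ifs
  · fun_prop
  · fun_prop
  · exact Continuous.finset_sup_apply fun i _ => continuous_apply i

/-- The properties of the normalized absolute value of a local field that are used here. -/
class LocField : Prop where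
  nabs_one : nabs E 1 = 1
  nabs_mul : ∀ a b, nabs E (a * b) = nabs E a * nabs E b
  nabs_eq_zero : ∀ a, nabs E a = 0 ↔ a = 0
  continuous_nabs : Continuous (nabs E)
  isCompact_nabs_le : ∀ C : ℝ≥0, IsCompact {a | nabs E a ≤ C}
  exists_one_lt : ∃ a, 1 < nabs E a
  nabs_add_le : ∀ a b, nabs E (a + b) ≤ 2 * (nabs E a + nabs E b)
  /-- Every nonzero vector in a plane with a diagonal norm belongs to an orthogonal basis. -/
  rotate : ∀ (a b : E) (r s : ℝ≥0), 0 < r → 0 < s → (a ≠ 0 ∨ b ≠ 0) →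
    ∃ (m₁ m₂ m₃ m₄ : E) (r' s' : ℝ≥0), 0 < r' ∧ 0 < s' ∧ m₃ * a + m₄ * b = 0 ∧
      nabs E (m₁ * m₄ - m₂ * m₃) * (r' * s') = r * s ∧
      ∀ x y, oadd E (r' * nabs E (m₁ * x + m₂ * y)) (s' * nabs E (m₃ * x + m₄ * y)) =
        oadd E (r * nabs E x) (s * nabs E y)

/-- The norm on a coordinate space given by the standard basis and the tuple `r`. -/
def wnorm [Fintype ι] (r : ι → ℝ≥0) (z : ι → E) : ℝ≥0 :=
  osum E Finset.univ fun i => r i * nabs E (z i)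

theorem basisNorm_eq {H : Type*} [AddCommGroup H] [Module E H] [Fintype ι]
    (b : Module.Basis ι E H) (r : ι → ℝ≥0) (x : H) :
    basisNorm b r x = wnorm E r (b.repr x) := by
  simp only [basisNorm, wnorm, osum, mul_pow]

end Diagonal

/-! ### Consequences of the axioms, and rotations of coordinate spaces -/

section LocalField

variable {E : Type*} [NormedField E] [LocField E] {ι : Type*}

open LocField

theorem nabs_zero : nabs E 0 = 0 := (nabs_eq_zero 0).2 rfl

theorem nabs_pos {a : E} (h : a ≠ 0) : 0 < nabs E a :=
  pos_of_ne_zero fun h0 => h ((nabs_eq_zero a).1 h0)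

variable (E) in
/-- The normalized absolute value as a homomorphism. -/
def nabsHom : E →*₀ ℝ≥0 where
  toFun := nabs E
  map_zero' := nabs_zero
  map_one' := nabs_one
  map_mul' := nabs_mul

theorem nabs_inv (a : E) : nabs E a⁻¹ = (nabs E a)⁻¹ := map_inv₀ (nabsHom E) a

theorem nabs_prod (T : Finset ι) (f : ι → E) : nabs E (∏ i ∈ T, f i) = ∏ i ∈ T, nabs E (f i) :=
  map_prod (nabsHom E) f T

theorem nabs_pow (a : E) (n : ℕ) : nabs E (a ^ n) = nabs E a ^ n := map_pow (nabsHom E) a n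

/-- On ℂ the normalized absolute value is a square, so it satisfies the triangle inequality only up
to a factor. A constant depending on the number of summands is enough for the compactness estimates.
-/
theorem exists_nabs_sum_le (T : Finset ι) :
    ∃ K : ℝ≥0, ∀ f : ι → E, nabs E (∑ i ∈ T, f i) ≤ K * ∑ i ∈ T, nabs E (f i) := by
  classical
  induction T using Finset.induction_on with
  | empty => exact ⟨0, fun f => by simp [nabs_zero]⟩
  | insert i T hi ih =>
    obtain ⟨K, hK⟩ := ih
    refine ⟨2 * (1 + K), fun f => ?_⟩
    rw [Finset.sum_insert hi, Finset.sum_insert hi]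
    refine (nabs_add_le _ _).trans ?_
    rw [mul_assoc]
    refine mul_le_mul_of_nonneg_left ?_ zero_le
    rw [mul_add]
    refine add_le_add (le_mul_of_one_le_left zero_le (by simp)) ((hK f).trans ?_)
    gcongr
    simp

variable [Fintype ι] {r r' : ι → ℝ≥0}

theorem wnorm_smul (r : ι → ℝ≥0) (c : E) (z : ι → E) :
    wnorm E r (c • z) = nabs E c * wnorm E r z := by
  simp only [wnorm, mul_osum, Pi.smul_apply, smul_eq_mul, nabs_mul, mul_left_comm]

theorem wnorm_const_mul (c : ℝ≥0) (r : ι → ℝ≥0) (z : ι → E) :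
    wnorm E (fun i => c * r i) z = c * wnorm E r z := by
  simp only [wnorm, mul_osum, mul_assoc]

theorem le_wnorm (r : ι → ℝ≥0) (z : ι → E) (i : ι) : r i * nabs E (z i) ≤ wnorm E r z :=
  le_osum E (Finset.mem_univ i) fun i => r i * nabs E (z i)

theorem wnorm_single [DecidableEq ι] (r : ι → ℝ≥0) (i : ι) (c : E) :
    wnorm E r (Pi.single i c) = r i * nabs E c := by
  apply le_antisymm
  · refine (osum_le_sum E _ _).trans ?_
    rw [Finset.sum_eq_single i]
    · simp
    · intro j _ hj
      simp [Pi.single_eq_of_ne hj, nabs_zero]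
    · simp
  · simpa using le_wnorm r (Pi.single i c) i

theorem wnorm_add_le (r : ι → ℝ≥0) (y z : ι → E) :
    wnorm E r (y + z) ≤ 2 * Fintype.card ι * (wnorm E r y + wnorm E r z) := by
  refine (osum_le_sum E _ _).trans ?_
  calc ∑ i, r i * nabs E ((y + z) i)
      ≤ ∑ _i : ι, 2 * (wnorm E r y + wnorm E r z) := by
        refine Finset.sum_le_sum fun i _ => ?_
        calc r i * nabs E (y i + z i) ≤ r i * (2 * (nabs E (y i) + nabs E (z i))) := by
              gcongr
              exact nabs_add_le _ _
          _ = 2 * (r i * nabs E (y i) + r i * nabs E (z i)) := by ring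
          _ ≤ _ := by
              gcongr
              · exact le_wnorm r y i
              · exact le_wnorm r z i
    _ = _ := by
        rw [Finset.sum_const, Finset.card_univ, nsmul_eq_mul]
        ring

theorem _root_.Continuous.wnorm {X : Type*} [TopologicalSpace X] {f : X → ι → ℝ≥0}
    {g : X → ι → E} (hf : Continuous f) (hg : Continuous g) :
    Continuous fun y => wnorm E (f y) (g y) := by
  have h : Continuous fun y => fun i => f y i * nabs E (g y i) :=
    continuous_pi fun i => ((continuous_apply i).comp hf).mul
      ((continuous_nabs (E := E)).comp ((continuous_apply i).comp hg))
  exact (continuous_osum E Finset.univ).comp h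

theorem wnorm_eq_zero (hr : ∀ i, 0 < r i) {z : ι → E} : wnorm E r z = 0 ↔ z = 0 := by
  constructor
  · intro h
    funext i
    have := le_wnorm r z i
    rw [h, nonpos_iff_eq_zero, mul_eq_zero, nabs_eq_zero] at this
    exact this.resolve_left (hr i).ne'
  · rintro rfl
    have := osum_le_sum E Finset.univ fun i => r i * nabs E ((0 : ι → E) i)
    simpa [nabs_zero, wnorm] using this

/-! ### Orthogonalization -/

variable [DecidableEq ι]

/-- The matrix `M` takes the norm given by `r` to the norm given by `r'`, and has the corresponding
determinant. -/
def IsoW (r r' : ι → ℝ≥0) (M : Matrix ι ι E) : Prop :=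
  (∀ z, wnorm E r' (M.mulVec z) = wnorm E r z) ∧ nabs E M.det * ∏ i, r' i = ∏ i, r i

theorem IsoW.one (r : ι → ℝ≥0) : IsoW r r (1 : Matrix ι ι E) := by
  simp [IsoW, nabs_one]

theorem IsoW.mul {r₁ r₂ r₃ : ι → ℝ≥0} {M N : Matrix ι ι E} (hM : IsoW r₂ r₃ M)
    (hN : IsoW r₁ r₂ N) : IsoW r₁ r₃ (M * N) := by
  refine ⟨fun z => ?_, ?_⟩
  · rw [← Matrix.mulVec_mulVec, hM.1, hN.1]
  · rw [Matrix.det_mul, nabs_mul, ← hN.2, ← hM.2]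
    ring

/-- Multilinearity in the two rows leaves four determinants: two have a repeated row and vanish, one
is that of the identity and one that of a transposition. -/
theorem det_two_rows {p i : ι} (hpi : p ≠ i) (m₁ m₂ m₃ m₄ : E) :
    Matrix.det (((1 : Matrix ι ι E).updateRow p (m₁ • Pi.single p 1 + m₂ • Pi.single i 1)).updateRow
      i (m₃ • Pi.single p 1 + m₄ • Pi.single i 1)) = m₁ * m₄ - m₂ * m₃ := by
  rw [Matrix.det_updateRow_add, Matrix.det_updateRow_smul, Matrix.det_updateRow_smul,
    Matrix.updateRow_comm _ hpi, Matrix.det_updateRow_add, Matrix.det_updateRow_smul,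
    Matrix.det_updateRow_smul, Matrix.updateRow_comm _ hpi, Matrix.det_updateRow_add,
    Matrix.det_updateRow_smul, Matrix.det_updateRow_smul]
  have h1 : ((1 : Matrix ι ι E).updateRow i (Pi.single p 1)).updateRow p (Pi.single p 1) =
      (1 : Matrix ι ι E).updateRow i (Pi.single p 1) := by
    ext a b
    by_cases ha : a = p
    · subst ha
      simp [Matrix.updateRow_ne hpi, Matrix.one_apply, Pi.single_apply, eq_comm]
    · simp [Matrix.updateRow_ne ha]
  have h2 : ((1 : Matrix ι ι E).updateRow i (Pi.single i 1)) = 1 := by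
    ext a b
    by_cases ha : a = i
    · subst ha
      simp [Matrix.one_apply, Pi.single_apply, eq_comm]
    · simp [Matrix.updateRow_ne ha]
  have h3 : ((1 : Matrix ι ι E).updateRow p (Pi.single p 1)) = 1 := by
    ext a b
    by_cases ha : a = p
    · subst ha
      simp [Matrix.one_apply, Pi.single_apply, eq_comm]
    · simp [Matrix.updateRow_ne ha]
  have h4 : Matrix.det ((1 : Matrix ι ι E).updateRow i (Pi.single p 1)) = 0 := by
    refine Matrix.det_zero_of_row_eq hpi ?_
    rw [Matrix.updateRow_self, Matrix.updateRow_ne hpi]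
    ext b
    simp [Matrix.one_apply, Pi.single_apply, eq_comm]
  have h5 : Matrix.det (((1 : Matrix ι ι E).updateRow i (Pi.single p 1)).updateRow p
      (Pi.single i 1)) = -1 := by
    have : (((1 : Matrix ι ι E).updateRow i (Pi.single p 1)).updateRow p (Pi.single i 1)) =
        (1 : Matrix ι ι E).submatrix (Equiv.swap p i) id := by
      ext a b
      by_cases ha : a = p
      · subst ha
        simp [Matrix.one_apply, Pi.single_apply, eq_comm]
      · by_cases ha' : a = i
        · subst ha'
          simp [Matrix.updateRow_ne ha, Matrix.one_apply, Pi.single_apply, eq_comm]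
        · rw [Matrix.updateRow_ne ha, Matrix.updateRow_ne ha', Matrix.submatrix_apply,
            Equiv.swap_apply_of_ne_of_ne ha ha', id]
    rw [this, Matrix.det_permute]
    simp [Equiv.Perm.sign_swap hpi]
  have h6 : Matrix.det ((1 : Matrix ι ι E).updateRow p (Pi.single i 1)) = 0 := by
    refine Matrix.det_zero_of_row_eq hpi ?_
    rw [Matrix.updateRow_self, Matrix.updateRow_ne hpi.symm]
    ext b
    simp [Matrix.one_apply, Pi.single_apply, eq_comm]
  rw [h1, h4, h5, h2, h3, h6]
  simp
  ring

/-- This is `rotate` in the plane of the coordinates `p` and `i`, extended by the identity, as in a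
Givens rotation. The clause on vectors vanishing at `p` and `i` is what preserves the zeros of
columns already treated. -/
theorem exists_isoW_pair (hr : ∀ j, 0 < r j) (a : ι → E) {p i : ι} (hpi : p ≠ i) :
    ∃ (M : Matrix ι ι E) (r' : ι → ℝ≥0), (∀ j, 0 < r' j) ∧ IsoW r r' M ∧
      (∀ z k, k ≠ p → k ≠ i → M.mulVec z k = z k) ∧
      (∀ z, z p = 0 → z i = 0 → M.mulVec z p = 0 ∧ M.mulVec z i = 0) ∧ M.mulVec a i = 0 := by
  by_cases ha : a p ≠ 0 ∨ a i ≠ 0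
  swap
  · push Not at ha
    exact ⟨1, r, hr, IsoW.one r, fun z k _ _ => by simp, fun z h h' => by simp [h, h'],
      by simp [ha.2]⟩
  obtain ⟨m₁, m₂, m₃, m₄, s, t, hs, ht, h0, hdet, hN⟩ :=
    rotate (a p) (a i) (r p) (r i) (hr p) (hr i) ha
  set M : Matrix ι ι E := (((1 : Matrix ι ι E).updateRow p
    (m₁ • Pi.single p 1 + m₂ • Pi.single i 1)).updateRow i
      (m₃ • Pi.single p 1 + m₄ • Pi.single i 1)) with hM
  have hk : ∀ z k, k ≠ p → k ≠ i → M.mulVec z k = z k := by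
    intro z k hkp hki
    have : M k = (1 : Matrix ι ι E) k := by
      rw [hM, Matrix.updateRow_ne hki, Matrix.updateRow_ne hkp]
    rw [Matrix.mulVec, this]
    exact congrFun (Matrix.one_mulVec z) k
  have hp : ∀ z, M.mulVec z p = m₁ * z p + m₂ * z i := by
    intro z
    have : M p = m₁ • Pi.single p 1 + m₂ • Pi.single i 1 := by
      rw [hM, Matrix.updateRow_ne hpi, Matrix.updateRow_self]
    rw [Matrix.mulVec, this]
    rw [add_dotProduct, smul_dotProduct, smul_dotProduct]
    simp
  have hi : ∀ z, M.mulVec z i = m₃ * z p + m₄ * z i := by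
    intro z
    have : M i = m₃ • Pi.single p 1 + m₄ • Pi.single i 1 := by
      rw [hM, Matrix.updateRow_self]
    rw [Matrix.mulVec, this]
    rw [add_dotProduct, smul_dotProduct, smul_dotProduct]
    simp
  have huniv : (Finset.univ : Finset ι) = insert p (insert i (Finset.univ \ {p, i})) := by
    ext j
    simp only [Finset.mem_univ, Finset.mem_insert, Finset.mem_sdiff, Finset.mem_singleton]
    tauto
  have hp' : p ∉ insert i (Finset.univ \ {p, i}) := by simp [hpi]
  have hi' : i ∉ Finset.univ \ {p, i} := by simp
  refine ⟨M, Function.update (Function.update r p s) i t, ?_, ⟨fun z => ?_, ?_⟩, hk,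
    fun z h1 h2 => by simp [hp, hi, h1, h2], by rw [hi, h0]⟩
  · intro j
    by_cases hj : j = i
    · subst hj; simpa
    · by_cases hj' : j = p
      · subst hj'; simpa [hj]
      · simpa [hj, hj'] using hr j
  -- After `p` and `i` are split off, associativity of `oadd` groups their two terms into the
  -- expression that `hN` leaves invariant.
  · unfold wnorm
    rw [huniv, osum_insert E hp', osum_insert E hi', osum_insert E hp', osum_insert E hi',
      ← oadd_assoc, ← oadd_assoc, hp, hi]
    simp only [Function.update_self, Function.update_of_ne hpi]
    rw [hN]
    congr 1
    refine osum_congr E fun j hj => ?_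
    simp only [Finset.mem_sdiff, Finset.mem_univ, Finset.mem_insert, Finset.mem_singleton,
      not_or, true_and] at hj
    rw [hk z j hj.1 hj.2, Function.update_of_ne hj.2, Function.update_of_ne hj.1]
  · rw [hM, det_two_rows hpi, huniv, Finset.prod_insert hp', Finset.prod_insert hi',
      Finset.prod_insert hp', Finset.prod_insert hi']
    simp only [Function.update_self, Function.update_of_ne hpi]
    rw [← mul_assoc (r p), ← hdet, ← mul_assoc s, ← mul_assoc (nabs E _)]
    congr 1
    refine Finset.prod_congr rfl fun j hj => ?_
    simp only [Finset.mem_sdiff, Finset.mem_univ, Finset.mem_insert, Finset.mem_singleton,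
      not_or, true_and] at hj
    rw [Function.update_of_ne hj.2, Function.update_of_ne hj.1]

/-- The entries in `T` are cleared one at a time by rotations against the pivot `p`. A later
rotation moves only `p` and its own index, so it does not disturb earlier zeros. -/
theorem exists_isoW_column (hr : ∀ j, 0 < r j) (a : ι → E) (p : ι) (T : Finset ι) (hp : p ∉ T) :
    ∃ (M : Matrix ι ι E) (r' : ι → ℝ≥0), (∀ j, 0 < r' j) ∧ IsoW r r' M ∧
      (∀ z k, k ≠ p → k ∉ T → M.mulVec z k = z k) ∧
      (∀ z, z p = 0 → (∀ i ∈ T, z i = 0) → M.mulVec z p = 0 ∧ ∀ i ∈ T, M.mulVec z i = 0) ∧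
      ∀ i ∈ T, M.mulVec a i = 0 := by
  induction T using Finset.induction_on with
  | empty => exact ⟨1, r, hr, IsoW.one r, by simp, by simp, by simp⟩
  | insert i T hi ih =>
    obtain ⟨M, s, hs, hM, h1, h2, h3⟩ := ih fun h => hp (Finset.mem_insert_of_mem h)
    have hpi : p ≠ i := fun h => hp (h ▸ Finset.mem_insert_self _ _)
    have hpT : p ∉ T := fun h => hp (Finset.mem_insert_of_mem h)
    obtain ⟨N, t, ht, hN, k1, k2, k3⟩ := exists_isoW_pair hs (M.mulVec a) hpi
    refine ⟨N * M, t, ht, hN.mul hM, fun z k hkp hk => ?_, fun z hzp hz => ?_, fun j hj => ?_⟩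
    · rw [Finset.mem_insert, not_or] at hk
      rw [← Matrix.mulVec_mulVec, k1 _ _ hkp hk.1, h1 _ _ hkp hk.2]
    · obtain ⟨e1, e2⟩ := h2 z hzp fun j hj => hz j (Finset.mem_insert_of_mem hj)
      have e3 : M.mulVec z i = 0 := by
        rw [h1 z i hpi.symm hi]
        exact hz i (Finset.mem_insert_self _ _)
      obtain ⟨e4, e5⟩ := k2 _ e1 e3
      rw [← Matrix.mulVec_mulVec]
      refine ⟨e4, fun j hj => ?_⟩
      rcases Finset.mem_insert.1 hj with rfl | hj
      · exact e5
      · rw [k1 _ _ (fun h => hpT (h ▸ hj)) fun h => hi (h ▸ hj)]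
        exact e2 j hj
    · rw [← Matrix.mulVec_mulVec]
      rcases Finset.mem_insert.1 hj with rfl | hj
      · exact k3
      · rw [k1 _ _ (fun h => hpT (h ▸ hj)) fun h => hi (h ▸ hj)]
        exact h3 j hj

end LocalField

/-! ### Reduction to triangular form (Iwasawa decomposition) -/

section Triangular

variable {E : Type*} [NormedField E] [LocField E] {ι : Type*} [Fintype ι] [LinearOrder ι]
  {r : ι → ℝ≥0}

open LocField

/-- Columns are cleared in increasing order. The rotations for column `p` involve only the rows from
`p` on, where all earlier columns already vanish and hence stay zero. -/
theorem exists_isoW_triangular (hr : ∀ j, 0 < r j) (G : Matrix ι ι E) (C : Finset ι) :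
    ∃ (M : Matrix ι ι E) (r' : ι → ℝ≥0), (∀ j, 0 < r' j) ∧ IsoW r r' M ∧
      ∀ j ∈ C, ∀ i, j < i → (M * G) i j = 0 := by
  induction C using Finset.induction_on_max with
  | empty => exact ⟨1, r, hr, IsoW.one r, by simp⟩
  | insert p C hC ih =>
    obtain ⟨M, s, hs, hM, h1⟩ := ih
    obtain ⟨N, t, ht, hN, k1, k2, k3⟩ := exists_isoW_column hs (fun i => (M * G) i p) p
      (Finset.univ.filter (p < ·)) (by simp)
    refine ⟨N * M, t, ht, hN.mul hM, fun j hj i hij => ?_⟩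
    rw [Matrix.mul_assoc]
    change N.mulVec (fun i => (M * G) i j) i = 0
    rcases Finset.mem_insert.1 hj with rfl | hj
    · exact k3 i (by simpa)
    · have hjp := hC j hj
      obtain ⟨e1, e2⟩ := k2 (fun i => (M * G) i j) (h1 j hj p hjp) fun i hi =>
        h1 j hj i (hjp.trans (by simpa using hi))
      rcases lt_trichotomy p i with h | rfl | h
      · exact e2 i (by simpa)
      · exact e1
      · rw [k1 _ _ h.ne (by simpa using h.le)]
        exact h1 j hj i hij

/-- Upper triangular matrices with ones on the diagonal. -/
abbrev UT (E ι : Type*) [NormedField E] [LinearOrder ι] := {A : Matrix ι ι E // (∀ i, A i i = 1) ∧ ∀ i j, j < i → A i j = 0}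

theorem UT.det (A : UT E ι) :
    A.1.det = 1 := by
  rw [Matrix.det_of_isUpperTriangular fun i j h => A.2.2 i j h]
  simp [A.2.1]

/-- Every diagonal norm is diagonal in a basis that is obtained from a given one by a unipotent
upper triangular matrix. -/
theorem exists_UT (hr : ∀ j, 0 < r j) (G : Matrix ι ι E) (hG : G.det ≠ 0) :
    ∃ (A : UT E ι) (r' : ι → ℝ≥0), (∀ j, 0 < r' j) ∧
      (∀ z, wnorm E r (G.mulVec z) = wnorm E r' (A.1.mulVec z)) ∧
      ∏ i, r' i = nabs E G.det * ∏ i, r i := by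
  obtain ⟨M, s, hs, hM, h1⟩ := exists_isoW_triangular hr G Finset.univ
  have htri : (M * G).IsUpperTriangular := fun i j hij => h1 j (Finset.mem_univ j) i hij
  have hM0 : M.det ≠ 0 := by
    intro h
    have := hM.2
    rw [h, nabs_zero, zero_mul] at this
    exact (Finset.prod_pos fun i _ => hr i).ne this
  have hd : ∏ i, (M * G) i i ≠ 0 := by
    rw [← Matrix.det_of_isUpperTriangular htri, Matrix.det_mul]
    exact mul_ne_zero hM0 hG
  have hd' : ∀ i, (M * G) i i ≠ 0 := fun i => Finset.prod_ne_zero_iff.1 hd i (Finset.mem_univ i)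
  -- Dividing each row of the triangular matrix by its diagonal entry makes it unipotent; the
  -- absolute values of these entries are absorbed into the weights.
  refine ⟨⟨fun i j => ((M * G) i i)⁻¹ * (M * G) i j, fun i => inv_mul_cancel₀ (hd' i),
    fun i j hij => by
      change ((M * G) i i)⁻¹ * (M * G) i j = 0
      rw [h1 j (Finset.mem_univ j) i hij, mul_zero]⟩,
    fun i => s i * nabs E ((M * G) i i), fun i => mul_pos (hs i) (nabs_pos (hd' i)),
    fun z => ?_, ?_⟩
  · rw [← hM.1, Matrix.mulVec_mulVec]
    refine osum_congr E fun i _ => ?_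
    rw [mul_assoc, ← nabs_mul]
    congr 2
    simp only [Matrix.mulVec, dotProduct, Finset.mul_sum]
    refine Finset.sum_congr rfl fun j _ => ?_
    rw [← mul_assoc, mul_inv_cancel_left₀ (hd' i)]
  · rw [Finset.prod_mul_distrib, ← nabs_prod, ← Matrix.det_of_isUpperTriangular htri,
      Matrix.det_mul, nabs_mul, ← hM.2]
    ring

end Triangular

/-! ### Norms and bases -/

section NormBasis

variable {E : Type*} [NormedField E] [LocField E] {ι : Type*} [Fintype ι] [LinearOrder ι]
  {H : Type*} [AddCommGroup H] [Module E H]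

open LocField

/-- The inverse of an upper unitriangular matrix. -/
def UT.inv (A : UT E ι) : UT E ι := by
  have hdet : IsUnit A.1.det := by rw [A.det]; exact isUnit_one
  have hinv := Matrix.invertibleOfIsUnitDet A.1 hdet
  have ht : (A.1⁻¹).BlockTriangular id :=
    Matrix.blockTriangular_inv_of_blockTriangular fun i j h => A.2.2 i j h
  refine ⟨A.1⁻¹, fun i => ?_, fun i j h => ht h⟩
  have h1 : (A.1 * A.1⁻¹) i i = 1 := by
    rw [Matrix.mul_nonsing_inv _ hdet, Matrix.one_apply_eq]
  rw [Matrix.mul_apply, Finset.sum_eq_single i] at h1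
  · rwa [A.2.1, one_mul] at h1
  · intro j _ hj
    rcases hj.lt_or_gt with h | h
    · rw [A.2.2 i j h, zero_mul]
    · rw [ht h, mul_zero]
  · simp

theorem UT.mul_inv (A : UT E ι) : A.1 * A.inv.1 = 1 :=
  Matrix.mul_nonsing_inv _ (by rw [A.det]; exact isUnit_one)

theorem UT.inv_mul (A : UT E ι) : A.inv.1 * A.1 = 1 :=
  Matrix.nonsing_inv_mul _ (by rw [A.det]; exact isUnit_one)

theorem UT.exists_mulVec_eq_single (A : UT E ι) (i : ι) :
    ∃ z : ι → E, A.1.mulVec z = Pi.single i 1 ∧ z i = 1 ∧ ∀ j, i < j → z j = 0 := by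
  refine ⟨A.inv.1.mulVec (Pi.single i 1), ?_, ?_, fun j hj => ?_⟩
  · rw [Matrix.mulVec_mulVec, A.mul_inv, Matrix.one_mulVec]
  · rw [Matrix.mulVec_single_one, Matrix.col_apply, A.inv.2.1]
  · rw [Matrix.mulVec_single_one, Matrix.col_apply, A.inv.2.2 j i hj]

theorem UT.mulVec_apply_of_support (A : UT E ι) {i : ι} {z : ι → E} (hz : ∀ j, i < j → z j = 0) :
    A.1.mulVec z i = z i := by
  rw [Matrix.mulVec, dotProduct, Finset.sum_eq_single i]
  · rw [A.2.1, one_mul]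
  · intro j _ hj
    rcases hj.lt_or_gt with h | h
    · rw [A.2.2 i j h, zero_mul]
    · rw [hz j h, mul_zero]
  · simp

/-- The vector that `A'` sends to the `i`-th unit vector has `i`-th coordinate 1 and no coordinates
beyond `i`, so its image under `A` also has `i`-th coordinate 1. Its norm is `r' i` in one
presentation and at least `r i` in the other. -/
theorem weights_le_of_UT {A A' : UT E ι} {r r' : ι → ℝ≥0}
    (h : ∀ z, wnorm E r (A.1.mulVec z) = wnorm E r' (A'.1.mulVec z)) (i : ι) : r i ≤ r' i := by
  obtain ⟨z, hz, hz1, hz2⟩ := A'.exists_mulVec_eq_single i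
  have h1 := le_wnorm r (A.1.mulVec z) i
  rw [h, hz, wnorm_single, A.mulVec_apply_of_support hz2, hz1, nabs_one, mul_one] at h1
  simpa using h1

theorem weights_eq_of_UT {A A' : UT E ι} {r r' : ι → ℝ≥0}
    (h : ∀ z, wnorm E r (A.1.mulVec z) = wnorm E r' (A'.1.mulVec z)) : r = r' :=
  funext fun i => le_antisymm (weights_le_of_UT h i) (weights_le_of_UT (fun z => (h z).symm) i)

/-- The basis whose coordinate vectors are obtained from those of `e` by applying a matrix. -/
def twBasis (e : Module.Basis ι E H) (A : UT E ι) : Module.Basis ι E H :=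
  Module.Basis.ofEquivFun (e.equivFun ≪≫ₗ
    LinearEquiv.ofLinearMap (Matrix.toLin' A.1) (Matrix.toLin' A.inv.1)
      (by rw [← Matrix.toLin'_mul, A.mul_inv, Matrix.toLin'_one])
      (by rw [← Matrix.toLin'_mul, A.inv_mul, Matrix.toLin'_one]))

theorem twBasis_repr (e : Module.Basis ι E H) (A : UT E ι) (x : H) :
    ⇑((twBasis e A).repr x) = A.1.mulVec (e.repr x) := by
  rw [← Module.Basis.equivFun_apply, twBasis, Module.Basis.equivFun_ofEquivFun]
  rfl

/-- Positive tuples. -/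
abbrev Pos (ι : Type*) := {r : ι → ℝ≥0 // ∀ i, 0 < r i}

/-- The norm given by a basis, a unitriangular matrix and a tuple of weights. -/
def utNorm (e : Module.Basis ι E H) (y : UT E ι × Pos ι) : NormOn E H :=
  ⟨basisNorm (twBasis e y.1) y.2.1, isNorm_basisNorm _ _ y.2.2⟩

theorem utNorm_apply (e : Module.Basis ι E H) (y : UT E ι × Pos ι) (x : H) :
    (utNorm e y).1 x = wnorm E y.2.1 (y.1.1.mulVec (e.repr x)) := by
  change basisNorm (twBasis e y.1) y.2.1 x = _
  rw [basisNorm_eq, twBasis_repr]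

/-- The product of the unitriangular weights is the quantity |μ : e|. Since those weights depend
only on the norm, so does |μ : e|. -/
theorem basisNorm_exists_UT (e b : Module.Basis ι E H) {r : ι → ℝ≥0} (hr : ∀ i, 0 < r i) :
    ∃ y : UT E ι × Pos ι, (utNorm e y).1 = basisNorm b r ∧
      ∏ i, y.2.1 i = (nabs E (e.det b))⁻¹ * ∏ i, r i := by
  have hdet : b.det e * e.det b = 1 := by
    rw [Module.Basis.det_apply, Module.Basis.det_apply, ← Matrix.det_mul,
      Module.Basis.toMatrix_mul_toMatrix, Module.Basis.toMatrix_self, Matrix.det_one]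
  have h0 : (b.toMatrix e).det ≠ 0 := by
    rw [← Module.Basis.det_apply]
    exact left_ne_zero_of_mul_eq_one hdet
  obtain ⟨A, s, hs, h1, h2⟩ := exists_UT hr _ h0
  refine ⟨(A, ⟨s, hs⟩), ?_, ?_⟩
  · funext x
    rw [utNorm_apply, ← h1, Module.Basis.toMatrix_mulVec_repr, basisNorm_eq]
  · rw [← nabs_inv, eq_inv_of_mul_eq_one_right hdet, inv_inv]
    exact h2

theorem utNorm_surjective (e : Module.Basis ι E H) : Function.Surjective (utNorm e) := by
  rintro ⟨μ, b, r, hr, rfl⟩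
  have hc : Fintype.card (Fin (Module.finrank E H)) = Fintype.card ι := by
    rw [Fintype.card_fin]
    exact Module.finrank_eq_card_basis e
  let f : Fin (Module.finrank E H) ≃ ι := Fintype.equivOfCardEq hc
  obtain ⟨y, hy, -⟩ := basisNorm_exists_UT e (b.reindex f) (r := r ∘ f.symm) fun i => hr _
  exact ⟨y, Subtype.ext (hy.trans (basisNorm_reindex b r f))⟩

/-- `absVal` is defined by an arbitrarily chosen presentation of the norm. Both that one and the
given one are compared with unitriangular presentations relative to `e`, which have the same
weights. -/
theorem absVal_basisNorm {κ : Type*} [Fintype κ]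
    (e : Module.Basis (Fin (Module.finrank E H)) E H) (b : Module.Basis κ E H)
    (σ : κ ≃ Fin (Module.finrank E H)) {r : κ → ℝ≥0} (hr : ∀ i, 0 < r i) :
    absVal e (basisNorm b r) = (nabs E (e.det (b.reindex σ)))⁻¹ * ∏ i, r i := by
  have h : IsNorm E (basisNorm b r) := isNorm_basisNorm b r hr
  rw [absVal, dif_pos h]
  obtain ⟨y, hy, hp⟩ := basisNorm_exists_UT e h.choose h.choose_spec.choose_spec.1
  obtain ⟨y', hy', hp'⟩ := basisNorm_exists_UT e (b.reindex σ) (r := r ∘ σ.symm) fun i => hr _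
  rw [h.choose_spec.choose_spec.2] at hy
  rw [basisNorm_reindex] at hy'
  have hz : ∀ z, wnorm E y.2.1 (y.1.1.mulVec z) = wnorm E y'.2.1 (y'.1.1.mulVec z) := by
    intro z
    have h1 := utNorm_apply e y (e.equivFun.symm z)
    have h2 := utNorm_apply e y' (e.equivFun.symm z)
    rw [hy, ← Module.Basis.equivFun_apply, LinearEquiv.apply_symm_apply] at h1
    rw [hy', ← Module.Basis.equivFun_apply, LinearEquiv.apply_symm_apply] at h2
    exact h1.symm.trans h2
  rw [← hp, weights_eq_of_UT hz, hp']
  congr 1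
  exact Equiv.prod_comp σ.symm r

theorem det_twBasis (e' : Module.Basis (Fin (Module.finrank E H)) E H) (e : Module.Basis ι E H)
    (σ : ι ≃ Fin (Module.finrank E H)) (A : UT E ι) :
    e'.det ((twBasis e A).reindex σ) = e'.det (e.reindex σ) := by
  have h : e'.toMatrix (e.reindex σ) =
      e'.toMatrix ((twBasis e A).reindex σ) * A.1.submatrix σ.symm σ.symm := by
    rw [← Module.Basis.toMatrix_mul_toMatrix e' ((twBasis e A).reindex σ) (e.reindex σ)]
    congr 1
    ext i j
    rw [Module.Basis.toMatrix_apply, Module.Basis.repr_reindex_apply, Module.Basis.reindex_apply,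
      twBasis_repr, Module.Basis.repr_self, Finsupp.single_eq_pi_single, Matrix.mulVec_single_one]
    rfl
  rw [Module.Basis.det_apply, Module.Basis.det_apply, h, Matrix.det_mul,
    Matrix.det_submatrix_equiv_self, A.det, mul_one]

theorem absVal_utNorm (e' : Module.Basis (Fin (Module.finrank E H)) E H) (e : Module.Basis ι E H)
    (σ : ι ≃ Fin (Module.finrank E H)) (y : UT E ι × Pos ι) :
    absVal e' (utNorm e y).1 = (nabs E (e'.det (e.reindex σ)))⁻¹ * ∏ i, y.2.1 i := by
  rw [utNorm, absVal_basisNorm e' _ σ y.2.2, det_twBasis]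

theorem basisNorm_const_mul {κ : Type*} [Fintype κ] (b : Module.Basis κ E H) (c : ℝ≥0)
    (r : κ → ℝ≥0) : basisNorm b (fun i => c * r i) = fun x => c * basisNorm b r x := by
  funext x
  rw [basisNorm_eq, basisNorm_eq, wnorm_const_mul]

theorem IsNorm.const_mul {μ : H → ℝ≥0} (h : IsNorm E μ) {c : ℝ≥0} (hc : 0 < c) :
    IsNorm E fun x => c * μ x := by
  obtain ⟨b, r, hr, rfl⟩ := h
  rw [← basisNorm_const_mul]
  exact isNorm_basisNorm _ _ fun i => mul_pos hc (hr i)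

theorem absVal_pos {μ : H → ℝ≥0} (h : IsNorm E μ)
    (e : Module.Basis (Fin (Module.finrank E H)) E H) : 0 < absVal e μ := by
  obtain ⟨b, r, hr, rfl⟩ := h
  rw [absVal_basisNorm e b (Equiv.refl _) hr]
  refine mul_pos (inv_pos.2 (nabs_pos ?_)) (Finset.prod_pos fun i _ => hr i)
  exact (e.isUnit_det _).ne_zero

theorem absVal_const_mul {μ : H → ℝ≥0} (h : IsNorm E μ) {c : ℝ≥0} (hc : 0 < c)
    (e : Module.Basis (Fin (Module.finrank E H)) E H) :
    absVal e (fun x => c * μ x) = c ^ Module.finrank E H * absVal e μ := by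
  obtain ⟨b, r, hr, rfl⟩ := h
  rw [← basisNorm_const_mul, absVal_basisNorm e b (Equiv.refl _) hr,
    absVal_basisNorm e b (Equiv.refl _) fun i => mul_pos hc (hr i), Finset.prod_mul_distrib]
  simp only [Finset.prod_const, Finset.card_univ, Fintype.card_fin]
  ring

theorem absVal_comp_symm {μ : H → ℝ≥0} (h : IsNorm E μ) (g : H ≃ₗ[E] H)
    (e : Module.Basis (Fin (Module.finrank E H)) E H) :
    absVal e (μ ∘ g.symm) = (nabs E (LinearMap.det (g : H →ₗ[E] H)))⁻¹ * absVal e μ := by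
  obtain ⟨b, r, hr, rfl⟩ := h
  have h1 : basisNorm b r ∘ g.symm = basisNorm (b.map g) r := by
    funext x
    simp [basisNorm]
  rw [h1, absVal_basisNorm e b (Equiv.refl _) hr, absVal_basisNorm e _ (Equiv.refl _) hr,
    ← mul_assoc, ← mul_inv, ← nabs_mul]
  congr 3
  simp only [Module.Basis.reindex_refl]
  have : (⇑(b.map g) : _ → H) = (g : H →ₗ[E] H) ∘ b := by
    funext i
    simp
  rw [this, Module.Basis.det_comp]

/-! ### The topology on the spaces of norms -/

theorem continuous_utNorm (e : Module.Basis ι E H) : Continuous (utNorm e) := by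
  refine Continuous.subtype_mk (continuous_pi fun x => ?_) _
  have : ∀ y : UT E ι × Pos ι, basisNorm (twBasis e y.1) y.2.1 x =
      wnorm E y.2.1 (y.1.1.mulVec (e.repr x)) := fun y => utNorm_apply e y x
  simp_rw [this]
  refine Continuous.wnorm (continuous_subtype_val.comp continuous_snd) ?_
  exact (continuous_subtype_val.comp continuous_fst).matrix_mulVec continuous_const

theorem isClosed_UT :
    IsClosed {A : Matrix ι ι E | (∀ i, A i i = 1) ∧ ∀ i j, j < i → A i j = 0} := by
  have h : ∀ i j, Continuous fun A : Matrix ι ι E => A i j := fun i j =>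
    continuous_id.matrix_elem i j
  simp only [Set.ofPred_and, Set.ofPred_forall]
  refine IsClosed.inter (isClosed_iInter fun i => isClosed_eq (h i i) continuous_const) ?_
  exact isClosed_iInter fun i => isClosed_iInter fun j => isClosed_iInter fun _ =>
    isClosed_eq (h i j) continuous_const

variable (E) in
/-- Vectors can be scaled into a fixed compact set that does not contain zero. -/
theorem exists_compact_scaling (κ : Type*) [Fintype κ] :
    ∃ K : Set (κ → E), IsCompact K ∧ (∀ z ∈ K, z ≠ 0) ∧
      ∀ z : κ → E, (∃ i, z i = 1) → ∃ c : E, nabs E c ≤ 1 ∧ c • z ∈ K := by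
  obtain ⟨a, ha⟩ := exists_one_lt (E := E)
  have hcont := continuous_nabs (E := E)
  refine ⟨{z | (∀ i, nabs E (z i) ≤ nabs E a) ∧ ∃ i, 1 ≤ nabs E (z i)}, ?_, ?_, ?_⟩
  · have h1 : IsCompact (Set.pi Set.univ fun _ : κ => {b : E | nabs E b ≤ nabs E a}) :=
      isCompact_univ_pi fun _ => isCompact_nabs_le (nabs E a)
    have h2 : {z : κ → E | (∀ i, nabs E (z i) ≤ nabs E a) ∧ ∃ i, 1 ≤ nabs E (z i)} =
        (Set.pi Set.univ fun _ : κ => {b : E | nabs E b ≤ nabs E a}) ∩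
          ⋃ i, {z | 1 ≤ nabs E (z i)} := by
      ext z
      simp [Set.mem_pi]
    rw [h2]
    refine h1.inter_right ?_
    exact isClosed_iUnion_of_finite fun i =>
      isClosed_le continuous_const (hcont.comp (continuous_apply i))
  · rintro z ⟨-, i, hi⟩ rfl
    rw [Pi.zero_apply, nabs_zero] at hi
    exact absurd hi (by simp)
  · rintro z ⟨i₀, h0⟩
    have : Nonempty κ := ⟨i₀⟩
    obtain ⟨i₁, -, hi₁⟩ := Finset.exists_max_image Finset.univ (fun i => nabs E (z i))
      Finset.univ_nonempty
    have h1 : 1 ≤ nabs E (z i₁) := by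
      have := hi₁ i₀ (Finset.mem_univ _)
      rwa [h0, nabs_one] at this
    -- With |a|ⁿ at most the largest coordinate and that coordinate less than |a|ⁿ⁺¹, division by aⁿ
    -- brings it into the range from 1 to |a|. As some coordinate is 1, `n` is a natural number and
    -- the scaling factor has absolute value at most 1.
    obtain ⟨n, hn, hn'⟩ := exists_nat_pow_near h1 ha
    have hpos : 0 < nabs E a ^ n := pow_pos (one_pos.trans ha) n
    refine ⟨(a ^ n)⁻¹, ?_, fun i => ?_, i₁, ?_⟩
    · rw [nabs_inv, nabs_pow]
      exact inv_le_one_of_one_le₀ (one_le_pow₀ ha.le)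
    · rw [Pi.smul_apply, smul_eq_mul, nabs_mul, nabs_inv, nabs_pow, inv_mul_le_iff₀ hpos,
        ← pow_succ]
      exact (hi₁ i (Finset.mem_univ _)).trans hn'.le
    · rw [Pi.smul_apply, smul_eq_mul, nabs_mul, nabs_inv, nabs_pow, le_inv_mul_iff₀ hpos, mul_one]
      exact hn

-- The norm of a vector is bounded through the values on unit vectors, with a constant independent
-- of the weights and of the matrix. Hence if these values stay bounded along a filter, small
-- vectors have small norm uniformly.
variable (E ι) in
theorem exists_wnorm_mulVec_le : ∃ K : ℝ≥0, ∀ (r : ι → ℝ≥0) (A : Matrix ι ι E) (z : ι → E),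
    wnorm E r (A.mulVec z) ≤ K * ∑ j, nabs E (z j) * wnorm E r (A.mulVec (Pi.single j 1)) := by
  obtain ⟨K, hK⟩ := exists_nabs_sum_le (E := E) (Finset.univ : Finset ι)
  refine ⟨Fintype.card ι * K, fun r A z => (osum_le_sum E _ _).trans ?_⟩
  have h : ∀ i, r i * nabs E (A.mulVec z i) ≤
      K * ∑ j, nabs E (z j) * wnorm E r (A.mulVec (Pi.single j 1)) := by
    intro i
    calc r i * nabs E (A.mulVec z i) ≤ r i * (K * ∑ j, nabs E (A i j * z j)) := by
          gcongr
          exact hK _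
      _ = K * ∑ j, nabs E (z j) * (r i * nabs E (A i j)) := by
          simp only [nabs_mul, Finset.mul_sum]
          refine Finset.sum_congr rfl fun j _ => by ring
      _ ≤ _ := by
          gcongr with j
          have h1 := le_wnorm r (A.mulVec (Pi.single j 1)) i
          have h2 : A.mulVec (Pi.single j 1) i = A i j := by
            rw [Matrix.mulVec_single_one, Matrix.col_apply]
          rwa [h2] at h1
  calc ∑ i, r i * nabs E (A.mulVec z i) ≤ ∑ _i : ι, K * _ := Finset.sum_le_sum fun i _ => h i
    _ = _ := by rw [Finset.sum_const, Finset.card_univ, nsmul_eq_mul, mul_assoc]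

/-- If the norms converge to a norm along an ultrafilter, their values on unit vectors are bounded.
These values dominate `r i * |A i j|`, and the diagonal entries of `A` are 1, so the weights are
bounded above. Nondegeneracy of the limit norm bounds them away from zero, and then the matrix
entries are bounded too. Compactness of balls in `E` provides the limit of the parameters. -/
theorem isProperMap_utNorm (e : Module.Basis ι E H) : IsProperMap (utNorm e) := by
  rw [isProperMap_iff_ultrafilter_of_t2]
  refine ⟨continuous_utNorm e, fun U ν hU => ?_⟩
  have hnabs := continuous_nabs (E := E)
  have hval : ∀ x, Filter.Tendsto (fun y => (utNorm e y).1 x) U (𝓝 (ν.1 x)) := fun x =>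
    ((continuous_apply x).comp continuous_subtype_val).continuousAt.tendsto.comp hU
  let N : UT E ι × Pos ι → (ι → E) → ℝ≥0 := fun y z => wnorm E y.2.1 (y.1.1.mulVec z)
  let n : (ι → E) → ℝ≥0 := fun z => ν.1 (e.equivFun.symm z)
  have hN : ∀ z, Filter.Tendsto (fun y => N y z) U (𝓝 (n z)) := by
    intro z
    refine (hval (e.equivFun.symm z)).congr fun y => ?_
    rw [utNorm_apply, ← Module.Basis.equivFun_apply, LinearEquiv.apply_symm_apply]
  have hn : ∀ z, z ≠ 0 → 0 < n z := by
    intro z hz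
    obtain ⟨y, hy⟩ := utNorm_surjective e ν
    have : n z = N y z := by
      change ν.1 _ = _
      rw [← hy, utNorm_apply, ← Module.Basis.equivFun_apply, LinearEquiv.apply_symm_apply]
    rw [this]
    refine pos_of_ne_zero fun h0 => hz ?_
    rw [wnorm_eq_zero y.2.2] at h0
    have := congrArg y.1.inv.1.mulVec h0
    rwa [Matrix.mulVec_mulVec, UT.inv_mul, Matrix.one_mulVec, Matrix.mulVec_zero] at this
  have hrle : ∀ (y : UT E ι × Pos ι) i j, y.2.1 i * nabs E (y.1.1 i j) ≤ N y (Pi.single j 1) := by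
    intro y i j
    have h1 := le_wnorm y.2.1 (y.1.1.mulVec (Pi.single j 1)) i
    have h2 : y.1.1.mulVec (Pi.single j 1) i = y.1.1 i j := by
      rw [Matrix.mulVec_single_one, Matrix.col_apply]
    rwa [h2] at h1
  have hbd : ∀ j, ∀ᶠ y : UT E ι × Pos ι in (U : Filter _), N y (Pi.single j 1) ≤ n (Pi.single j 1) + 1 := fun j =>
    ((hN _).eventually_lt_const (lt_add_one _)).mono fun _ h => h.le
  -- the weights converge
  obtain ⟨r₀, hr₀⟩ : ∃ r₀ : ι → ℝ≥0, Filter.Tendsto (fun y : UT E ι × Pos ι => y.2.1) (U : Filter _) (𝓝 r₀) := by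
    have hc : IsCompact (Set.pi Set.univ fun i : ι => Set.Icc 0 (n (Pi.single i 1) + 1)) :=
      isCompact_univ_pi fun i => isCompact_Icc
    obtain ⟨r₀, -, h⟩ := hc.ultrafilter_le_nhds' (U.map fun y : UT E ι × Pos ι => y.2.1) (by
      rw [Ultrafilter.mem_map]
      filter_upwards [Filter.eventually_all.2 hbd] with y hy
      intro i _
      refine ⟨zero_le, ?_⟩
      have := (hrle y i i).trans (hy i)
      rwa [y.1.2.1, nabs_one, mul_one] at this)
    exact ⟨r₀, h⟩
  have hr₀' : ∀ i, Filter.Tendsto (fun y : UT E ι × Pos ι => y.2.1 i) (U : Filter _) (𝓝 (r₀ i)) := fun i =>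
    ((continuous_apply i).tendsto _).comp hr₀
  -- the limit of the weights is positive
  obtain ⟨K, hK, hK0, hsc⟩ := exists_compact_scaling E ι
  obtain ⟨C, hC⟩ := exists_wnorm_mulVec_le E ι
  have hpos : ∀ i, 0 < r₀ i := by
    intro i
    -- At the parameter `y`, the vector `z y` has norm exactly the `i`-th weight. Scaled into `K`,
    -- it has norm at most that weight and converges to some nonzero `w`. The norms of the
    -- differences from `w` tend to zero, so `n w` is bounded by a multiple of `r₀ i`; but `n w` is
    -- positive.
    choose z hz hz1 hz2 using fun y : UT E ι × Pos ι => y.1.exists_mulVec_eq_single i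
    choose c hc hcK using fun y : UT E ι × Pos ι => hsc (z y) ⟨i, hz1 y⟩
    obtain ⟨w, hw, hlim⟩ := hK.ultrafilter_le_nhds' (U.map fun y : UT E ι × Pos ι => c y • z y)
      (Filter.mem_map.2 (Filter.univ_mem' hcK))
    have hlim : Filter.Tendsto (fun y : UT E ι × Pos ι => c y • z y) (U : Filter _) (𝓝 w) := hlim
    have h1 : ∀ y, N y (c y • z y) ≤ y.2.1 i := by
      intro y
      change wnorm E _ _ ≤ _
      rw [Matrix.mulVec_smul, wnorm_smul, hz, wnorm_single, nabs_one, mul_one]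
      exact mul_le_of_le_one_left zero_le (hc y)
    have h2 : ∀ y, N y w ≤ 2 * Fintype.card ι * (y.2.1 i +
        C * ∑ j, nabs E ((w - c y • z y) j) * N y (Pi.single j 1)) := by
      intro y
      have h3 : w = c y • z y + (w - c y • z y) := by abel
      calc N y w = N y (c y • z y + (w - c y • z y)) := by rw [← h3]
        _ ≤ 2 * Fintype.card ι * (N y (c y • z y) + N y (w - c y • z y)) := by
          change wnorm E _ _ ≤ _
          rw [Matrix.mulVec_add]
          exact wnorm_add_le _ _ _
        _ ≤ _ := by
          gcongr
          · exact h1 y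
          · exact hC _ _ _
    have h4 : Filter.Tendsto (fun y : UT E ι × Pos ι => 2 * Fintype.card ι * (y.2.1 i +
        C * ∑ j, nabs E ((w - c y • z y) j) * N y (Pi.single j 1))) (U : Filter _)
        (𝓝 (2 * Fintype.card ι * (r₀ i + C * ∑ j, nabs E ((w - w) j) * n (Pi.single j 1)))) := by
      refine Filter.Tendsto.const_mul _ ((hr₀' i).add (Filter.Tendsto.const_mul _ ?_))
      refine tendsto_finsetSum _ fun j _ => Filter.Tendsto.mul ?_ (hN _)
      refine (hnabs.tendsto _).comp (((continuous_apply j).tendsto _).comp ?_)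
      exact tendsto_const_nhds.sub hlim
    have h5 := le_of_tendsto_of_tendsto' (hN w) h4 h2
    have h6 : ∑ j, nabs E ((w - w) j) * n (Pi.single j 1) = 0 :=
      Finset.sum_eq_zero fun j _ => by simp [nabs_zero]
    rw [h6, mul_zero, add_zero] at h5
    refine pos_of_ne_zero fun h0 => (hn w (hK0 w hw)).not_ge ?_
    rwa [h0, mul_zero] at h5
  -- the matrices converge
  obtain ⟨A₀, hA₀⟩ : ∃ A₀ : Matrix ι ι E,
      Filter.Tendsto (fun y : UT E ι × Pos ι => y.1.1) (U : Filter _) (𝓝 A₀) := by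
    -- Eventually each weight exceeds half of its positive limit, which turns the bound on `r i * |A
    -- i j|` into a bound on the entries.
    have hc : IsCompact {A : Matrix ι ι E |
        ∀ i j, nabs E (A i j) ≤ (r₀ i / 2)⁻¹ * (n (Pi.single j 1) + 1)} := by
      have h := isCompact_univ_pi fun i : ι => isCompact_univ_pi fun j : ι =>
        isCompact_nabs_le (E := E) ((r₀ i / 2)⁻¹ * (n (Pi.single j 1) + 1))
      convert! h using 1
      ext A
      exact ⟨fun h i _ j _ => h i j, fun h i j => h i trivial j trivial⟩
    have hlow : ∀ i, ∀ᶠ y : UT E ι × Pos ι in (U : Filter _), r₀ i / 2 < y.2.1 i := fun i =>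
      (hr₀' i).eventually_const_lt (NNReal.half_lt_self (hpos i).ne')
    obtain ⟨A₀, -, h⟩ := hc.ultrafilter_le_nhds' (U.map fun y : UT E ι × Pos ι => y.1.1) (by
      rw [Ultrafilter.mem_map]
      filter_upwards [Filter.eventually_all.2 hbd, Filter.eventually_all.2 hlow] with y hy hy'
      intro i j
      have h1 := (hrle y i j).trans (hy j)
      have h2 : 0 < r₀ i / 2 := half_pos (hpos i)
      change nabs E (y.1.1 i j) ≤ _
      rw [le_inv_mul_iff₀ h2]
      exact (mul_le_mul_of_nonneg_right (hy' i).le zero_le).trans h1)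
    exact ⟨A₀, h⟩
  have hA₀' : (∀ i, A₀ i i = 1) ∧ ∀ i j, j < i → A₀ i j = 0 :=
    isClosed_UT.mem_of_tendsto hA₀ (Filter.Eventually.of_forall fun y => y.1.2)
  refine ⟨(⟨A₀, hA₀'⟩, ⟨r₀, hpos⟩), ?_⟩
  rw [nhds_prod_eq, ← Filter.tendsto_id', Filter.tendsto_prod_iff']
  exact ⟨tendsto_subtype_rng.2 hA₀, tendsto_subtype_rng.2 hr₀⟩

/-! ### Classes of norms -/

theorem NormClass.mk_eq_mk {μ ν : NormOn E H} :
    NormClass.mk μ = NormClass.mk ν ↔ ∃ c : ℝ≥0, 0 < c ∧ ∀ x, ν.1 x = c * μ.1 x :=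
  Quotient.eq (r := normSetoid E H)

theorem NormClass.mk_surjective : Function.Surjective (NormClass.mk (E := E) (H := H)) :=
  Quotient.mk_surjective

theorem NormClass.exists_rep (μ : NormOn E H) :
    ∃ c : ℝ≥0, 0 < c ∧ (NormClass.mk μ).rep = fun x => c * μ.1 x := by
  have h : NormClass.mk (Quotient.out (s := normSetoid E H) (NormClass.mk μ)) = NormClass.mk μ :=
    Quotient.out_eq (s := normSetoid E H) _
  obtain ⟨c, hc, h⟩ := NormClass.mk_eq_mk.1 h.symm
  exact ⟨c, hc, funext h⟩

theorem NormClass.ofFun_eq [FiniteDimensional E H] {μ : H → ℝ≥0} (ν : NormOn E H) {c : ℝ≥0}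
    (hc : 0 < c) (h : ∀ x, μ x = c * ν.1 x) : NormClass.ofFun (E := E) μ = NormClass.mk ν := by
  have hμ : IsNorm E μ := by
    rw [show μ = fun x => c * ν.1 x from funext h]
    exact ν.2.const_mul hc
  rw [NormClass.ofFun, dif_pos hμ]
  exact (NormClass.mk_eq_mk.2 ⟨c, hc, h⟩).symm

theorem NormClass.smul_mk (g : H ≃ₗ[E] H) (μ : NormOn E H) :
    g • NormClass.mk μ = NormClass.mk ⟨μ.1 ∘ g.symm, μ.2.comp_equiv g⟩ := rfl

/-- The saturation of an open set of norms is the union of its preimages under rescalings. Openness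
is recorded because, unlike general quotient maps, open ones are stable under products. -/
theorem isOpenQuotientMap_mk : IsOpenQuotientMap (NormClass.mk (E := E) (H := H)) := by
  refine ⟨NormClass.mk_surjective, continuous_quotient_mk', fun U hU => ?_⟩
  change IsOpen (Quotient.mk (normSetoid E H) ⁻¹' (NormClass.mk '' U))
  have h : Quotient.mk (normSetoid E H) ⁻¹' (NormClass.mk '' U) =
      ⋃ c : {c : ℝ≥0 // 0 < c},
        (fun μ : NormOn E H => (⟨fun x => c.1 * μ.1 x, μ.2.const_mul c.2⟩ : NormOn E H)) ⁻¹' U := by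
    ext μ
    simp only [Set.mem_preimage, Set.mem_iUnion]
    constructor
    · rintro ⟨ν, hν, h⟩
      obtain ⟨c, hc, h⟩ := NormClass.mk_eq_mk.1 (show NormClass.mk μ = NormClass.mk ν from h.symm)
      refine ⟨⟨c, hc⟩, ?_⟩
      convert! hν using 1
      exact Subtype.ext (funext fun x => (h x).symm)
    · rintro ⟨⟨c, hc⟩, h⟩
      refine ⟨_, h, ?_⟩
      exact (NormClass.mk_eq_mk (μ := μ).2 ⟨c, hc, fun x => rfl⟩).symm
  rw [h]
  refine isOpen_iUnion fun c => hU.preimage (Continuous.subtype_mk (continuous_pi fun x => ?_) _)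
  exact continuous_const.mul ((continuous_apply x).comp continuous_subtype_val)

end NormBasis

/-! ### Diagonal norms on subquotients -/

section SubquotientNorms

variable {E : Type*} [NormedField E] {M : Type*} [AddCommGroup M] [Module E M]

theorem subqBasis_repr {ι : Type*} (b : Module.Basis ι E M) {B A : Submodule E M} (u s : Set ι)
    (hB : B = Submodule.span E (b '' u)) (hA : A = Submodule.span E (b '' s)) {y : M} (hy : y ∈ B)
    (j : {j // j ∈ u ∧ j ∉ s}) :
    (subqBasis b u s hB hA).repr ((A.submoduleOf B).mkQ ⟨y, hy⟩) j = b.repr y j.1 := by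
  have key : ∀ x ∈ Submodule.span E (b '' u), ∀ hx : x ∈ B,
      (subqBasis b u s hB hA).repr ((A.submoduleOf B).mkQ ⟨x, hx⟩) j = b.repr x j.1 := by
    intro x hx
    induction hx using Submodule.span_induction with
    | mem x h =>
      intro hxB
      obtain ⟨k, hk, rfl⟩ := h
      by_cases hks : k ∈ s
      · have h0 : (A.submoduleOf B).mkQ ⟨b k, hxB⟩ = 0 := by
          rw [Submodule.mkQ_apply, Submodule.Quotient.mk_eq_zero]
          change b k ∈ A
          rw [hA]
          exact Submodule.subset_span (Set.mem_image_of_mem b hks)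
        have hjk : k ≠ j.1 := fun h => j.2.2 (h ▸ hks)
        rw [h0, map_zero, b.repr_self, Finsupp.single_eq_of_ne' hjk]
        rfl
      · have h1 : (A.submoduleOf B).mkQ ⟨b k, hxB⟩ = subqBasis b u s hB hA ⟨k, hk, hks⟩ := by
          rw [subqBasis, Module.Basis.mk_apply]
        classical
        rw [h1, Module.Basis.repr_self, Module.Basis.repr_self, Finsupp.single_apply,
          Finsupp.single_apply]
        simp only [Subtype.ext_iff]
    | zero =>
      intro hxB
      have : (⟨0, hxB⟩ : B) = 0 := rfl
      rw [this, map_zero, map_zero, map_zero]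
      rfl
    | add x y hx hy ihx ihy =>
      intro hxB
      have hx' : x ∈ B := hB ▸ hx
      have hy' : y ∈ B := hB ▸ hy
      have : (⟨x + y, hxB⟩ : B) = ⟨x, hx'⟩ + ⟨y, hy'⟩ := rfl
      rw [this, map_add, map_add, map_add, Finsupp.add_apply, Finsupp.add_apply, ihx hx', ihy hy']
    | smul a x hx ih =>
      intro hxB
      have hx' : x ∈ B := hB ▸ hx
      have : (⟨a • x, hxB⟩ : B) = a • ⟨x, hx'⟩ := rfl
      rw [this, map_smul, map_smul, map_smul, Finsupp.smul_apply, Finsupp.smul_apply, ih hx']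
  exact key y (hB ▸ hy) hy

theorem basisNorm_subqBasis {ι : Type*} [Fintype ι] (b : Module.Basis ι E M) {B A : Submodule E M}
    (u s : Set ι) [Fintype {j // j ∈ u ∧ j ∉ s}] [DecidablePred fun j => j ∈ u ∧ j ∉ s]
    (hB : B = Submodule.span E (b '' u)) (hA : A = Submodule.span E (b '' s))
    (ρ : ι → ℝ≥0) {y : M} (hy : y ∈ B) :
    basisNorm (subqBasis b u s hB hA) (fun j => ρ j.1) ((A.submoduleOf B).mkQ ⟨y, hy⟩) =
      osum E (Finset.univ.filter fun j => j ∈ u ∧ j ∉ s) fun j => ρ j * nabs E (b.repr y j) := by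
  rw [basisNorm_eq, wnorm, ← osum_subtype]
  refine osum_congr E fun j _ => ?_
  rw [subqBasis_repr]

theorem mem_span_image_iff {ι : Type*} (b : Module.Basis ι E M) (u : Set ι) (x : M) :
    x ∈ Submodule.span E (b '' u) ↔ ∀ j, j ∉ u → b.repr x j = 0 := by
  rw [Module.Basis.mem_span_image]
  constructor
  · intro h j hj
    by_contra h0
    exact hj (h (Finsupp.mem_support_iff.2 h0))
  · intro h j hj
    by_contra hju
    exact Finsupp.mem_support_iff.1 hj (h j hju)

variable [LocField E]

/-- The coordinates outside `s'` are fixed by the class in B'/A', while those in `s'` are free. A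
diagonal norm is monotone in the absolute values of the coordinates, so the infimum is attained by
setting the free ones to zero. -/
theorem subquotNorm_subqBasis {ι : Type*} [Fintype ι] (b : Module.Basis ι E M)
    {B A B' A' : Submodule E M} {u s u' s' : Set ι} (hs : s ⊆ s') (hu : u' ⊆ u)
    [Fintype {j // j ∈ u ∧ j ∉ s}] [Fintype {j // j ∈ u' ∧ j ∉ s'}]
    (hB : B = Submodule.span E (b '' u)) (hA : A = Submodule.span E (b '' s))
    (hB' : B' = Submodule.span E (b '' u')) (hA' : A' = Submodule.span E (b '' s'))
    (ρ : ι → ℝ≥0) :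
    subquotNorm B' A' (basisNorm (subqBasis b u s hB hA) fun j => ρ j.1) =
      basisNorm (subqBasis b u' s' hB' hA') fun j => ρ j.1 := by
  classical
  funext x
  obtain ⟨⟨x, hx⟩, rfl⟩ := (A'.submoduleOf B').mkQ_surjective x
  have hBB : B' ≤ B := by
    rw [hB, hB']
    exact Submodule.span_mono (Set.image_mono hu)
  rw [basisNorm_subqBasis]
  apply le_antisymm
  · -- the projection of `x`
    let y : M := ∑ j ∈ Finset.univ.filter (· ∉ s'), b.repr x j • b j
    have hrepr : ∀ i, b.repr y i = if i ∉ s' then b.repr x i else 0 := by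
      intro i
      simp only [y, map_sum, map_smul, Module.Basis.repr_self, Finsupp.smul_single, smul_eq_mul,
        mul_one, Finsupp.coe_finsetSum, Finset.sum_apply, Finsupp.single_apply]
      rw [Finset.sum_ite_eq' (Finset.univ.filter (· ∉ s')) i]
      simp
    have hy : y ∈ B' := by
      rw [hB', mem_span_image_iff]
      intro j hj
      rw [hrepr]
      rw [hB', mem_span_image_iff] at hx
      rw [hx j hj, ite_self]
    have hle : osum E (Finset.univ.filter fun j => j ∈ u ∧ j ∉ s) (fun j => ρ j * nabs E (b.repr y j))
        = osum E (Finset.univ.filter fun j => j ∈ u' ∧ j ∉ s') fun j => ρ j * nabs E (b.repr x j) := by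
      rw [← osum_subset E (T := Finset.univ.filter fun j => j ∈ u' ∧ j ∉ s')]
      · refine osum_congr E fun j hj => ?_
        rw [hrepr, if_pos (Finset.mem_filter.1 hj).2.2]
      · intro j hj
        simp only [Finset.mem_filter, Finset.mem_univ, true_and] at hj ⊢
        exact ⟨hu hj.1, fun h => hj.2 (hs h)⟩
      · intro j _ hj
        simp only [Finset.mem_filter, Finset.mem_univ, true_and] at hj
        rw [hrepr]
        rw [hB', mem_span_image_iff] at hx
        by_cases h1 : j ∈ s'
        · simp [h1, nabs_zero]
        · rw [hx j fun h => hj ⟨h, h1⟩, ite_self, nabs_zero, mul_zero]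
    refine le_trans (csInf_le (OrderBot.bddBelow _) ⟨y, hy, hBB hy, ?_, rfl⟩) ?_
    · rw [Submodule.mkQ_apply, Submodule.mkQ_apply, Submodule.Quotient.eq]
      change y - x ∈ A'
      rw [hA', mem_span_image_iff]
      intro j hj
      rw [map_sub, Finsupp.sub_apply, hrepr, if_pos hj, sub_self]
    · rw [basisNorm_subqBasis]
      exact hle.le
  · refine le_csInf ⟨_, x, hx, hBB hx, rfl, rfl⟩ ?_
    rintro _ ⟨y, hy', hy, h, rfl⟩
    rw [basisNorm_subqBasis]
    rw [Submodule.mkQ_apply, Submodule.mkQ_apply, Submodule.Quotient.eq] at h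
    change y - x ∈ A' at h
    rw [hA', mem_span_image_iff] at h
    refine osum_mono E ?_ fun j hj => ?_
    · intro j hj
      simp only [Finset.mem_filter, Finset.mem_univ, true_and] at hj ⊢
      exact ⟨hu hj.1, fun h => hj.2 (hs h)⟩
    · have h1 := h j (Finset.mem_filter.1 hj).2.2
      rw [map_sub, Finsupp.sub_apply, sub_eq_zero] at h1
      rw [h1]

theorem subquotNorm_const_mul {B A B' A' : Submodule E M} (hBB : B' ≤ B) {c : ℝ≥0} (hc : 0 < c)
    (μ : SubQ B A → ℝ≥0) :
    subquotNorm B' A' (fun x => c * μ x) = fun x => c * subquotNorm B' A' μ x := by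
  funext x
  obtain ⟨⟨x, hx⟩, rfl⟩ := (A'.submoduleOf B').mkQ_surjective x
  apply le_antisymm
  · rw [← inv_mul_le_iff₀ hc]
    refine le_csInf ⟨_, x, hx, hBB hx, rfl, rfl⟩ ?_
    rintro _ ⟨y, hy', hy, h, rfl⟩
    rw [inv_mul_le_iff₀ hc]
    exact csInf_le (OrderBot.bddBelow _) ⟨y, hy', hy, h, rfl⟩
  · refine le_csInf ⟨_, x, hx, hBB hx, rfl, rfl⟩ ?_
    rintro _ ⟨y, hy', hy, h, rfl⟩
    exact mul_le_mul_of_nonneg_left (csInf_le (OrderBot.bddBelow _) ⟨y, hy', hy, h, rfl⟩) zero_le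

theorem mem_iff_of_map_eq {A : Submodule E M} {g : M ≃ₗ[E] M}
    (hA : A.map (g : M →ₗ[E] M) = A) (y : M) : g.symm y ∈ A ↔ y ∈ A := by
  conv_rhs => rw [← hA]
  constructor
  · intro h
    exact ⟨g.symm y, h, g.apply_symm_apply y⟩
  · rintro ⟨z, hz, rfl⟩
    simpa using hz

theorem subqEquiv_symm_mk {B A : Submodule E M} (g : M ≃ₗ[E] M)
    (hB : B.map (g : M →ₗ[E] M) = B) (hA : A.map (g : M →ₗ[E] M) = A) {y : M} (hy : y ∈ B) :
    (subqEquiv g hB hA).symm ((A.submoduleOf B).mkQ ⟨y, hy⟩) =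
      (A.submoduleOf B).mkQ ⟨g.symm y, (mem_iff_of_map_eq hB y).2 hy⟩ := by
  rw [LinearEquiv.symm_apply_eq, subqEquiv_mk]
  congr 1
  exact Subtype.ext (g.apply_symm_apply y).symm

/-- An automorphism preserving the four subspaces carries the preimages of a class to the preimages
of its translate, so both infima run over the same set. -/
theorem subquotNorm_comp_symm {B A B' A' : Submodule E M} (g : M ≃ₗ[E] M)
    (hB : B.map (g : M →ₗ[E] M) = B) (hA : A.map (g : M →ₗ[E] M) = A)
    (hB' : B'.map (g : M →ₗ[E] M) = B') (hA' : A'.map (g : M →ₗ[E] M) = A')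
    (μ : SubQ B A → ℝ≥0) :
    subquotNorm B' A' (μ ∘ (subqEquiv g hB hA).symm) =
      subquotNorm B' A' μ ∘ (subqEquiv g hB' hA').symm := by
  funext x
  obtain ⟨⟨x, hx⟩, rfl⟩ := (A'.submoduleOf B').mkQ_surjective x
  rw [Function.comp, subqEquiv_symm_mk]
  unfold subquotNorm
  congr 1
  ext s
  constructor
  · rintro ⟨y, hy', hy, h, rfl⟩
    refine ⟨g.symm y, (mem_iff_of_map_eq hB' y).2 hy', (mem_iff_of_map_eq hB y).2 hy, ?_, ?_⟩
    · rw [← subqEquiv_symm_mk g hB' hA' hy', h, subqEquiv_symm_mk]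
    · rw [Function.comp, subqEquiv_symm_mk]
  · rintro ⟨y, hy', hy, h, rfl⟩
    have h1 : g y ∈ B' := by
      rw [← mem_iff_of_map_eq hB']
      simpa using hy'
    have h2 : g y ∈ B := by
      rw [← mem_iff_of_map_eq hB]
      simpa using hy
    refine ⟨g y, h1, h2, ?_, ?_⟩
    · have h3 := congrArg (subqEquiv g hB' hA') h
      rw [subqEquiv_mk, ← subqEquiv_symm_mk g hB' hA' hx, LinearEquiv.apply_symm_apply] at h3
      exact h3
    · rw [Function.comp, subqEquiv_symm_mk]
      congr 2
      exact Subtype.ext (g.symm_apply_apply y).symm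

end SubquotientNorms

/-! ### Combinatorics of flags -/

section FlagLemmas

variable {F V : Type*} [Field F] [AddCommGroup V] [Module F V] [FiniteDimensional F V]

theorem ParFlag.ext_carrier {P Q : ParFlag F V} (h : P.carrier = Q.carrier) : P = Q := by
  cases P
  cases Q
  congr

theorem ParFlag.pred_lt (P : ParFlag F V) (W : P.Steps) : P.pred W.1 < W.1 :=
  (P.sSup_mem (T := {U | U ∈ P.carrier ∧ U < W.1}) (fun _ h => h.1)
    ⟨⊥, P.bot_mem, bot_lt_iff_ne_bot.2 W.2.2⟩).2

theorem ParFlag.le_pred (P : ParFlag F V) {W U : Submodule F V} (hU : U ∈ P.carrier)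
    (h : U < W) : U ≤ P.pred W := le_sSup ⟨hU, h⟩

theorem ParFlag.le_or_lt (P : ParFlag F V) {U W : Submodule F V} (hU : U ∈ P.carrier)
    (hW : W ∈ P.carrier) : U ≤ W ∨ W < U := by
  rcases P.chain.total hU hW with h | h
  · exact Or.inl h
  · rcases h.eq_or_lt with h | h
    · exact Or.inl h.ge
    · exact Or.inr h

theorem ParFlag.le_cover (Q : ParFlag F V) {W : Submodule F V} (hW : W ≠ ⊥) :
    W ≤ (Q.cover W hW).1 :=
  (Q.sInf_mem (T := {U | U ∈ Q.carrier ∧ W ≤ U}) (fun _ h => h.1) ⟨⊤, Q.top_mem, le_top⟩).2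

theorem ParFlag.cover_le (Q : ParFlag F V) {W : Submodule F V} (hW : W ≠ ⊥) {U : Submodule F V}
    (hU : U ∈ Q.carrier) (h : W ≤ U) : (Q.cover W hW).1 ≤ U := sInf_le ⟨hU, h⟩

theorem ParFlag.cover_eq_iff (Q : ParFlag F V) {W : Submodule F V} (hW : W ≠ ⊥) (U : Q.Steps) :
    Q.cover W hW = U ↔ W ≤ U.1 ∧ ¬ W ≤ Q.pred U.1 := by
  constructor
  · rintro rfl
    refine ⟨Q.le_cover hW, fun h => ?_⟩
    exact (Q.pred_lt (Q.cover W hW)).not_ge (Q.cover_le hW (Q.pred_mem _) h)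
  · rintro ⟨h1, h2⟩
    apply Subtype.ext
    refine le_antisymm (Q.cover_le hW U.2.1 h1) ?_
    rcases Q.le_or_lt U.2.1 (Q.cover W hW).2.1 with h | h
    · exact h
    · exact absurd ((Q.le_cover hW).trans (Q.le_pred (Q.cover W hW).2.1 h)) h2

theorem ParFlag.cover_self (Q : ParFlag F V) (W : Q.Steps) : Q.cover W.1 W.2.2 = W := by
  rw [Q.cover_eq_iff]
  exact ⟨le_rfl, (Q.pred_lt W).not_ge⟩

/-- If the flag of `P` refines the flag of `Q`, the graded piece of `P` at `W` is a subquotient of the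
graded piece of `Q` at the smallest member of `Q` containing `W`. -/
theorem ParFlag.pred_cover_le {P Q : ParFlag F V} (h : Q.carrier ⊆ P.carrier) (W : P.Steps) :
    Q.pred (Q.cover W.1 W.2.2).1 ≤ P.pred W.1 := by
  have h1 := ((Q.cover_eq_iff W.2.2 _).1 rfl).2
  have h2 : Q.pred (Q.cover W.1 W.2.2).1 ∈ P.carrier := h (Q.pred_mem _)
  rcases P.le_or_lt W.2.1 h2 with h3 | h3
  · exact absurd h3 h1
  · exact P.le_pred h2 h3

theorem ParFlag.pred_mono_of_cover {P Q : ParFlag F V} (h : Q.carrier ⊆ P.carrier) (W : P.Steps)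
    {U : Q.Steps} (hU : Q.cover W.1 W.2.2 = U) : W.1 ≤ U.1 ∧ Q.pred U.1 ≤ P.pred W.1 := by
  subst hU
  exact ⟨Q.le_cover _, P.pred_cover_le h W⟩

theorem ParFlag.lt_upper (P : ParFlag F V) (W : P.Inner) : W.1 < (P.upper W).1 :=
  (P.sInf_mem (T := {U | U ∈ P.carrier ∧ W.1 < U}) (fun _ h => h.1)
    ⟨⊤, P.top_mem, lt_top_iff_ne_top.2 W.2.2.2⟩).2

theorem ParFlag.upper_le (P : ParFlag F V) (W : P.Inner) {U : Submodule F V} (hU : U ∈ P.carrier)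
    (h : W.1 < U) : (P.upper W).1 ≤ U := sInf_le ⟨hU, h⟩

theorem ParFlag.pred_upper (P : ParFlag F V) (W : P.Inner) : P.pred (P.upper W).1 = W.1 := by
  apply le_antisymm
  · rcases P.le_or_lt (P.pred_mem (P.upper W)) W.2.1 with h | h
    · exact h
    · exact absurd (P.upper_le W (P.pred_mem _) h) (P.pred_lt _).not_ge
  · exact P.le_pred W.2.1 (P.lt_upper W)

/-- When V_{i-1} is not a member of the coarser flag, the graded pieces on either side of it lie in
one graded piece of that flag. Hence t_i compares two norms induced by the same norm. -/
theorem ParFlag.cover_upper_of_notMem {P Q : ParFlag F V} (h : Q.carrier ⊆ P.carrier) (W : P.Inner)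
    (hW : W.1 ∉ Q.carrier) :
    Q.cover (P.lower W).1 (P.lower W).2.2 = Q.cover (P.upper W).1 (P.upper W).2.2 := by
  rw [Q.cover_eq_iff]
  refine ⟨(P.lt_upper W).le.trans (Q.le_cover _), fun hle => ?_⟩
  have h1 : Q.pred (Q.cover (P.upper W).1 (P.upper W).2.2).1 ∈ Q.carrier := Q.pred_mem _
  have h2 : W.1 < Q.pred (Q.cover (P.upper W).1 (P.upper W).2.2).1 :=
    lt_of_le_of_ne hle fun h => hW (h ▸ h1)
  exact (Q.pred_lt _).not_ge (Q.cover_le (P.upper W).2.2 h1 (P.upper_le W (h h1) h2))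

/-- For a member `W` of a coarser flag, the cover of the next member is the next member of the
coarser flag. -/
theorem ParFlag.cover_upper_of_mem {P Q : ParFlag F V} (h : Q.carrier ⊆ P.carrier) (W : P.Inner)
    (hW : W.1 ∈ Q.carrier) :
    Q.cover (P.upper W).1 (P.upper W).2.2 = Q.upper ⟨W.1, hW, W.2.2⟩ := by
  rw [Q.cover_eq_iff, Q.pred_upper]
  exact ⟨P.upper_le W (h (Q.upper ⟨W.1, hW, W.2.2⟩).2.1) (Q.lt_upper ⟨W.1, hW, W.2.2⟩), (P.lt_upper W).not_ge⟩

theorem ParFlag.cover_trans {Q R : ParFlag F V} (h : Q.carrier ⊆ R.carrier) {W : Submodule F V}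
    (hW : W ≠ ⊥) :
    Q.cover (R.cover W hW).1 (R.cover W hW).2.2 = Q.cover W hW := by
  apply Subtype.ext
  apply le_antisymm
  · exact Q.cover_le _ (Q.cover W hW).2.1 (R.cover_le _ (h (Q.cover W hW).2.1) (Q.le_cover hW))
  · exact Q.cover_le _ (Q.cover _ _).2.1 ((R.le_cover hW).trans (Q.le_cover _))

/-! ### Adapted bases -/

variable {e : Module.Basis (Fin (Module.finrank F V)) F V} {P Q : ParFlag F V}

theorem Adapted.mono (hP : Adapted e P) (h : Q.carrier ⊆ P.carrier) : Adapted e Q :=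
  fun U hU => hP U (h hU)

theorem mem_stdSub (e : Module.Basis (Fin (Module.finrank F V)) F V) (k : ℕ)
    (j : Fin (Module.finrank F V)) : e j ∈ stdSub e k ↔ j.1 < k := by
  rw [stdSub, e.mem_span_image, e.repr_self, Finsupp.support_single _ one_ne_zero]
  simp

theorem stdSub_eq_span (e : Module.Basis (Fin (Module.finrank F V)) F V) (k : ℕ) :
    stdSub e k = Submodule.span F (e '' {j | e j ∈ stdSub e k}) := by
  simp only [mem_stdSub]
  rfl

theorem Adapted.eq_span (hP : Adapted e P) {U : Submodule F V} (hU : U ∈ P.carrier) :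
    U = Submodule.span F (e '' {j | e j ∈ U}) := by
  obtain ⟨k, rfl⟩ := hP U hU
  exact stdSub_eq_span e k

theorem Adapted.mem_of_le (hP : Adapted e P) {U : Submodule F V} (hU : U ∈ P.carrier)
    {i j : Fin (Module.finrank F V)} (hij : i ≤ j) (hj : e j ∈ U) : e i ∈ U := by
  obtain ⟨k, rfl⟩ := hP U hU
  rw [mem_stdSub] at hj ⊢
  exact lt_of_le_of_lt hij hj

variable (E : Type*) [NormedField E] [Algebra F E]

theorem Adapted.baseChange_eq_span (hP : Adapted e P) {U : Submodule F V} (hU : U ∈ P.carrier) :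
    U.baseChange E = Submodule.span E (e.baseChange E '' {j | e j ∈ U}) := by
  conv_lhs => rw [hP.eq_span hU]
  rw [Submodule.baseChange_span, ← Set.image_comp]
  congr 1
  refine Set.image_congr fun i _ => ?_
  simp

theorem Adapted.mem_baseChange_iff (hP : Adapted e P) {U : Submodule F V} (hU : U ∈ P.carrier)
    (x : E ⊗[F] V) : x ∈ U.baseChange E ↔ ∀ j, e j ∉ U → (e.baseChange E).repr x j = 0 := by
  rw [hP.baseChange_eq_span E hU, mem_span_image_iff]
  rfl

variable (e P) in
/-- The indices of the basis vectors that give rise to a basis of the graded piece at `W`. -/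
abbrev Blk (W : P.Steps) := {j // e j ∈ W.1 ∧ e j ∉ P.pred W.1}

/-- The basis of a graded piece given by an adapted basis. -/
def grB (hP : Adapted e P) (W : P.Steps) : Module.Basis (Blk e P W) E (Gr E P W) :=
  subqBasis (e.baseChange E) {j | e j ∈ W.1} {j | e j ∈ P.pred W.1}
    (hP.baseChange_eq_span E W.2.1) (hP.baseChange_eq_span E (P.pred_mem W))

variable (P) in
theorem span_singleton_ne_bot (e : Module.Basis (Fin (Module.finrank F V)) F V)
    (j : Fin (Module.finrank F V)) : Submodule.span F {e j} ≠ ⊥ := by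
  rw [Ne, Submodule.span_singleton_eq_bot]
  exact e.ne_zero j

variable (e P) in
/-- The graded piece to which an index belongs. -/
def blk (j : Fin (Module.finrank F V)) : P.Steps :=
  P.cover (Submodule.span F {e j}) (span_singleton_ne_bot e j)

theorem blk_eq_iff {j : Fin (Module.finrank F V)} {W : P.Steps} :
    blk e P j = W ↔ e j ∈ W.1 ∧ e j ∉ P.pred W.1 := by
  rw [blk, P.cover_eq_iff, Submodule.span_singleton_le_iff_mem, Submodule.span_singleton_le_iff_mem]

theorem blk_mem (j : Fin (Module.finrank F V)) :
    e j ∈ (blk e P j).1 ∧ e j ∉ P.pred (blk e P j).1 := blk_eq_iff.1 rfl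

theorem blk_of_subset (h : Q.carrier ⊆ P.carrier) (j : Fin (Module.finrank F V)) :
    Q.cover (blk e P j).1 (blk e P j).2.2 = blk e Q j := ParFlag.cover_trans h _

theorem Adapted.exists_mem_blk (hP : Adapted e P) (W : P.Steps) : ∃ j, blk e P j = W := by
  by_contra! h
  have h1 : ∀ j, e j ∈ W.1 → e j ∈ P.pred W.1 := by
    intro j hj
    by_contra hj'
    exact h j (blk_eq_iff.2 ⟨hj, hj'⟩)
  refine (P.pred_lt W).not_ge ?_
  refine (hP.eq_span W.2.1).le.trans (Submodule.span_le.2 ?_)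
  rintro _ ⟨j, hj, rfl⟩
  exact h1 j hj

/-- Every flag has an adapted basis. -/
theorem exists_adapted (P : ParFlag F V) :
    ∃ e : Module.Basis (Fin (Module.finrank F V)) F V, Adapted e P := by
  have key : ∀ k ≤ Module.finrank F V, ∃ v : Fin k → V, LinearIndependent F v ∧
      ∀ U ∈ P.carrier, ∀ i : Fin k, i.1 < Module.finrank F U → v i ∈ U := by
    intro k
    induction k with
    | zero => exact fun _ => ⟨Fin.elim0, linearIndependent_empty_type, fun _ _ i => i.elim0⟩
    | succ k ih =>
      intro hk
      obtain ⟨v, hv, hvU⟩ := ih (by omega)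
      -- The next vector is taken from the smallest member of dimension greater than `k`, outside
      -- the span of the previous ones. It then lies in every member of dimension greater than `k`.
      let T : Set (Submodule F V) := {U | U ∈ P.carrier ∧ k < Module.finrank F U}
      have hT := P.sInf_mem (T := T) (fun _ h => h.1) ⟨⊤, P.top_mem, by rw [finrank_top]; omega⟩
      set U₀ := sInf T
      have hle : Submodule.span F (Set.range v) ≤ U₀ := by
        rw [Submodule.span_le]
        rintro _ ⟨i, rfl⟩
        exact hvU U₀ hT.1 i (i.2.trans hT.2)
      have hne : ¬ U₀ ≤ Submodule.span F (Set.range v) := by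
        intro h
        have h1 := Submodule.finrank_mono h
        rw [finrank_span_eq_card hv, Fintype.card_fin] at h1
        exact absurd hT.2 (by omega)
      obtain ⟨x, hx, hx'⟩ := Set.not_subset.1 hne
      refine ⟨Fin.snoc v x, ?_, fun U hU i hi => ?_⟩
      · rw [linearIndependent_finSnoc]
        exact ⟨hv, hx'⟩
      · induction i using Fin.lastCases with
        | last =>
          rw [Fin.snoc_last]
          exact (sInf_le ⟨hU, hi⟩ : U₀ ≤ U) hx
        | cast i =>
          rw [Fin.snoc_castSucc]
          exact hvU U hU i hi
  obtain ⟨v, hv, hvU⟩ := key _ le_rfl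
  let e : Module.Basis (Fin (Module.finrank F V)) F V :=
    basisOfLinearIndependentOfCardEqFinrank' v hv (by simp)
  have he : ⇑e = v := by simp [e]
  refine ⟨e, fun U hU => ⟨Module.finrank F U, ?_⟩⟩
  symm
  apply Submodule.eq_of_le_of_finrank_le
  · rw [stdSub, Submodule.span_le]
    rintro _ ⟨i, hi, rfl⟩
    rw [he]
    exact hvU U hU i hi
  · have hle : Module.finrank F U ≤ Module.finrank F V := Submodule.finrank_le U
    have h1 : stdSub e (Module.finrank F U) =
        Submodule.span F (Set.range fun i : Fin (Module.finrank F U) => e (Fin.castLE hle i)) := by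
      rw [stdSub]
      congr 1
      ext x
      constructor
      · rintro ⟨i, hi, rfl⟩
        exact ⟨⟨i.1, hi⟩, rfl⟩
      · rintro ⟨i, rfl⟩
        exact ⟨_, i.2, rfl⟩
    rw [h1, finrank_span_eq_card, Fintype.card_fin]
    exact e.linearIndependent.comp _ (Fin.castLE_injective hle)

end FlagLemmas

section Frames

open scoped Classical

variable {F V : Type*} [Field F] [AddCommGroup V] [Module F V] [FiniteDimensional F V]
  {e : Module.Basis (Fin (Module.finrank F V)) F V} {P Q : ParFlag F V}
  {E : Type*} [NormedField E] [LocField E] [Algebra F E]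

/-! ### Unitriangular elements of parabolic subgroups -/

/-- The automorphism of `V_v` whose inverse is given by a unitriangular matrix. -/
def utAut (e : Module.Basis (Fin (Module.finrank F V)) F V) (A : UT E (Fin (Module.finrank F V))) :
    (E ⊗[F] V) ≃ₗ[E] (E ⊗[F] V) :=
  (e.baseChange E).equiv (twBasis (e.baseChange E) A) (Equiv.refl _)

theorem repr_utAut_symm (A : UT E (Fin (Module.finrank F V))) (x : E ⊗[F] V) :
    ⇑((e.baseChange E).repr ((utAut e A).symm x)) = A.1.mulVec ((e.baseChange E).repr x) := by
  rw [← twBasis_repr]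
  have h : ∀ y, (twBasis (e.baseChange E) A).repr (utAut e A y) = (e.baseChange E).repr y := by
    intro y
    have : (utAut e A).trans (twBasis (e.baseChange E) A).repr = (e.baseChange E).repr := by
      apply (e.baseChange E).ext'
      intro i
      rw [LinearEquiv.trans_apply, utAut, Module.Basis.equiv_apply, Module.Basis.repr_self,
        Module.Basis.repr_self]
      rfl
    exact LinearEquiv.congr_fun this y
  rw [← h, LinearEquiv.apply_symm_apply]

theorem mulVec_eq_zero_of_notMem (hP : Adapted e P) {U : Submodule F V} (hU : U ∈ P.carrier)
    (A : UT E (Fin (Module.finrank F V))) {z : Fin (Module.finrank F V) → E}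
    (hz : ∀ j, e j ∉ U → z j = 0) (j : Fin (Module.finrank F V)) (hj : e j ∉ U) :
    A.1.mulVec z j = 0 := by
  rw [Matrix.mulVec, dotProduct]
  refine Finset.sum_eq_zero fun i _ => ?_
  rcases lt_or_ge i j with h | h
  · rw [A.2.2 j i h, zero_mul]
  · rw [hz i fun hi => hj (hP.mem_of_le hU h hi), mul_zero]

/-- The element of the parabolic subgroup given by a unitriangular matrix. -/
def utPar (hP : Adapted e P) (A : UT E (Fin (Module.finrank F V))) : Par E P :=
  ⟨utAut e A, fun U hU => by
    ext x
    have h1 : x ∈ (U.baseChange E).map (utAut e A : (E ⊗[F] V) →ₗ[E] (E ⊗[F] V)) ↔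
        (utAut e A).symm x ∈ U.baseChange E := by
      constructor
      · rintro ⟨y, hy, rfl⟩
        simpa using hy
      · intro h
        exact ⟨_, h, (utAut e A).apply_symm_apply x⟩
    rw [h1, hP.mem_baseChange_iff E hU, hP.mem_baseChange_iff E hU, repr_utAut_symm]
    constructor
    · intro h
      have h2 := mulVec_eq_zero_of_notMem hP hU A.inv h
      rwa [Matrix.mulVec_mulVec, UT.inv_mul, Matrix.one_mulVec] at h2
    · intro h
      exact mulVec_eq_zero_of_notMem hP hU A h⟩

variable (e P) in
/-- The diagonal block of a unitriangular matrix at a graded piece. -/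
def resUT (W : P.Steps) (A : UT E (Fin (Module.finrank F V))) : UT E (Blk e P W) :=
  ⟨A.1.submatrix Subtype.val Subtype.val, fun i => A.2.1 i.1, fun i j h => A.2.2 i.1 j.1 h⟩

variable (e P) in
/-- The part of a tuple of weights that belongs to a graded piece. -/
def resPos (W : P.Steps) (ρ : Pos (Fin (Module.finrank F V))) : Pos (Blk e P W) :=
  ⟨fun j => ρ.1 j.1, fun j => ρ.2 j.1⟩

/-- The block diagonal matrix with given blocks. -/
def glueUT (a : ∀ W : P.Steps, UT E (Blk e P W)) : UT E (Fin (Module.finrank F V)) :=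
  ⟨fun i j => if h : e j ∈ (blk e P i).1 ∧ e j ∉ P.pred (blk e P i).1 then
      (a (blk e P i)).1 ⟨i, blk_mem i⟩ ⟨j, h⟩ else 0,
    fun i => by
      change dite _ _ _ = _
      rw [dif_pos (blk_mem i)]
      exact (a (blk e P i)).2.1 ⟨i, blk_mem i⟩,
    fun i j hij => by
      change dite _ _ _ = _
      split_ifs with h
      · exact (a (blk e P i)).2.2 ⟨i, blk_mem i⟩ ⟨j, h⟩ hij
      · rfl⟩

/-- The tuple of weights with given parts. -/
def gluePos (r : ∀ W : P.Steps, Pos (Blk e P W)) : Pos (Fin (Module.finrank F V)) :=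
  ⟨fun i => (r (blk e P i)).1 ⟨i, blk_mem i⟩, fun i => (r (blk e P i)).2 _⟩

theorem resUT_glueUT (a : ∀ W : P.Steps, UT E (Blk e P W)) (W : P.Steps) :
    resUT e P W (glueUT a) = a W := by
  apply Subtype.ext
  ext ⟨i, hi⟩ ⟨j, hj⟩
  obtain rfl : blk e P i = W := blk_eq_iff.2 hi
  change dite _ _ _ = _
  rw [dif_pos hj]

theorem resPos_gluePos (r : ∀ W : P.Steps, Pos (Blk e P W)) (W : P.Steps) :
    resPos e P W (gluePos r) = r W := by
  apply Subtype.ext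
  funext ⟨i, hi⟩
  obtain rfl : blk e P i = W := blk_eq_iff.2 hi
  rfl

/-! ### Standard norms on graded pieces -/

variable (E) in
/-- The norm on a graded piece given by an adapted basis and a tuple of weights. -/
def stdN (hP : Adapted e P) (W : P.Steps) (ρ : Pos (Fin (Module.finrank F V))) :
    NormOn E (Gr E P W) :=
  ⟨basisNorm (grB E hP W) fun j => ρ.1 j.1, isNorm_basisNorm _ _ fun j => ρ.2 j.1⟩

/-- The translate of a standard norm by an element of the parabolic subgroup. -/
def grN (hP : Adapted e P) (W : P.Steps) (g : Par E P) (ρ : Pos (Fin (Module.finrank F V))) :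
    NormOn E (Gr E P W) :=
  ⟨(stdN E hP W ρ).1 ∘ (grHom E P W g).symm, (stdN E hP W ρ).2.comp_equiv _⟩

theorem grHom_symm_mk (W : P.Steps) (g : Par E P) {y : E ⊗[F] V} (hy : y ∈ W.1.baseChange E) :
    (grHom E P W g).symm (Submodule.mkQ _ ⟨y, hy⟩) =
      Submodule.mkQ _ ⟨g.1.symm y, (mem_iff_of_map_eq (g.2 _ W.2.1) y).2 hy⟩ :=
  subqEquiv_symm_mk g.1 (g.2 _ W.2.1) (g.2 _ (P.pred_mem W)) hy

theorem grN_apply (hP : Adapted e P) (W : P.Steps) (g : Par E P)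
    (ρ : Pos (Fin (Module.finrank F V))) {y : E ⊗[F] V} (hy : y ∈ W.1.baseChange E) :
    (grN hP W g ρ).1 (Submodule.mkQ _ ⟨y, hy⟩) =
      osum E (Finset.univ.filter fun j => e j ∈ W.1 ∧ e j ∉ P.pred W.1)
        fun j => ρ.1 j * nabs E ((e.baseChange E).repr (g.1.symm y) j) := by
  have h1 : (grN hP W g ρ).1 (Submodule.mkQ _ ⟨y, hy⟩) =
      (stdN E hP W ρ).1 ((grHom E P W g).symm (Submodule.mkQ _ ⟨y, hy⟩)) := rfl
  rw [h1, grHom_symm_mk]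
  exact basisNorm_subqBasis (e.baseChange E) {j | e j ∈ W.1} {j | e j ∈ P.pred W.1} _ _ ρ.1 _

/-- Only the diagonal block matters: coordinates beyond the block vanish for vectors of `W`, and
matrix entries in the columns before the block lie below the diagonal. -/
theorem repr_grHom_utPar_symm (hP : Adapted e P) (W : P.Steps)
    (A : UT E (Fin (Module.finrank F V))) (x : Gr E P W) :
    ⇑((grB E hP W).repr ((grHom E P W (utPar hP A)).symm x)) =
      (resUT e P W A).1.mulVec ((grB E hP W).repr x) := by
  obtain ⟨⟨x, hx⟩, rfl⟩ := Submodule.mkQ_surjective _ x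
  rw [grHom_symm_mk]
  funext j
  refine (subqBasis_repr _ _ _ _ _ _ j).trans ?_
  change (e.baseChange E).repr ((utAut e A).symm x) j.1 = _
  rw [repr_utAut_symm]
  have hx' := (hP.mem_baseChange_iff E W.2.1 x).1 hx
  have h1 : A.1.mulVec ((e.baseChange E).repr x) j.1 =
      ∑ i ∈ Finset.univ.filter fun i => e i ∈ W.1 ∧ e i ∉ P.pred W.1,
        A.1 j.1 i * (e.baseChange E).repr x i := by
    rw [Matrix.mulVec, dotProduct]
    refine (Finset.sum_subset (Finset.subset_univ _) fun i _ hi => ?_).symm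
    simp only [Finset.mem_filter, Finset.mem_univ, true_and, not_and_or, not_not] at hi
    rcases hi with hi | hi
    · rw [hx' i hi, mul_zero]
    · have hij : i < j.1 := by
        by_contra! h
        exact j.2.2 (hP.mem_of_le (P.pred_mem W) h hi)
      rw [A.2.2 j.1 i hij, zero_mul]
  rw [h1, Finset.sum_subtype (p := fun i => e i ∈ W.1 ∧ e i ∉ P.pred W.1) _ (by simp)]
  rw [Matrix.mulVec, dotProduct]
  refine Finset.sum_congr rfl fun i _ => ?_
  congr 1
  exact (subqBasis_repr _ _ _ _ _ hx i).symm

theorem grN_utPar (hP : Adapted e P) (W : P.Steps) (A : UT E (Fin (Module.finrank F V)))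
    (ρ : Pos (Fin (Module.finrank F V))) :
    grN hP W (utPar hP A) ρ = utNorm (grB E hP W) (resUT e P W A, resPos e P W ρ) := by
  apply Subtype.ext
  funext x
  change basisNorm (grB E hP W) (fun j => ρ.1 j.1) ((grHom E P W (utPar hP A)).symm x) = _
  rw [basisNorm_eq, repr_grHom_utPar_symm, utNorm_apply]
  rfl

/-- The point of `X̄_{F,v}(P)` with a given flag and standard norms. -/
def pt (hP : Adapted e P) (h : Q.carrier ⊆ P.carrier) (ρ : Pos (Fin (Module.finrank F V))) :
    XBarP E P :=
  ⟨⟨Q, fun U => NormClass.mk (stdN E (hP.mono h) U ρ)⟩, h⟩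

theorem smul_pt_cls (hP : Adapted e P) (h : Q.carrier ⊆ P.carrier)
    (ρ : Pos (Fin (Module.finrank F V))) (g : Par E P) (U : Q.Steps) :
    (g • (pt hP h ρ : XBarP E P)).1.cls U =
      NormClass.mk (grN (hP.mono h) U (Subgroup.inclusion (Par_mono E h) g) ρ) := rfl

/-- The constant comes from the arbitrary choice of a norm in the class at `U`. That it is the same
for all graded pieces of `P` inside `U` is what makes φ' independent of this choice. -/
theorem induced_smul_pt (hP : Adapted e P) (h : Q.carrier ⊆ P.carrier)
    (ρ : Pos (Fin (Module.finrank F V))) (g : Par E P) (U : Q.Steps) :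
    ∃ c : ℝ≥0, 0 < c ∧ ((g • (pt hP h ρ : XBarP E P)).1.cls U).rep =
        (fun x => c * (grN (hP.mono h) U (Subgroup.inclusion (Par_mono E h) g) ρ).1 x) ∧
      ∀ W : P.Steps, Q.cover W.1 W.2.2 = U →
        (g • (pt hP h ρ : XBarP E P)).1.induced E U P W = fun x => c * (grN hP W g ρ).1 x := by
  obtain ⟨c, hc, hrep⟩ := NormClass.exists_rep
    (grN (hP.mono h) U (Subgroup.inclusion (Par_mono E h) g) ρ)
  refine ⟨c, hc, hrep, fun W hW => ?_⟩
  obtain ⟨h1, h2⟩ := ParFlag.pred_mono_of_cover h W hW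
  change subquotNorm _ _ (NormClass.mk
    (grN (hP.mono h) U (Subgroup.inclusion (Par_mono E h) g) ρ)).rep = _
  rw [hrep, subquotNorm_const_mul (Submodule.baseChange_mono E h1) hc]
  have h3 := subquotNorm_comp_symm g.1 (g.2 _ (h U.2.1)) (g.2 _ (h (Q.pred_mem U)))
    (g.2 _ W.2.1) (g.2 _ (P.pred_mem W)) (stdN E (hP.mono h) U ρ).1
  have h4 : subquotNorm (W.1.baseChange E) ((P.pred W.1).baseChange E)
      (stdN E (hP.mono h) U ρ).1 = (stdN E hP W ρ).1 :=
    subquotNorm_subqBasis (e.baseChange E) (u := {j | e j ∈ U.1}) (s := {j | e j ∈ Q.pred U.1})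
      (u' := {j | e j ∈ W.1}) (s' := {j | e j ∈ P.pred W.1}) (fun j hj => h2 hj)
      (fun j hj => h1 hj) _ _ _ _ ρ.1
  rw [h4] at h3
  exact congrArg (fun f x => c * f x) h3

/-- On each graded piece of the flag of `x`, the norm is unitriangular with respect to the adapted
basis. The blocks and weights obtained in this way are glued to one block diagonal matrix and one
tuple for the whole space. -/
theorem exists_frame (hP : Adapted e P) (x : XBarP E P) :
    ∃ (A : UT E (Fin (Module.finrank F V))) (ρ : Pos (Fin (Module.finrank F V))),
      x = utPar hP A • pt hP x.2 ρ := by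
  obtain ⟨⟨Q, cls⟩, h⟩ := x
  have hex : ∀ U : Q.Steps, ∃ y : UT E (Blk e Q U) × Pos (Blk e Q U),
      NormClass.mk (utNorm (grB E (hP.mono h) U) y) = cls U := by
    intro U
    obtain ⟨μ, hμ⟩ := NormClass.mk_surjective (cls U)
    obtain ⟨y, rfl⟩ := utNorm_surjective (grB E (hP.mono h) U) μ
    exact ⟨y, hμ⟩
  choose y hy using hex
  refine ⟨glueUT fun U => (y U).1, gluePos fun U => (y U).2, Subtype.ext ?_⟩
  change XBar.mk Q cls = XBar.mk Q _
  congr 1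
  funext U
  have h1 := grN_utPar (hP.mono h) U (glueUT fun U => (y U).1) (gluePos fun U => (y U).2)
  rw [resUT_glueUT, resPos_gluePos] at h1
  rw [← hy U, ← h1]
  rfl

theorem exists_frame_par (x : XBarP E P) :
    ∃ (e : Module.Basis (Fin (Module.finrank F V)) F V) (hP : Adapted e P) (Q : ParFlag F V)
      (h : Q.carrier ⊆ P.carrier) (g : Par E P) (ρ : Pos (Fin (Module.finrank F V))),
      x = g • pt hP h ρ := by
  obtain ⟨e, hP⟩ := exists_adapted P
  obtain ⟨A, ρ, h⟩ := exists_frame hP x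
  exact ⟨e, hP, _, _, _, ρ, h⟩

/-! ### The maps `φ` and `φ'` on translates of standard points -/

theorem isNorm_induced (x : XBarP E P) (W : P.Steps) :
    IsNorm E (x.1.induced E (x.1.flag.cover W.1 W.2.2) P W) := by
  obtain ⟨e, hP, Q, h, g, ρ, rfl⟩ := exists_frame_par x
  obtain ⟨c, hc, -, h1⟩ := induced_smul_pt hP h ρ g (Q.cover W.1 W.2.2)
  have h2 : IsNorm E ((g • (pt hP h ρ : XBarP E P)).1.induced E (Q.cover W.1 W.2.2) P W) := by
    rw [h1 W rfl]
    exact (grN hP W g ρ).2.const_mul hc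
  exact h2

theorem phi_smul_pt (hP : Adapted e P) (h : Q.carrier ⊆ P.carrier)
    (ρ : Pos (Fin (Module.finrank F V))) (g : Par E P) (W : P.Steps) :
    phi E P (g • pt hP h ρ) W = NormClass.mk (grN hP W g ρ) := by
  obtain ⟨c, hc, -, h1⟩ := induced_smul_pt hP h ρ g (Q.cover W.1 W.2.2)
  exact NormClass.ofFun_eq _ hc (congrFun (h1 W rfl))

/-- The absolute value of a norm relative to a basis, normalized to be homogeneous of degree one. -/
def hAbs {H : Type*} [AddCommGroup H] [Module E H]
    (b : Module.Basis (Fin (Module.finrank E H)) E H) (μ : H → ℝ≥0) : ℝ≥0 :=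
  absVal b μ ^ (1 / (Module.finrank E H : ℝ))

theorem hAbs_pos {H : Type*} [AddCommGroup H] [Module E H]
    (b : Module.Basis (Fin (Module.finrank E H)) E H) {μ : H → ℝ≥0} (h : IsNorm E μ) :
    0 < hAbs b μ := NNReal.rpow_pos (absVal_pos h b)

theorem hAbs_const_mul {H : Type*} [AddCommGroup H] [Module E H]
    (hd : Module.finrank E H ≠ 0)
    (b : Module.Basis (Fin (Module.finrank E H)) E H) {μ : H → ℝ≥0} (h : IsNorm E μ) {c : ℝ≥0}
    (hc : 0 < c) : hAbs b (fun x => c * μ x) = c * hAbs b μ := by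
  rw [hAbs, hAbs, absVal_const_mul h hc, NNReal.mul_rpow]
  congr 1
  rw [one_div, NNReal.pow_rpow_inv_natCast c hd]

theorem finrank_gr_ne_zero (P : ParFlag F V) (W : P.Steps) : Module.finrank E (Gr E P W) ≠ 0 := by
  obtain ⟨e, hP⟩ := exists_adapted P
  obtain ⟨j, hj⟩ := hP.exists_mem_blk W
  have : Nonempty (Blk e P W) := ⟨⟨j, blk_eq_iff.1 hj⟩⟩
  rw [Module.finrank_eq_card_basis (grB E hP W)]
  exact Fintype.card_ne_zero

theorem phi'_of_mem (b : GrBases E P) (x : XBarP E P) (W : P.Inner) (hW : W.1 ∈ x.1.flag.carrier) :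
    phi' E P b x W = 0 := if_pos hW

/-- `hAbs` is homogeneous of degree one on every graded piece, whatever its dimension, so a common
factor of the two norms cancels. -/
theorem phi'_of_notMem (b : GrBases E P) (x : XBarP E P) (W : P.Inner)
    (hW : W.1 ∉ x.1.flag.carrier) {μ : NormOn E (Gr E P (P.lower W))}
    {ν : NormOn E (Gr E P (P.upper W))} {c : ℝ≥0} (hc : 0 < c)
    (hμ : x.1.induced E (x.1.flag.cover (P.upper W).1 (P.upper W).2.2) P (P.lower W) =
      fun y => c * μ.1 y)
    (hν : x.1.induced E (x.1.flag.cover (P.upper W).1 (P.upper W).2.2) P (P.upper W) =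
      fun y => c * ν.1 y) :
    phi' E P b x W = hAbs (b (P.lower W)) μ.1 / hAbs (b (P.upper W)) ν.1 := by
  have h1 := hAbs_const_mul (finrank_gr_ne_zero P _) (b (P.lower W)) μ.2 hc
  have h2 := hAbs_const_mul (finrank_gr_ne_zero P _) (b (P.upper W)) ν.2 hc
  rw [← mul_div_mul_left _ _ hc.ne', ← h1, ← h2, ← hμ, ← hν, div_eq_mul_inv, phi', if_neg hW]
  simp only [hAbs, neg_div, NNReal.rpow_neg]

theorem phi'_smul_pt (hP : Adapted e P) (h : Q.carrier ⊆ P.carrier) (b : GrBases E P)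
    (ρ : Pos (Fin (Module.finrank F V))) (g : Par E P) (W : P.Inner) (hW : W.1 ∉ Q.carrier) :
    phi' E P b (g • pt hP h ρ) W = hAbs (b (P.lower W)) (grN hP (P.lower W) g ρ).1 /
      hAbs (b (P.upper W)) (grN hP (P.upper W) g ρ).1 := by
  obtain ⟨c, hc, -, h1⟩ := induced_smul_pt hP h ρ g (Q.cover (P.upper W).1 (P.upper W).2.2)
  exact phi'_of_notMem b (g • pt hP h ρ) W hW hc
    (h1 _ (ParFlag.cover_upper_of_notMem h W hW)) (h1 _ rfl)

/-- Away from the flag the coordinate is a quotient of positive absolute values. Thus the zeros of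
φ' recover the flag of the point. -/
theorem phi'_eq_zero_iff (b : GrBases E P) (x : XBarP E P) (W : P.Inner) :
    phi' E P b x W = 0 ↔ W.1 ∈ x.1.flag.carrier := by
  refine ⟨fun h => ?_, phi'_of_mem b x W⟩
  by_contra hW
  obtain ⟨e, hP, Q, hQ, g, ρ, rfl⟩ := exists_frame_par x
  have h1 := phi'_smul_pt hP hQ b ρ g W hW
  rw [h] at h1
  exact (div_pos (hAbs_pos (b (P.lower W)) (grN hP (P.lower W) g ρ).2)
    (hAbs_pos (b (P.upper W)) (grN hP (P.upper W) g ρ).2)).ne h1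

/-! ### Equivariance -/

theorem grN_mul (hP : Adapted e P) (W : P.Steps) (g g' : Par E P)
    (ρ : Pos (Fin (Module.finrank F V))) :
    (grN hP W (g * g') ρ).1 = (grN hP W g' ρ).1 ∘ (grHom E P W g).symm := by
  funext x
  change (stdN E hP W ρ).1 ((grHom E P W (g * g')).symm x) =
    (stdN E hP W ρ).1 ((grHom E P W g').symm ((grHom E P W g).symm x))
  rw [map_mul]
  rfl

theorem phi_smul (g : Par E P) (x : XBarP E P) (W : P.Steps) :
    phi E P (g • x) W = grHom E P W g • phi E P x W := by
  obtain ⟨e, hP, Q, h, g', ρ, rfl⟩ := exists_frame_par x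
  rw [← mul_smul, phi_smul_pt, phi_smul_pt, NormClass.smul_mk]
  congr 1
  exact Subtype.ext (grN_mul hP W g g' ρ)

theorem hAbs_comp_symm {H : Type*} [AddCommGroup H] [Module E H]
    (b : Module.Basis (Fin (Module.finrank E H)) E H) {μ : H → ℝ≥0} (h : IsNorm E μ)
    (g : H ≃ₗ[E] H) :
    hAbs b (μ ∘ g.symm) =
      (nabs E (LinearMap.det (g : H →ₗ[E] H)) ^ (1 / (Module.finrank E H : ℝ)))⁻¹ * hAbs b μ := by
  rw [hAbs, absVal_comp_symm h, NNReal.mul_rpow, NNReal.inv_rpow]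
  rfl

theorem tFactor_eq (g : Par E P) (W : P.Inner) :
    tFactor E P g W =
      nabs E (LinearMap.det (grHom E P (P.upper W) g : Gr E P (P.upper W) →ₗ[E] _)) ^
        (1 / (Module.finrank E (Gr E P (P.upper W)) : ℝ)) /
      nabs E (LinearMap.det (grHom E P (P.lower W) g : Gr E P (P.lower W) →ₗ[E] _)) ^
        (1 / (Module.finrank E (Gr E P (P.lower W)) : ℝ)) := by
  rw [tFactor]
  simp only [neg_div, NNReal.rpow_neg]
  exact (div_eq_mul_inv _ _).symm

theorem phi'_smul (b : GrBases E P) (g : Par E P) (x : XBarP E P) (W : P.Inner) :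
    phi' E P b (g • x) W = tFactor E P g W * phi' E P b x W := by
  by_cases hW : W.1 ∈ x.1.flag.carrier
  · rw [phi'_of_mem b x W hW, phi'_of_mem b (g • x) W hW, mul_zero]
  obtain ⟨e, hP, Q, h, g', ρ, rfl⟩ := exists_frame_par x
  have h1 := phi'_smul_pt hP h b ρ g' W hW
  have h2 := phi'_smul_pt hP h b ρ (g * g') W hW
  rw [mul_smul, grN_mul, grN_mul, hAbs_comp_symm _ (grN hP _ g' ρ).2,
    hAbs_comp_symm _ (grN hP _ g' ρ).2] at h2
  rw [h1, h2, tFactor_eq]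
  simp only [div_eq_mul_inv, mul_inv, inv_inv]
  ring

end Frames

section Orbits

open scoped Classical

variable {F V : Type*} [Field F] [AddCommGroup V] [Module F V] [FiniteDimensional F V]
  {e : Module.Basis (Fin (Module.finrank F V)) F V} {P Q : ParFlag F V}
  {E : Type*} [NormedField E] [LocField E] [Algebra F E]

/-! ### Orbits of the unipotent radical -/

/-- A flag contained in that of `P` is determined by its members among the `V_0, ..., V_{m-1}`. -/
theorem ParFlag.eq_of_inner {Q Q' : ParFlag F V} (h : Q.carrier ⊆ P.carrier)
    (h' : Q'.carrier ⊆ P.carrier) (hi : ∀ W : P.Inner, W.1 ∈ Q.carrier ↔ W.1 ∈ Q'.carrier) :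
    Q = Q' := by
  apply ParFlag.ext_carrier
  ext U
  by_cases hb : U = ⊥
  · subst hb
    exact ⟨fun _ => Q'.bot_mem, fun _ => Q.bot_mem⟩
  by_cases ht : U = ⊤
  · subst ht
    exact ⟨fun _ => Q'.top_mem, fun _ => Q.top_mem⟩
  exact ⟨fun hU => (hi ⟨U, h hU, hb, ht⟩).1 hU, fun hU => (hi ⟨U, h' hU, hb, ht⟩).2 hU⟩

theorem mem_uniRad_iff (u : Par E P) : u ∈ UniRad E P ↔ ∀ W, grHom E P W u = 1 := by
  simp [UniRad, Subgroup.mem_iInf, MonoidHom.mem_ker]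

theorem grHom_utPar_congr (hP : Adapted e P) {A B : UT E (Fin (Module.finrank F V))}
    {W : P.Steps} (h : resUT e P W A = resUT e P W B) :
    grHom E P W (utPar hP A) = grHom E P W (utPar hP B) := by
  have h1 : (grHom E P W (utPar hP A)).symm = (grHom E P W (utPar hP B)).symm := by
    ext x
    apply (grB E hP W).repr.injective
    apply DFunLike.coe_injective
    rw [repr_grHom_utPar_symm, repr_grHom_utPar_symm, h]
  exact LinearEquiv.symm_bijective.injective h1

/-- Up to the unipotent radical, a frame can be chosen to be block diagonal. -/
theorem exists_uniRad_block (hP : Adapted e P) (A : UT E (Fin (Module.finrank F V))) :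
    ∃ u ∈ UniRad E P, utPar hP (glueUT fun W => resUT e P W A) = u * utPar hP A := by
  refine ⟨utPar hP (glueUT fun W => resUT e P W A) * (utPar hP A)⁻¹, ?_, by group⟩
  rw [mem_uniRad_iff]
  intro W
  rw [map_mul, map_inv, grHom_utPar_congr hP (resUT_glueUT (fun W => resUT e P W A) W),
    mul_inv_cancel]

theorem glueUT_mulVec (a : ∀ W : P.Steps, UT E (Blk e P W)) (z : Fin (Module.finrank F V) → E)
    {W : P.Steps} (j : Blk e P W) :
    (glueUT a).1.mulVec z j.1 = (a W).1.mulVec (fun i => z i.1) j := by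
  obtain ⟨j, hj⟩ := j
  obtain rfl : blk e P j = W := blk_eq_iff.2 hj
  rw [Matrix.mulVec, Matrix.mulVec, dotProduct, dotProduct,
    ← Finset.sum_subset (Finset.subset_univ
      (Finset.univ.filter fun i => e i ∈ (blk e P j).1 ∧ e i ∉ P.pred (blk e P j).1)),
    Finset.sum_subtype (p := fun i => e i ∈ (blk e P j).1 ∧ e i ∉ P.pred (blk e P j).1) _ (by simp)]
  · refine Finset.sum_congr rfl fun i _ => ?_
    congr 1
    change dite _ _ _ = _
    rw [dif_pos i.2]
  · intro i _ hi
    have h1 : (glueUT a).1 j i = 0 := by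
      change dite _ _ _ = _
      rw [dif_neg]
      simpa using hi
    rw [h1, zero_mul]

/-- The orthogonal sum over the block of a graded piece of `P`. -/
theorem osum_block (A : UT E (Fin (Module.finrank F V))) (ρ : Pos (Fin (Module.finrank F V)))
    (W : P.Steps) (z : Fin (Module.finrank F V) → E) :
    osum E (Finset.univ.filter fun j => e j ∈ W.1 ∧ e j ∉ P.pred W.1)
        (fun j => ρ.1 j * nabs E ((glueUT fun W => resUT e P W A).1.mulVec z j)) =
      wnorm E (resPos e P W ρ).1 ((resUT e P W A).1.mulVec fun i => z i.1) := by
  rw [wnorm, ← osum_subtype]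
  refine osum_congr E fun j _ => ?_
  rw [glueUT_mulVec (fun W => resUT e P W A) z j]
  rfl

/-- The scaling factors between two families of norms that agree up to scalars on the graded pieces
of `P` are constant on the pieces of `Q` if they are equal for neighbors. -/
theorem eq_of_cover_eq (h : Q.carrier ⊆ P.carrier) (c : P.Steps → ℝ≥0)
    (hc : ∀ W : P.Inner, W.1 ∉ Q.carrier → c (P.lower W) = c (P.upper W)) (W' : P.Steps) :
    ∀ W : P.Steps, W.1 ≤ W'.1 → Q.cover W.1 W.2.2 = Q.cover W'.1 W'.2.2 → c W = c W' := by
  obtain ⟨W', hW'⟩ := W'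
  induction W' using WellFoundedLT.induction with
  | ind W' ih =>
    intro W hle hcov
    rcases hle.eq_or_lt with heq | hlt
    · congr 1
      exact Subtype.ext heq
    have h1 : W.1 ≤ P.pred W' := P.le_pred W.2.1 hlt
    have h2 : P.pred W' < W' := P.pred_lt ⟨W', hW'⟩
    have h3 : P.pred W' ∈ P.carrier := P.pred_mem ⟨W', hW'⟩
    have h4 : P.pred W' ≠ ⊥ := ((bot_lt_iff_ne_bot.2 W.2.2).trans_le h1).ne'
    let W₀ : P.Inner := ⟨P.pred W', h3, h4, (h2.trans_le le_top).ne⟩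
    have h5 : P.upper W₀ = ⟨W', hW'⟩ := by
      apply Subtype.ext
      apply le_antisymm (P.upper_le W₀ hW'.1 h2)
      rcases P.le_or_lt hW'.1 (P.upper W₀).2.1 with h | h
      · exact h
      · exact absurd (P.le_pred (P.upper W₀).2.1 h) (P.lt_upper W₀).not_ge
    -- Were the predecessor of `W'` in `Q`, it would contain the cover of `W`, which is also the
    -- cover of `W'`; but it is strictly smaller than `W'`. So the scalars at `W'` and at its
    -- predecessor agree and the induction descends.
    have h6 : W₀.1 ∉ Q.carrier := by
      intro hmem
      have h7 := Q.cover_le W.2.2 hmem h1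
      rw [hcov] at h7
      exact h2.not_ge ((Q.le_cover hW'.2).trans h7)
    rw [← h5, ← hc W₀ h6]
    refine ih _ h2 ⟨h3, h4⟩ W h1 ?_
    rw [Q.cover_eq_iff]
    refine ⟨h1.trans (Q.le_cover _), fun hle' => ?_⟩
    have h8 : Q.cover W.1 W.2.2 = Q.cover (P.pred W') h4 := by
      have h9 := ParFlag.cover_upper_of_notMem h W₀ h6
      rw [h5] at h9
      exact hcov.trans h9.symm
    rw [← h8] at hle'
    rw [h8] at hle'
    exact ((Q.cover_eq_iff W.2.2 _).1 h8).2 hle'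

theorem smul_pt_eq_smul_pt (hP : Adapted e P) (hQ : Q.carrier ⊆ P.carrier) {g g' : Par E P}
    {ρ ρ' : Pos (Fin (Module.finrank F V))}
    (h : ∀ U : Q.Steps, ∃ c : ℝ≥0, 0 < c ∧
      ∀ y, (grN (hP.mono hQ) U (Subgroup.inclusion (Par_mono E hQ) g') ρ').1 y =
        c * (grN (hP.mono hQ) U (Subgroup.inclusion (Par_mono E hQ) g) ρ).1 y) :
    g • pt hP hQ ρ = g' • (pt hP hQ ρ' : XBarP E P) := by
  apply Subtype.ext
  change XBar.mk Q _ = XBar.mk Q _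
  congr 1
  funext U
  refine (smul_pt_cls hP hQ ρ g U).trans (Eq.trans ?_ (smul_pt_cls hP hQ ρ' g' U).symm)
  exact NormClass.mk_eq_mk.2 (h U)

/-- Block diagonal frames whose norms agree on the graded pieces of `P` up to scalars that are
constant on the graded pieces of `Q` give the same point. -/
theorem smul_pt_eq_of_block (hP : Adapted e P) (hQ : Q.carrier ⊆ P.carrier)
    {A A' : UT E (Fin (Module.finrank F V))} {ρ ρ' : Pos (Fin (Module.finrank F V))}
    (c : P.Steps → ℝ≥0) (hc : ∀ W, 0 < c W)
    (hadj : ∀ W : P.Inner, W.1 ∉ Q.carrier → c (P.lower W) = c (P.upper W))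
    (hblock : ∀ (W : P.Steps) (z : Fin (Module.finrank F V) → E),
      wnorm E (resPos e P W ρ').1 ((resUT e P W A').1.mulVec fun i => z i.1) =
        c W * wnorm E (resPos e P W ρ).1 ((resUT e P W A).1.mulVec fun i => z i.1)) :
    utPar hP (glueUT fun W => resUT e P W A) • pt hP hQ ρ =
      utPar hP (glueUT fun W => resUT e P W A') • (pt hP hQ ρ' : XBarP E P) := by
  refine smul_pt_eq_smul_pt hP hQ fun U => ?_
  obtain ⟨j₀, hj₀⟩ := (hP.mono hQ).exists_mem_blk U
  refine ⟨c (blk e P j₀), hc _, fun y => ?_⟩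
  obtain ⟨⟨y, hy⟩, rfl⟩ := Submodule.mkQ_surjective _ y
  rw [grN_apply, grN_apply, mul_osum]
  change osum E _ (fun j => ρ'.1 j * nabs E ((e.baseChange E).repr ((utAut e _).symm y) j)) =
    osum E _ fun j => _ * (ρ.1 j * nabs E ((e.baseChange E).repr ((utAut e _).symm y) j))
  rw [repr_utAut_symm, repr_utAut_symm]
  -- The indices of a graded piece of `Q` split into blocks of `P`, which block diagonal matrices do
  -- not mix. It suffices to compare the partial sums, with a scalar that is the same for all blocks
  -- concerned.
  apply osum_fiberwise E (blk e P)
  intro W hW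
  obtain ⟨j₁, hj₁, rfl⟩ := Finset.mem_image.1 hW
  have hj₁' : blk e Q j₁ = U := blk_eq_iff.2 (Finset.mem_filter.1 hj₁).2
  have hfilter : (Finset.univ.filter fun j => e j ∈ U.1 ∧ e j ∉ Q.pred U.1).filter
      (blk e P · = blk e P j₁) =
      Finset.univ.filter fun j => e j ∈ (blk e P j₁).1 ∧ e j ∉ P.pred (blk e P j₁).1 := by
    ext j
    simp only [Finset.mem_filter, Finset.mem_univ, true_and, ← blk_eq_iff]
    refine ⟨fun h => h.2, fun h => ⟨?_, h⟩⟩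
    rw [← hj₁', ← blk_of_subset hQ, ← blk_of_subset hQ, h]
  have hcc : c (blk e P j₀) = c (blk e P j₁) := by
    have hcov : Q.cover (blk e P j₀).1 (blk e P j₀).2.2 =
        Q.cover (blk e P j₁).1 (blk e P j₁).2.2 := by
      rw [blk_of_subset hQ, blk_of_subset hQ, hj₀, hj₁']
    rcases P.le_or_lt (blk e P j₀).2.1 (blk e P j₁).2.1 with h | h
    · exact eq_of_cover_eq hQ c hadj _ _ h hcov
    · exact (eq_of_cover_eq hQ c hadj _ _ h.le hcov.symm).symm
  rw [hfilter, osum_block, hblock, ← osum_block, mul_osum, hcc]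

theorem exists_common_frames (hP : Adapted e P) (x x' : XBarP E P)
    (hflag : x.1.flag = x'.1.flag) :
    ∃ (Q : ParFlag F V) (hQ : Q.carrier ⊆ P.carrier) (A A' : UT E (Fin (Module.finrank F V)))
      (ρ ρ' : Pos (Fin (Module.finrank F V))),
      x = utPar hP A • pt hP hQ ρ ∧ x' = utPar hP A' • pt hP hQ ρ' := by
  obtain ⟨A, ρ, hx⟩ := exists_frame hP x
  obtain ⟨A', ρ', hx'⟩ := exists_frame hP x'
  refine ⟨x.1.flag, x.2, A, A', ρ, ρ', hx, ?_⟩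
  generalize_proofs at hx' ⊢
  -- The two flags are only propositionally equal, and the type of the class of norms depends on the
  -- flag. The claim is therefore generalized to an arbitrary flag before substitution.
  have : ∀ (Q' : ParFlag F V) (hQ' : Q'.carrier ⊆ P.carrier) (_ : x.1.flag = Q'),
      x' = utPar hP A' • pt hP hQ' ρ' → x' = utPar hP A' • pt hP x.2 ρ' := by
    rintro Q' hQ' rfl h
    exact h
  exact this _ _ hflag hx'

/-- Equality of φ provides a scalar for each graded piece of `P`. Equality of φ' forces the scalars
of neighbors to agree unless a member of `Q` separates them. Elements of the unipotent radical make
both frames block diagonal, and then the norms on each graded piece of `Q` differ by a single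
scalar. -/
theorem exists_uniRad_smul_pt (hP : Adapted e P) (hQ : Q.carrier ⊆ P.carrier) (b : GrBases E P)
    (A A' : UT E (Fin (Module.finrank F V))) (ρ ρ' : Pos (Fin (Module.finrank F V)))
    (h1 : phi E P (utPar hP A • pt hP hQ ρ) = phi E P (utPar hP A' • pt hP hQ ρ'))
    (h2 : phi' E P b (utPar hP A • pt hP hQ ρ) = phi' E P b (utPar hP A' • pt hP hQ ρ')) :
    ∃ u ∈ UniRad E P, u • utPar hP A • (pt hP hQ ρ : XBarP E P) = utPar hP A' • pt hP hQ ρ' := by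
  have hc : ∀ W : P.Steps, ∃ c : ℝ≥0, 0 < c ∧
      ∀ y, (grN hP W (utPar hP A') ρ').1 y = c * (grN hP W (utPar hP A) ρ).1 y := by
    intro W
    have h3 := congrFun h1 W
    rw [phi_smul_pt, phi_smul_pt] at h3
    exact NormClass.mk_eq_mk.1 h3
  choose c hc hcN using hc
  have hadj : ∀ W : P.Inner, W.1 ∉ Q.carrier → c (P.lower W) = c (P.upper W) := by
    intro W hW
    have h3 := congrFun h2 W
    rw [phi'_smul_pt hP hQ b ρ _ W hW, phi'_smul_pt hP hQ b ρ' _ W hW, funext (hcN (P.lower W)),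
      funext (hcN (P.upper W)),
      hAbs_const_mul (finrank_gr_ne_zero P _) _ (grN hP _ _ ρ).2 (hc _),
      hAbs_const_mul (finrank_gr_ne_zero P _) _ (grN hP _ _ ρ).2 (hc _), mul_div_mul_comm] at h3
    have h4 : 0 < hAbs (b (P.lower W)) (grN hP (P.lower W) (utPar hP A) ρ).1 /
        hAbs (b (P.upper W)) (grN hP (P.upper W) (utPar hP A) ρ).1 :=
      div_pos (hAbs_pos _ (grN hP _ _ ρ).2) (hAbs_pos _ (grN hP _ _ ρ).2)
    have h5 := (mul_eq_right₀ h4.ne').1 h3.symm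
    exact (div_eq_one_iff_eq (hc _).ne').1 h5
  have hblock : ∀ (W : P.Steps) (z : Fin (Module.finrank F V) → E),
      wnorm E (resPos e P W ρ').1 ((resUT e P W A').1.mulVec fun i => z i.1) =
        c W * wnorm E (resPos e P W ρ).1 ((resUT e P W A).1.mulVec fun i => z i.1) := by
    intro W z
    have h3 := hcN W ((grB E hP W).equivFun.symm fun i => z i.1)
    rw [grN_utPar, grN_utPar, utNorm_apply, utNorm_apply, ← Module.Basis.equivFun_apply,
      LinearEquiv.apply_symm_apply] at h3
    exact h3
  obtain ⟨u, hu, hL⟩ := exists_uniRad_block hP A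
  obtain ⟨u', hu', hL'⟩ := exists_uniRad_block hP A'
  refine ⟨u'⁻¹ * u, mul_mem (inv_mem hu') hu, ?_⟩
  rw [mul_smul, inv_smul_eq_iff, ← mul_smul, ← mul_smul, ← hL, ← hL']
  exact smul_pt_eq_of_block hP hQ c hc hadj hblock

theorem exists_uniRad_of_eq (b : GrBases E P) {x x' : XBarP E P}
    (h1 : phi E P x = phi E P x') (h2 : phi' E P b x = phi' E P b x') :
    ∃ u ∈ UniRad E P, u • x = x' := by
  obtain ⟨e, hP⟩ := exists_adapted P
  have hflag : x.1.flag = x'.1.flag := by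
    refine ParFlag.eq_of_inner x.2 x'.2 fun W => ?_
    rw [← phi'_eq_zero_iff b x W, h2, phi'_eq_zero_iff b x' W]
  obtain ⟨Q, hQ, A, A', ρ, ρ', rfl, rfl⟩ := exists_common_frames hP x x' hflag
  exact exists_uniRad_smul_pt hP hQ b A A' ρ ρ' h1 h2

theorem phi_uniRad_smul {u : Par E P} (hu : u ∈ UniRad E P) (x : XBarP E P) :
    phi E P (u • x) = phi E P x := by
  funext W
  rw [phi_smul, (mem_uniRad_iff u).1 hu W, one_smul]

theorem phi'_uniRad_smul (b : GrBases E P) {u : Par E P} (hu : u ∈ UniRad E P) (x : XBarP E P) :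
    phi' E P b (u • x) = phi' E P b x := by
  funext W
  rw [phi'_smul, tFactor_eq, (mem_uniRad_iff u).1 hu, (mem_uniRad_iff u).1 hu]
  have h1 : ∀ H : Type _, ∀ [AddCommGroup H] [Module E H],
      LinearMap.det ((1 : H ≃ₗ[E] H) : H →ₗ[E] H) = 1 := fun H _ _ => LinearMap.det_id
  rw [h1, h1, LocField.nabs_one, NNReal.one_rpow, NNReal.one_rpow, div_one, one_mul]

end Orbits

section Weights

open scoped Classical

variable {F V : Type*} [Field F] [AddCommGroup V] [Module F V] [FiniteDimensional F V]
  {e : Module.Basis (Fin (Module.finrank F V)) F V} {P Q : ParFlag F V}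
  {E : Type*} [NormedField E] [LocField E] [Algebra F E]

/-! ### Absolute values of standard norms -/

/-- The homogeneous absolute value of a standard norm on a graded piece. -/
def wgt (hP : Adapted e P) (b : GrBases E P) (W : P.Steps)
    (ρ : Pos (Fin (Module.finrank F V))) : ℝ≥0 :=
  hAbs (b W) (stdN E hP W ρ).1

theorem wgt_pos (hP : Adapted e P) (b : GrBases E P) (W : P.Steps)
    (ρ : Pos (Fin (Module.finrank F V))) : 0 < wgt hP b W ρ := hAbs_pos _ (stdN E hP W ρ).2

/-- The constant is the inverse absolute value of the determinant between the chosen basis and the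
adapted one. It also serves for unitriangular translates, since these have determinant one. -/
theorem exists_hAbs_utNorm (hP : Adapted e P) (b : GrBases E P) (W : P.Steps) :
    ∃ κ : ℝ≥0, (∀ ρ, wgt hP b W ρ =
        (κ * ∏ j : Blk e P W, ρ.1 j.1) ^ (1 / (Module.finrank E (Gr E P W) : ℝ))) ∧
      ∀ y, hAbs (b W) (utNorm (grB E hP W) y).1 =
        (κ * ∏ j : Blk e P W, y.2.1 j) ^ (1 / (Module.finrank E (Gr E P W) : ℝ)) := by
  let σ : Blk e P W ≃ Fin (Module.finrank E (Gr E P W)) :=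
    Fintype.equivFinOfCardEq (Module.finrank_eq_card_basis (grB E hP W)).symm
  refine ⟨(nabs E ((b W).det ((grB E hP W).reindex σ)))⁻¹, fun ρ => ?_, fun y => ?_⟩
  · rw [wgt, hAbs, stdN, absVal_basisNorm (b W) (grB E hP W) σ fun j => ρ.2 j.1]
  · rw [hAbs, absVal_utNorm (b W) (grB E hP W) σ]

theorem continuous_wgt (hP : Adapted e P) (b : GrBases E P) (W : P.Steps) :
    Continuous (wgt hP b W) := by
  obtain ⟨κ, h, -⟩ := exists_hAbs_utNorm hP b W
  rw [funext h]
  refine (NNReal.continuous_rpow_const (by positivity)).comp (continuous_const.mul ?_)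
  exact continuous_finsetProd _ fun j _ => (continuous_apply j.1).comp continuous_subtype_val

theorem hAbs_grN (hP : Adapted e P) (b : GrBases E P) (W : P.Steps) (g : Par E P)
    (ρ : Pos (Fin (Module.finrank F V))) :
    hAbs (b W) (grN hP W g ρ).1 =
      (nabs E (LinearMap.det (grHom E P W g : Gr E P W →ₗ[E] Gr E P W)) ^
        (1 / (Module.finrank E (Gr E P W) : ℝ)))⁻¹ * wgt hP b W ρ :=
  hAbs_comp_symm (b W) (stdN E hP W ρ).2 _

theorem hAbs_grN_utPar (hP : Adapted e P) (b : GrBases E P) (W : P.Steps)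
    (A : UT E (Fin (Module.finrank F V))) (ρ : Pos (Fin (Module.finrank F V))) :
    hAbs (b W) (grN hP W (utPar hP A) ρ).1 = wgt hP b W ρ := by
  obtain ⟨κ, h, h'⟩ := exists_hAbs_utNorm hP b W
  rw [grN_utPar, h, h']
  rfl

/-- No determinant is computed: a unitriangular translate does not change `hAbs` of a standard norm,
whereas by the general rule it multiplies `hAbs` by the inverse of a power of the absolute value of
the determinant. So that power is 1. -/
theorem tFactor_utPar (hP : Adapted e P) (A : UT E (Fin (Module.finrank F V))) (W : P.Inner) :
    tFactor E P (utPar hP A) W = 1 := by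
  have key : ∀ W : P.Steps,
      nabs E (LinearMap.det (grHom E P W (utPar hP A) : Gr E P W →ₗ[E] Gr E P W)) ^
        (1 / (Module.finrank E (Gr E P W) : ℝ)) = 1 := by
    intro W
    let b : GrBases E P := fun W => Module.finBasis E _
    have h := hAbs_grN hP b W (utPar hP A) ⟨fun _ => 1, fun _ => one_pos⟩
    rw [hAbs_grN_utPar] at h
    have h1 := (mul_eq_right₀ (wgt_pos hP b W _).ne').1 h.symm
    rwa [inv_eq_one] at h1
  rw [tFactor_eq, key, key, div_one]

/-- The quotient of the absolute values of the standard norms on neighboring graded pieces. -/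
def wgtRatio (hP : Adapted e P) (b : GrBases E P) (W : P.Inner)
    (ρ : Pos (Fin (Module.finrank F V))) : ℝ≥0 :=
  wgt hP b (P.lower W) ρ / wgt hP b (P.upper W) ρ

theorem phi'_smul_pt_eq (hP : Adapted e P) (h : Q.carrier ⊆ P.carrier) (b : GrBases E P)
    (ρ : Pos (Fin (Module.finrank F V))) (g : Par E P) (W : P.Inner) (hW : W.1 ∉ Q.carrier) :
    phi' E P b (g • pt hP h ρ) W = tFactor E P g W * wgtRatio hP b W ρ := by
  rw [phi'_smul_pt hP h b ρ g W hW, hAbs_grN, hAbs_grN, tFactor_eq, wgtRatio]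
  simp only [div_eq_mul_inv, mul_inv, inv_inv]
  ring

theorem stdN_of_proportional (hP : Adapted e P) (W : P.Steps)
    {ρ ρ' : Pos (Fin (Module.finrank F V))} {c : ℝ≥0}
    (h : ∀ j : Blk e P W, ρ'.1 j.1 = c * ρ.1 j.1) :
    (stdN E hP W ρ').1 = fun x => c * (stdN E hP W ρ).1 x := by
  rw [stdN, stdN, ← basisNorm_const_mul, ← funext h]

theorem wgt_of_proportional (hP : Adapted e P) (b : GrBases E P) (W : P.Steps)
    {ρ ρ' : Pos (Fin (Module.finrank F V))} {c : ℝ≥0} (hc : 0 < c)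
    (h : ∀ j : Blk e P W, ρ'.1 j.1 = c * ρ.1 j.1) : wgt hP b W ρ' = c * wgt hP b W ρ := by
  rw [wgt, stdN_of_proportional hP W h,
    hAbs_const_mul (finrank_gr_ne_zero P W) _ (stdN E hP W ρ).2 hc, wgt]

theorem mk_grN_of_proportional (hP : Adapted e P) (W : P.Steps) (g : Par E P)
    {ρ ρ' : Pos (Fin (Module.finrank F V))} {c : ℝ≥0} (hc : 0 < c)
    (h : ∀ j : Blk e P W, ρ'.1 j.1 = c * ρ.1 j.1) :
    NormClass.mk (grN hP W g ρ') = NormClass.mk (grN hP W g ρ) := by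
  refine (NormClass.mk_eq_mk.2 ⟨c, hc, fun x => ?_⟩).symm
  exact congrFun (stdN_of_proportional hP W h) _

/-! ### Weights in terms of the coordinates of the Borel–Serre charts -/

/-- The tuple of weights `r_j = ∏_{k < j} s_k⁻¹`. -/
def rho {n : ℕ} (s : Pos (Fin (n - 1))) : Pos (Fin n) :=
  ⟨fun j => ∏ k ∈ Finset.univ.filter fun k : Fin (n - 1) => k.1 < j.1, (s.1 k)⁻¹,
    fun _ => Finset.prod_pos fun k _ => inv_pos.2 (s.2 k)⟩

theorem continuous_rho {n : ℕ} : Continuous (rho : Pos (Fin (n - 1)) → Pos (Fin n)) := by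
  refine Continuous.subtype_mk (continuous_pi fun j => ?_) _
  exact continuous_finsetProd _ fun k _ =>
    ((continuous_apply k).comp continuous_subtype_val).inv₀ fun s => (s.2 k).ne'

theorem rho_eq_mul {n : ℕ} (s : Pos (Fin (n - 1))) {i j : Fin n} (h : i ≤ j) :
    (rho s).1 j = (rho s).1 i *
      ∏ k ∈ Finset.univ.filter fun k : Fin (n - 1) => i.1 ≤ k.1 ∧ k.1 < j.1, (s.1 k)⁻¹ := by
  have hij : i.1 ≤ j.1 := h
  unfold rho
  dsimp only
  rw [← Finset.prod_union]
  · congr 1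
    ext k
    simp only [Finset.mem_filter, Finset.mem_univ, true_and, Finset.mem_union]
    omega
  · rw [Finset.disjoint_filter]
    intro k _ h1 h2
    omega

theorem rho_succ {n : ℕ} (s : Pos (Fin (n - 1))) {i j : Fin n} (k : Fin (n - 1)) (hi : i.1 = k.1)
    (hj : j.1 = k.1 + 1) : (rho s).1 j * s.1 k = (rho s).1 i := by
  rw [rho_eq_mul s (i := i) (j := j) (by rw [Fin.le_def]; omega)]
  have : (Finset.univ.filter fun k : Fin (n - 1) => i.1 ≤ k.1 ∧ k.1 < j.1) = {k} := by
    ext l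
    simp only [Finset.mem_filter, Finset.mem_univ, true_and, Finset.mem_singleton, Fin.ext_iff]
    omega
  rw [this, Finset.prod_singleton, mul_assoc, inv_mul_cancel₀ (s.2 k).ne', mul_one]

/-- The quotient of the weights at `i` and `j` involves only the coordinates `k` with `i ≤ k < j`.
None of these belongs to the flag: such a member would contain `e i` but not `e j`, although both
lie in one graded piece. -/
theorem rho_mul_rho_of_le {s s' : Pos (Fin (Module.finrank F V - 1))}
    (h : ∀ k, stdSub e (k.1 + 1) ∉ P.carrier → s'.1 k = s.1 k) {i j : Fin (Module.finrank F V)}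
    (hb : blk e P i = blk e P j) (hij : i ≤ j) :
    (rho s').1 j * (rho s).1 i = (rho s').1 i * (rho s).1 j := by
  rw [rho_eq_mul s' hij, rho_eq_mul s hij]
  have : ∀ k ∈ Finset.univ.filter fun k : Fin (Module.finrank F V - 1) => i.1 ≤ k.1 ∧ k.1 < j.1,
      (s'.1 k)⁻¹ = (s.1 k)⁻¹ := by
    intro k hk
    rw [Finset.mem_filter] at hk
    rw [h k]
    intro hmem
    have h1 : e i ∈ stdSub e (k.1 + 1) := by
      rw [mem_stdSub]
      omega
    have h2 : e j ∉ stdSub e (k.1 + 1) := by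
      rw [mem_stdSub]
      omega
    have h3 := P.cover_le (span_singleton_ne_bot e i) hmem
      ((Submodule.span_singleton_le_iff_mem _ _).2 h1)
    change (blk e P i).1 ≤ _ at h3
    rw [hb] at h3
    exact h2 (h3 (blk_mem j).1)
  rw [Finset.prod_congr rfl this]
  ring

theorem rho_mul_rho {s s' : Pos (Fin (Module.finrank F V - 1))}
    (h : ∀ k, stdSub e (k.1 + 1) ∉ P.carrier → s'.1 k = s.1 k) {i j : Fin (Module.finrank F V)}
    (hb : blk e P i = blk e P j) :
    (rho s').1 j * (rho s).1 i = (rho s').1 i * (rho s).1 j := by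
  rcases le_total i j with hij | hij
  · exact rho_mul_rho_of_le h hb hij
  · exact (rho_mul_rho_of_le h hb.symm hij).symm

/-- Weights whose coordinates agree apart from those belonging to the flag are proportional on the
graded pieces. -/
theorem exists_rho_proportional (hP : Adapted e P) {s s' : Pos (Fin (Module.finrank F V - 1))}
    (h : ∀ k, stdSub e (k.1 + 1) ∉ P.carrier → s'.1 k = s.1 k) (W : P.Steps) :
    ∃ c : ℝ≥0, 0 < c ∧ ∀ j : Blk e P W, (rho s').1 j.1 = c * (rho s).1 j.1 := by
  obtain ⟨i, hi⟩ := hP.exists_mem_blk W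
  refine ⟨(rho s').1 i / (rho s).1 i, div_pos ((rho s').2 i) ((rho s).2 i), fun j => ?_⟩
  rw [div_mul_eq_mul_div, eq_div_iff ((rho s).2 i).ne']
  exact rho_mul_rho h (hi.trans (blk_eq_iff.2 j.2).symm)

theorem mk_grN_rho (hP : Adapted e P) (W : P.Steps) (g : Par E P)
    {s s' : Pos (Fin (Module.finrank F V - 1))}
    (h : ∀ k, stdSub e (k.1 + 1) ∉ P.carrier → s'.1 k = s.1 k) :
    NormClass.mk (grN hP W g (rho s')) = NormClass.mk (grN hP W g (rho s)) := by
  obtain ⟨c, hc, h'⟩ := exists_rho_proportional hP h W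
  exact mk_grN_of_proportional hP W g hc h'

/-- On the pieces below and above `W`, passing from `s` to `s'` scales the weights by constants `c`
and `c'`. Comparing the last index `k` of the lower piece with the first index `k + 1` of the upper
one shows that `c / c'` is the coordinate `s' k`, because `s k = 1`. -/
theorem wgtRatio_rho (hP : Adapted e P) (b : GrBases E P) (W : P.Inner)
    {k : Fin (Module.finrank F V - 1)} (hk : W.1 = stdSub e (k.1 + 1))
    {s s' : Pos (Fin (Module.finrank F V - 1))}
    (h : ∀ k, stdSub e (k.1 + 1) ∉ P.carrier → s'.1 k = s.1 k) (hs : s.1 k = 1) :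
    wgtRatio hP b W (rho s') = s'.1 k * wgtRatio hP b W (rho s) := by
  have hk2 := k.2
  let i : Fin (Module.finrank F V) := ⟨k.1, by omega⟩
  let j : Fin (Module.finrank F V) := ⟨k.1 + 1, by omega⟩
  have hi : e i ∈ (P.lower W).1 ∧ e i ∉ P.pred (P.lower W).1 := by
    constructor
    · change e i ∈ W.1
      rw [hk, mem_stdSub]
      exact Nat.lt_succ_self _
    · intro hmem
      refine (P.pred_lt (P.lower W)).not_ge ?_
      change W.1 ≤ _
      rw [hk, stdSub, Submodule.span_le]
      rintro _ ⟨l, hl, rfl⟩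
      refine hP.mem_of_le (P.pred_mem (P.lower W)) (j := i) ?_ hmem
      exact Nat.lt_succ_iff.1 hl
  have hj : e j ∈ (P.upper W).1 ∧ e j ∉ P.pred (P.upper W).1 := by
    have h1 : e j ∉ W.1 := by
      rw [hk, mem_stdSub]
      exact lt_irrefl _
    rw [P.pred_upper]
    refine ⟨?_, h1⟩
    by_contra hmem
    refine (P.lt_upper W).not_ge ?_
    rw [hP.eq_span (P.upper W).2.1, Submodule.span_le]
    rintro _ ⟨l, hl, rfl⟩
    change e l ∈ W.1
    rw [hk, mem_stdSub]
    by_contra hlj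
    exact hmem (hP.mem_of_le (P.upper W).2.1 (i := j) (Nat.not_lt.1 hlj) hl)
  obtain ⟨c, hc, h1⟩ := exists_rho_proportional hP h (P.lower W)
  obtain ⟨c', hc', h2⟩ := exists_rho_proportional hP h (P.upper W)
  have h3 := h1 ⟨i, hi⟩
  have h4 := h2 ⟨j, hj⟩
  have h5 := rho_succ s' (i := i) (j := j) k rfl rfl
  have h6 := rho_succ s (i := i) (j := j) k rfl rfl
  rw [hs, mul_one] at h6
  have h7 : c = s'.1 k * c' := by
    apply mul_right_cancel₀ ((rho s).2 i).ne'
    rw [← h3, ← h5, h4, ← h6]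
    ring
  rw [wgtRatio, wgtRatio, wgt_of_proportional hP b _ hc h1, wgt_of_proportional hP b _ hc' h2, h7,
    mul_assoc, mul_div_assoc, mul_div_mul_left _ _ hc'.ne']

/-! ### The points `(P_t, μ_t)` -/

variable (P) in
/-- The coordinates that do not belong to the flag, the other ones being replaced by `1`. -/
def offFlag (t : RSp e P) : Pos (Fin (Module.finrank F V - 1)) :=
  ⟨fun k => if stdSub e (k.1 + 1) ∈ P.carrier then 1 else t.1 k, fun k => by
    beta_reduce
    split_ifs with h
    · exact one_pos
    · exact pos_of_ne_zero fun h0 => h (t.2 k h0)⟩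

theorem offFlag_of_mem (t : RSp e P) {k : Fin (Module.finrank F V - 1)}
    (h : stdSub e (k.1 + 1) ∈ P.carrier) : (offFlag P t).1 k = 1 := if_pos h

theorem offFlag_of_notMem (t : RSp e P) {k : Fin (Module.finrank F V - 1)}
    (h : stdSub e (k.1 + 1) ∉ P.carrier) : (offFlag P t).1 k = t.1 k := if_neg h

/-- The element `t` of the chart of the parabolic subgroup that it defines. -/
def selfRSp (e : Module.Basis (Fin (Module.finrank F V)) F V)
    (t : Fin (Module.finrank F V - 1) → ℝ≥0) : RSp e (flagOf e t) :=
  ⟨t, fun k hk => Or.inr (Or.inr ⟨k, hk, rfl⟩)⟩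

theorem adapted_flagOf (e : Module.Basis (Fin (Module.finrank F V)) F V)
    (t : Fin (Module.finrank F V - 1) → ℝ≥0) : Adapted e (flagOf e t) := by
  rintro U (rfl | rfl | ⟨k, -, rfl⟩)
  · exact ⟨0, (stdSub_zero e).symm⟩
  · exact ⟨_, (stdSub_finrank e).symm⟩
  · exact ⟨_, rfl⟩

theorem stdSub_injective (e : Module.Basis (Fin (Module.finrank F V)) F V)
    {k l : Fin (Module.finrank F V - 1)} (h : stdSub e (k.1 + 1) = stdSub e (l.1 + 1)) : k = l := by
  have hk := k.2
  have hl := l.2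
  have key : ∀ i : Fin (Module.finrank F V), i.1 < k.1 + 1 ↔ i.1 < l.1 + 1 := fun i => by
    rw [← mem_stdSub e, h, mem_stdSub]
  have h1 := key ⟨k.1, by omega⟩
  have h2 := key ⟨l.1, by omega⟩
  apply Fin.ext
  simp only at h1 h2
  omega

theorem stdSub_ne_bot (e : Module.Basis (Fin (Module.finrank F V)) F V)
    (k : Fin (Module.finrank F V - 1)) : stdSub e (k.1 + 1) ≠ ⊥ := by
  have hk := k.2
  intro h
  have h1 : e ⟨k.1, by omega⟩ ∈ stdSub e (k.1 + 1) := by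
    rw [mem_stdSub]
    exact Nat.lt_succ_self _
  rw [h, Submodule.mem_bot] at h1
  exact e.ne_zero _ h1

theorem stdSub_ne_top (e : Module.Basis (Fin (Module.finrank F V)) F V)
    (k : Fin (Module.finrank F V - 1)) : stdSub e (k.1 + 1) ≠ ⊤ := by
  have hk := k.2
  intro h
  have h1 : e ⟨k.1 + 1, by omega⟩ ∈ stdSub e (k.1 + 1) := by
    rw [h]
    exact Submodule.mem_top
  rw [mem_stdSub] at h1
  exact lt_irrefl _ h1

theorem stdSub_mem_flagOf {t : Fin (Module.finrank F V - 1) → ℝ≥0}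
    {k : Fin (Module.finrank F V - 1)} :
    stdSub e (k.1 + 1) ∈ (flagOf e t).carrier ↔ t k = 0 := by
  refine ⟨?_, fun h => Or.inr (Or.inr ⟨k, h, rfl⟩)⟩
  rintro (h | h | ⟨l, hl, h⟩)
  · exact absurd h (stdSub_ne_bot e k)
  · exact absurd h (stdSub_ne_top e k)
  · rwa [stdSub_injective e h]

theorem Adapted.exists_index (hP : Adapted e P) (W : P.Inner) :
    ∃ k : Fin (Module.finrank F V - 1), W.1 = stdSub e (k.1 + 1) := by
  obtain ⟨l, hl⟩ := hP _ W.2.1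
  have h1 : l ≠ 0 := by
    rintro rfl
    exact W.2.2.1 (hl.trans (stdSub_zero e))
  have h2 : l < Module.finrank F V := by
    by_contra! h
    refine W.2.2.2 (top_le_iff.1 ?_)
    rw [hl, ← stdSub_finrank e]
    exact stdSub_mono e h
  exact ⟨⟨l - 1, by omega⟩, by rw [hl]; congr 1; change l = l - 1 + 1; omega⟩

/-- The products defining `weight` begin anew on each graded piece, those defining `rho` begin at
the first basis vector. On a piece they differ by the constant product over `T`. The vanishing
coordinates, replaced by 1 in `offFlag`, never enter `weight`. -/
theorem smul_stdPoint_eq (hP : Adapted e P) (t : RSp e P) :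
    (⟨stdPoint E e t.1, flagOf_subset e P t⟩ : XBarP E P) =
      pt hP (flagOf_subset e P t) (rho (offFlag _ (selfRSp e t.1))) := by
  apply Subtype.ext
  change XBar.mk (flagOf e t.1) _ = XBar.mk (flagOf e t.1) _
  congr 1
  funext W
  rw [NormClass.mk_eq_mk]
  let T : Finset (Fin (Module.finrank F V - 1)) :=
    Finset.univ.filter fun k => stdSub e (k.1 + 1) ≤ (flagOf e t.1).pred W.1
  refine ⟨∏ k ∈ T, ((offFlag _ (selfRSp e t.1)).1 k)⁻¹,
    Finset.prod_pos fun k _ => inv_pos.2 ((offFlag _ (selfRSp e t.1)).2 k), fun x => ?_⟩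
  have key : ∀ j : Blk e (flagOf e t.1) W, (rho (offFlag _ (selfRSp e t.1))).1 j.1 =
      (∏ k ∈ T, ((offFlag _ (selfRSp e t.1)).1 k)⁻¹) * weight e t.1 W j := by
    intro j
    have hw : weight e t.1 W j = ∏ k ∈ Finset.univ.filter fun k : Fin (Module.finrank F V - 1) =>
        ¬ stdSub e (k.1 + 1) ≤ (flagOf e t.1).pred W.1 ∧ k.1 < j.1.1,
        ((offFlag _ (selfRSp e t.1)).1 k)⁻¹ := by
      refine Finset.prod_congr rfl fun k hk => ?_
      obtain ⟨-, h1, h2⟩ := Finset.mem_filter.1 hk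
      have h3 := weight_factor_pos e t.1 W j k h1 h2
      rw [inv_pos] at h3
      have h4 : stdSub e (k.1 + 1) ∉ (flagOf e t.1).carrier := by
        rw [stdSub_mem_flagOf]
        exact h3.ne'
      rw [offFlag_of_notMem _ h4]
      rfl
    rw [hw, ← Finset.prod_union]
    · unfold rho
      dsimp only
      congr 1
      ext k
      simp only [T, Finset.mem_union, Finset.mem_filter, Finset.mem_univ, true_and]
      have h5 : stdSub e (k.1 + 1) ≤ (flagOf e t.1).pred W.1 → k.1 < j.1.1 := by
        intro hle
        by_contra! h6
        apply j.2.2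
        apply hle
        rw [mem_stdSub]
        omega
      tauto
    · rw [Finset.disjoint_filter]
      intro k _ h1 h2
      exact h2.1 h1
  change basisNorm (grB E _ W) (fun j => _) x = _ * basisNorm (grBasis E e t.1 W) _ x
  rw [funext key, basisNorm_const_mul]
  rfl

theorem phi_piBar (hP : Adapted e P) (g : Par E P) (t : RSp e P) (W : P.Steps) :
    phi E P (g • (⟨stdPoint E e t.1, flagOf_subset e P t⟩ : XBarP E P)) W =
      NormClass.mk (grN hP W g (rho (offFlag P t))) := by
  rw [smul_stdPoint_eq hP, phi_smul_pt]
  refine mk_grN_rho hP W g fun k hk => ?_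
  rw [offFlag_of_notMem _ hk, offFlag_of_notMem _ fun h => hk (flagOf_subset e P t h)]
  rfl

/-- In a Borel–Serre chart, φ' is proportional to the chart coordinate attached to `W`. The factor
is positive and independent of all coordinates belonging to the flag, so the formula holds also
where they vanish. -/
theorem phi'_piBar (hP : Adapted e P) (b : GrBases E P) (g : Par E P) (t : RSp e P) (W : P.Inner)
    {k : Fin (Module.finrank F V - 1)} (hk : W.1 = stdSub e (k.1 + 1)) :
    phi' E P b (g • (⟨stdPoint E e t.1, flagOf_subset e P t⟩ : XBarP E P)) W =
      tFactor E P g W * (t.1 k * wgtRatio hP b W (rho (offFlag P t))) := by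
  by_cases hW : W.1 ∈ (flagOf e t.1).carrier
  · rw [phi'_of_mem _ _ _ hW]
    rw [hk, stdSub_mem_flagOf] at hW
    rw [hW, zero_mul, mul_zero]
  · have hW' := hW
    rw [hk] at hW'
    rw [smul_stdPoint_eq hP, phi'_smul_pt_eq hP _ b _ g W hW,
      wgtRatio_rho hP b W hk (s := offFlag P t) (fun k hk => ?_)
        (offFlag_of_mem _ (hk ▸ W.2.1)), offFlag_of_notMem _ hW']
    · rfl
    · rw [offFlag_of_notMem _ hk, offFlag_of_notMem _ fun h => hk (flagOf_subset e P t h)]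
      rfl

end Weights

section Topologies

open scoped Classical

/-! ### Quotient maps -/

/-- A composite of a proper surjection and an open quotient map is a quotient map, and remains one
after products with any space. -/
theorem isQuotientMap_prodMap_id {X Y Z : Type*} [TopologicalSpace X] [TopologicalSpace Y]
    [TopologicalSpace Z] {p : X → Y} {q : Y → Z} (hq : IsOpenQuotientMap q) (hp : IsProperMap p)
    (hs : Function.Surjective p) (T : Type*) [TopologicalSpace T] :
    Topology.IsQuotientMap (Prod.map (q ∘ p) (id : T → T)) := by
  have h1 : Topology.IsQuotientMap (Prod.map p (id : T → T)) :=
    (hp.universally_closed T).isQuotientMap (hp.continuous.prodMap continuous_id)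
      (hs.prodMap Function.surjective_id)
  have h2 : Topology.IsQuotientMap (Prod.map q (id : T → T)) :=
    (hq.prodMap IsOpenQuotientMap.id).isQuotientMap
  exact h2.comp h1

theorem isQuotientMap_comp {X Y Z : Type*} [TopologicalSpace X] [TopologicalSpace Y]
    [TopologicalSpace Z] {p : X → Y} {q : Y → Z} (hq : IsOpenQuotientMap q) (hp : IsProperMap p)
    (hs : Function.Surjective p) : Topology.IsQuotientMap (q ∘ p) :=
  hq.isQuotientMap.comp (hp.isClosedMap.isQuotientMap hp.continuous hs)

variable {F V : Type*} [Field F] [AddCommGroup V] [Module F V] [FiniteDimensional F V]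
  {e : Module.Basis (Fin (Module.finrank F V)) F V} {P Q R : ParFlag F V}
  {E : Type*} [NormedField E] [LocField E] [Algebra F E]

variable (E e P) in
/-- Parameters for norms on all graded pieces of a flag. -/
abbrev Frm := ∀ W : P.Steps, UT E (Blk e P W) × Pos (Blk e P W)

/-- The unitriangular matrix attached to a parameter. -/
def frmUT (y : Frm e P E) : UT E (Fin (Module.finrank F V)) := glueUT fun W => (y W).1

/-- The tuple of weights attached to a parameter. -/
def frmPos (y : Frm e P E) : Pos (Fin (Module.finrank F V)) := gluePos fun W => (y W).2

/-- The classes of norms attached to a parameter. -/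
def zeta (hP : Adapted e P) (y : Frm e P E) : ZSp E P :=
  fun W => NormClass.mk (utNorm (grB E hP W) (y W))

theorem zeta_eq (hP : Adapted e P) (y : Frm e P E) (W : P.Steps) :
    zeta hP y W = NormClass.mk (grN hP W (utPar hP (frmUT y)) (frmPos y)) := by
  rw [grN_utPar, frmUT, frmPos, resUT_glueUT, resPos_gluePos]
  rfl

theorem continuous_frmUT : Continuous (frmUT : Frm e P E → UT E (Fin (Module.finrank F V))) := by
  refine Continuous.subtype_mk (continuous_matrix fun i j => ?_) _
  change Continuous fun y : Frm e P E => dite _ _ _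
  by_cases h : e j ∈ (blk e P i).1 ∧ e j ∉ P.pred (blk e P i).1
  · simp only [dif_pos h]
    exact (continuous_subtype_val.comp (continuous_fst.comp (continuous_apply _))).matrix_elem _ _
  · simp only [dif_neg h]
    exact continuous_const

theorem continuous_frmPos :
    Continuous (frmPos : Frm e P E → Pos (Fin (Module.finrank F V))) := by
  refine Continuous.subtype_mk (continuous_pi fun i => ?_) _
  change Continuous fun y : Frm e P E => (y (blk e P i)).2.1 ⟨i, blk_mem i⟩
  exact (continuous_apply _).comp
    (continuous_subtype_val.comp (continuous_snd.comp (continuous_apply _)))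

/-- Proper maps and open quotient maps are both stable under arbitrary products, so the statement
for one graded piece passes to the product of all of them. -/
theorem isQuotientMap_zeta (hP : Adapted e P) :
    Topology.IsQuotientMap (zeta hP : Frm e P E → ZSp E P) :=
  isQuotientMap_comp (IsOpenQuotientMap.piMap fun _ : P.Steps => isOpenQuotientMap_mk)
    (IsProperMap.pi_map fun W : P.Steps => isProperMap_utNorm (grB E hP W))
    (Function.Surjective.piMap fun W => utNorm_surjective (grB E hP W))

/-- The extra factor will be Y_0 with either of its topologies. Properness is what allows it to be
carried along. -/
theorem isQuotientMap_zetaS {S : Type*} (E : S → Type*) [∀ v, NormedField (E v)]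
    [∀ v, LocField (E v)] [∀ v, Algebra F (E v)] (hP : Adapted e P) (T : Type*)
    [TopologicalSpace T] :
    Topology.IsQuotientMap (Prod.map (fun (y : ∀ v, Frm e P (E v)) v => zeta hP (y v))
      (id : T → T)) :=
  isQuotientMap_prodMap_id
    (IsOpenQuotientMap.piMap fun _ : S =>
      IsOpenQuotientMap.piMap fun _ : P.Steps => isOpenQuotientMap_mk)
    (IsProperMap.pi_map fun v : S =>
      IsProperMap.pi_map fun W : P.Steps => isProperMap_utNorm (grB (E v) hP W))
    (Function.Surjective.piMap fun v =>
      Function.Surjective.piMap fun W => utNorm_surjective (grB (E v) hP W)) T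

theorem continuous_hAbs {H : Type*} [AddCommGroup H] [Module E H] [FiniteDimensional E H]
    (b : Module.Basis (Fin (Module.finrank E H)) E H) :
    Continuous fun μ : NormOn E H => hAbs b μ.1 := by
  have hq : Topology.IsQuotientMap (utNorm b) :=
    (isProperMap_utNorm b).isClosedMap.isQuotientMap (continuous_utNorm b) (utNorm_surjective b)
  rw [hq.continuous_iff]
  have h : ((fun μ : NormOn E H => hAbs b μ.1) ∘ utNorm b) = fun y =>
      ((nabs E (b.det (b.reindex (Equiv.refl _))))⁻¹ * ∏ i, y.2.1 i) ^
        (1 / (Module.finrank E H : ℝ)) := by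
    funext y
    change hAbs b (utNorm b y).1 = _
    rw [hAbs, absVal_utNorm b b (Equiv.refl _)]
  rw [h]
  refine (NNReal.continuous_rpow_const (by positivity)).comp (continuous_const.mul ?_)
  exact continuous_finsetProd _ fun j _ =>
    (continuous_apply j).comp (continuous_subtype_val.comp continuous_snd)

/-! ### Passage to a smaller flag -/

/-- The point with flag `R` and given classes of norms, as an element of `X̄_{F,v}(P)`. -/
def ptOf (h : R.carrier ⊆ P.carrier) (z : ZSp E R) : XBarP E P := ⟨⟨R, z⟩, h⟩

theorem ptOf_mk_grN (hP : Adapted e P) (h : R.carrier ⊆ P.carrier) (g : Par E P)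
    (ρ : Pos (Fin (Module.finrank F V))) :
    ptOf h (fun U => NormClass.mk (grN (hP.mono h) U (Subgroup.inclusion (Par_mono E h) g) ρ)) =
      g • pt hP h ρ := rfl

theorem ptOf_zeta (hP : Adapted e P) (h : R.carrier ⊆ P.carrier) (y : Frm e R E) :
    ptOf h (zeta (hP.mono h) y) = utPar hP (frmUT y) • pt hP h (frmPos y) := by
  rw [← ptOf_mk_grN, funext (zeta_eq (hP.mono h) y)]
  rfl

theorem phi_incl (hP : Adapted e P) (h : R.carrier ⊆ P.carrier) (hQ : Q.carrier ⊆ P.carrier)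
    (hQR : Q.carrier ⊆ R.carrier) (g : Par E P) (ρ : Pos (Fin (Module.finrank F V))) :
    phi E R ⟨(g • (pt hP hQ ρ : XBarP E P)).1, hQR⟩ =
      fun U => NormClass.mk (grN (hP.mono h) U (Subgroup.inclusion (Par_mono E h) g) ρ) :=
  funext (phi_smul_pt (hP.mono h) hQR ρ (Subgroup.inclusion (Par_mono E h) g))

/-- Norms can be induced in stages. On points whose flag lies in `R`, the map φ for `P` thus factors
through φ for `R`. -/
theorem phi_eq_phi_ptOf (h : R.carrier ⊆ P.carrier) (x : XBarP E P)
    (hx : x.1.flag.carrier ⊆ R.carrier) : phi E P x = phi E P (ptOf h (phi E R ⟨x.1, hx⟩)) := by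
  obtain ⟨e, hP, Q, hQ, g, ρ, rfl⟩ := exists_frame_par x
  have hx' : Q.carrier ⊆ R.carrier := hx
  rw [phi_incl hP h hQ hx', ptOf_mk_grN]
  funext W
  rw [phi_smul_pt, phi_smul_pt]

/-- The absolute value of the norm induced on a graded piece, relative to the one of the inducing
norm. -/
def relAbs (h : R.carrier ⊆ P.carrier) (b : GrBases E P) (b' : GrBases E R) (W : P.Steps)
    (z : ZSp E R) : ℝ≥0 :=
  hAbs (b W) ((ptOf h z).1.induced E (R.cover W.1 W.2.2) P W) /
    hAbs (b' (R.cover W.1 W.2.2)) (z (R.cover W.1 W.2.2)).rep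

/-- Numerator and denominator scale alike with the chosen representative, so its constant cancels
and only weights remain. Positivity and continuity of `relAbs` are read off from this formula. -/
theorem relAbs_mk_grN (hP : Adapted e P) (h : R.carrier ⊆ P.carrier) (b : GrBases E P)
    (b' : GrBases E R) (W : P.Steps) (A : UT E (Fin (Module.finrank F V)))
    (ρ : Pos (Fin (Module.finrank F V))) :
    relAbs h b b' W (fun U => NormClass.mk
      (grN (hP.mono h) U (Subgroup.inclusion (Par_mono E h) (utPar hP A)) ρ)) =
      wgt hP b W ρ / wgt (hP.mono h) b' (R.cover W.1 W.2.2) ρ := by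
  obtain ⟨c, hc, h1, h2⟩ := induced_smul_pt hP h ρ (utPar hP A) (R.cover W.1 W.2.2)
  have h3 : hAbs (b W) ((utPar hP A • (pt hP h ρ : XBarP E P)).1.induced E
      (R.cover W.1 W.2.2) P W) = c * wgt hP b W ρ := by
    rw [h2 W rfl, hAbs_const_mul (finrank_gr_ne_zero P W) _ (grN hP W _ ρ).2 hc, hAbs_grN_utPar]
  have h4 : hAbs (b' (R.cover W.1 W.2.2))
      ((utPar hP A • (pt hP h ρ : XBarP E P)).1.cls (R.cover W.1 W.2.2)).rep =
        c * wgt (hP.mono h) b' (R.cover W.1 W.2.2) ρ := by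
    rw [h1, hAbs_const_mul (finrank_gr_ne_zero R _) _ (grN (hP.mono h) _ _ ρ).2 hc]
    congr 1
    exact hAbs_grN_utPar (hP.mono h) b' _ A ρ
  rw [← mul_div_mul_left _ _ hc.ne', ← h3, ← h4]
  rfl

theorem relAbs_pos (h : R.carrier ⊆ P.carrier) (b : GrBases E P) (b' : GrBases E R) (W : P.Steps)
    (z : ZSp E R) : 0 < relAbs h b b' W z := by
  obtain ⟨e, hP⟩ := exists_adapted P
  obtain ⟨y, rfl⟩ := (isQuotientMap_zeta (hP.mono h)).surjective z
  rw [funext (zeta_eq (hP.mono h) y)]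
  refine lt_of_lt_of_eq ?_ (relAbs_mk_grN hP h b b' W (frmUT y) (frmPos y)).symm
  exact div_pos (wgt_pos _ _ _ _) (wgt_pos _ _ _ _)

theorem continuous_relAbs (h : R.carrier ⊆ P.carrier) (b : GrBases E P) (b' : GrBases E R)
    (W : P.Steps) : Continuous (relAbs h b b' W) := by
  obtain ⟨e, hP⟩ := exists_adapted P
  rw [(isQuotientMap_zeta (E := E) (hP.mono h)).continuous_iff]
  have h1 : relAbs h b b' W ∘ zeta (hP.mono h) = fun y =>
      wgt hP b W (frmPos y) / wgt (hP.mono h) b' (R.cover W.1 W.2.2) (frmPos y) := by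
    funext y
    rw [← relAbs_mk_grN hP h b b' W (frmUT y) (frmPos y), Function.comp_apply,
      funext (zeta_eq (hP.mono h) y)]
    rfl
  rw [h1]
  exact ((continuous_wgt _ _ _).comp continuous_frmPos).div₀
    ((continuous_wgt _ _ _).comp continuous_frmPos) fun _ => (wgt_pos _ _ _ _).ne'

theorem continuous_resUT (W : P.Steps) :
    Continuous (resUT e P W : UT E (Fin (Module.finrank F V)) → _) :=
  Continuous.subtype_mk (continuous_subtype_val.matrix_submatrix _ _) _

theorem continuous_resPos (W : P.Steps) : Continuous (resPos e P W) :=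
  Continuous.subtype_mk (continuous_pi fun j =>
    (continuous_apply j.1).comp continuous_subtype_val) _

theorem continuous_phi_ptOf (h : R.carrier ⊆ P.carrier) :
    Continuous fun z : ZSp E R => phi E P (ptOf h z) := by
  obtain ⟨e, hP⟩ := exists_adapted P
  rw [(isQuotientMap_zeta (E := E) (hP.mono h)).continuous_iff]
  refine continuous_pi fun W => ?_
  have h1 : (fun y : Frm e R E => phi E P (ptOf h (zeta (hP.mono h) y)) W) = fun y =>
      NormClass.mk (utNorm (grB E hP W) (resUT e P W (frmUT y), resPos e P W (frmPos y))) := by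
    funext y
    rw [ptOf_zeta hP h y, phi_smul_pt, grN_utPar]
  change Continuous fun y : Frm e R E => phi E P (ptOf h (zeta (hP.mono h) y)) W
  rw [h1]
  refine isOpenQuotientMap_mk.continuous.comp ((continuous_utNorm _).comp ?_)
  exact ((continuous_resUT W).comp continuous_frmUT).prodMk
    ((continuous_resPos W).comp continuous_frmPos)

/-- The factor relating the coordinates `φ'` for a flag and a smaller one. -/
def relFac (h : R.carrier ⊆ P.carrier) (b : GrBases E P) (b' : GrBases E R) (W : P.Inner)
    (z : ZSp E R) : ℝ≥0 :=
  relAbs h b b' (P.lower W) z / relAbs h b b' (P.upper W) z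

theorem relFac_pos (h : R.carrier ⊆ P.carrier) (b : GrBases E P) (b' : GrBases E R) (W : P.Inner)
    (z : ZSp E R) : 0 < relFac h b b' W z := div_pos (relAbs_pos _ _ _ _ _) (relAbs_pos _ _ _ _ _)

theorem continuous_relFac (h : R.carrier ⊆ P.carrier) (b : GrBases E P) (b' : GrBases E R)
    (W : P.Inner) : Continuous (relFac h b b' W) :=
  (continuous_relAbs _ _ _ _).div₀ (continuous_relAbs _ _ _ _) fun _ => (relAbs_pos _ _ _ _ _).ne'

theorem exists_utPar_smul_pt (hP : Adapted e P) (x : XBarP E P) :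
    ∃ (Q : ParFlag F V) (hQ : Q.carrier ⊆ P.carrier) (A : UT E (Fin (Module.finrank F V)))
      (ρ : Pos (Fin (Module.finrank F V))), x = utPar hP A • pt hP hQ ρ := by
  obtain ⟨A, ρ, h⟩ := exists_frame hP x
  exact ⟨_, x.2, A, ρ, h⟩

theorem relFac_smul_pt (hP : Adapted e P) (h : R.carrier ⊆ P.carrier) (b : GrBases E P)
    (b' : GrBases E R) (hQ : Q.carrier ⊆ P.carrier) (hQR : Q.carrier ⊆ R.carrier)
    (A : UT E (Fin (Module.finrank F V))) (ρ : Pos (Fin (Module.finrank F V))) (W : P.Inner) :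
    relFac h b b' W (phi E R ⟨(utPar hP A • (pt hP hQ ρ : XBarP E P)).1, hQR⟩) =
      (wgt hP b (P.lower W) ρ / wgt (hP.mono h) b' (R.cover W.1 W.2.2.1) ρ) /
        (wgt hP b (P.upper W) ρ /
          wgt (hP.mono h) b' (R.cover (P.upper W).1 (P.upper W).2.2) ρ) := by
  rw [phi_incl hP h hQ hQR, relFac, relAbs_mk_grN, relAbs_mk_grN]
  rfl

/-- The pieces on both sides of `W` lie in one graded piece of `R`, so the reference absolute values
for `R` cancel. The coordinate is already determined by φ for `R`. -/
theorem phi'_eq_of_notMem (h : R.carrier ⊆ P.carrier) (b : GrBases E P) (b' : GrBases E R)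
    (x : XBarP E P) (hx : x.1.flag.carrier ⊆ R.carrier) (W : P.Inner) (hW : W.1 ∉ R.carrier) :
    phi' E P b x W = relFac h b b' W (phi E R ⟨x.1, hx⟩) := by
  obtain ⟨e, hP⟩ := exists_adapted P
  obtain ⟨Q, hQ, A, ρ, rfl⟩ := exists_utPar_smul_pt hP x
  have hQR : Q.carrier ⊆ R.carrier := hx
  have h1 := ParFlag.cover_upper_of_notMem h W hW
  change R.cover W.1 W.2.2.1 = _ at h1
  rw [relFac_smul_pt hP h b b' hQ hQR, phi'_smul_pt_eq hP hQ b ρ _ W fun hm => hW (hQR hm),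
    tFactor_utPar, one_mul, h1, div_div_div_cancel_right₀ (wgt_pos _ _ _ _).ne', wgtRatio]

/-- Here the two covers are the graded pieces of `R` on both sides of `W`, and the quotient of their
absolute values is the coordinate for `R`. If `W` belongs to the flag of the point, both sides
vanish. -/
theorem phi'_eq_of_mem (h : R.carrier ⊆ P.carrier) (b : GrBases E P) (b' : GrBases E R)
    (x : XBarP E P) (hx : x.1.flag.carrier ⊆ R.carrier) (W : P.Inner) (hW : W.1 ∈ R.carrier) :
    phi' E P b x W = relFac h b b' W (phi E R ⟨x.1, hx⟩) *
      phi' E R b' ⟨x.1, hx⟩ ⟨W.1, hW, W.2.2⟩ := by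
  obtain ⟨e, hP⟩ := exists_adapted P
  obtain ⟨Q, hQ, A, ρ, rfl⟩ := exists_utPar_smul_pt hP x
  have hQR : Q.carrier ⊆ R.carrier := hx
  by_cases hWQ : W.1 ∈ Q.carrier
  · rw [phi'_of_mem b _ W hWQ, phi'_of_mem b' _ ⟨W.1, hW, W.2.2⟩ hWQ, mul_zero]
  have h1 : R.cover W.1 W.2.2.1 = R.lower ⟨W.1, hW, W.2.2⟩ :=
    R.cover_self (R.lower ⟨W.1, hW, W.2.2⟩)
  have h2 := ParFlag.cover_upper_of_mem h W hW
  have h3 : phi' E R b' ⟨(utPar hP A • (pt hP hQ ρ : XBarP E P)).1, hQR⟩ ⟨W.1, hW, W.2.2⟩ = _ :=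
    phi'_smul_pt_eq (hP.mono h) hQR b' ρ (utPar (hP.mono h) A) ⟨W.1, hW, W.2.2⟩ hWQ
  rw [tFactor_utPar, one_mul] at h3
  rw [relFac_smul_pt hP h b b' hQ hQR, phi'_smul_pt_eq hP hQ b ρ _ W hWQ, tFactor_utPar, one_mul,
    h1, h2, h3, wgtRatio, wgtRatio]
  have p1 := (wgt_pos (hP.mono h) b' (R.lower ⟨W.1, hW, W.2.2⟩) ρ).ne'
  have p2 := (wgt_pos (hP.mono h) b' (R.upper ⟨W.1, hW, W.2.2⟩) ρ).ne'
  have p3 := (wgt_pos hP b (P.upper W) ρ).ne'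
  field_simp

end Topologies

section Charts

open scoped Classical

variable {F V : Type*} [Field F] [AddCommGroup V] [Module F V] [FiniteDimensional F V]
  {e : Module.Basis (Fin (Module.finrank F V)) F V} {P Q R : ParFlag F V}
  {E : Type*} [NormedField E] [LocField E] [Algebra F E]

/-! ### Continuity on the Borel–Serre charts -/

variable (e) in
/-- The matrix of an element of the parabolic subgroup. -/
def parMat (g : Par E P) : Matrix (Fin (Module.finrank F V)) (Fin (Module.finrank F V)) E :=
  LinearMap.toMatrix (e.baseChange E) (e.baseChange E) (g.1 : (E ⊗[F] V) →ₗ[E] (E ⊗[F] V))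

theorem parMat_mulVec (g : Par E P) (y : E ⊗[F] V) :
    (parMat e g).mulVec ((e.baseChange E).repr y) = (e.baseChange E).repr (g.1 y) :=
  LinearMap.toMatrix_mulVec_repr _ _ _ _

theorem parMat_inv_mul (g : Par E P) : parMat e g⁻¹ * parMat e g = 1 := by
  have h : ((g⁻¹ : Par E P).1 : (E ⊗[F] V) →ₗ[E] (E ⊗[F] V)) ∘ₗ
      (g.1 : (E ⊗[F] V) →ₗ[E] (E ⊗[F] V)) = LinearMap.id := by
    refine LinearMap.ext fun x => ?_
    exact g.1.symm_apply_apply x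
  rw [parMat, parMat, ← LinearMap.toMatrix_comp, h, LinearMap.toMatrix_id]

/-- By construction `A` is the matrix of the inverse. As its determinant is 1, the matrix itself is
the adjugate, which is visibly continuous in `A`. -/
theorem parMat_utPar (hP : Adapted e P) (A : UT E (Fin (Module.finrank F V))) :
    parMat e (utPar hP A) = A.1.adjugate := by
  have h : parMat e (utPar hP A)⁻¹ = A.1 := by
    apply Matrix.ext_of_mulVec_single
    intro j
    have h1 := parMat_mulVec (e := e) (utPar hP A)⁻¹ (e.baseChange E j)
    have h2 := repr_utAut_symm (e := e) A (e.baseChange E j)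
    rw [Module.Basis.repr_self, Finsupp.single_eq_pi_single] at h1 h2
    rw [h1, ← h2]
    rfl
  have h1 := parMat_inv_mul (e := e) (utPar hP A)
  rw [h] at h1
  rw [← Matrix.inv_eq_right_inv h1, Matrix.inv_def, A.det, Ring.inverse_one, one_smul]

variable {X : Type*} [TopologicalSpace X]

theorem continuous_parMat_utPar (hP : Adapted e P) {A : X → UT E (Fin (Module.finrank F V))}
    (hA : Continuous A) : Continuous fun x => parMat e (utPar hP (A x)) := by
  simp only [parMat_utPar]
  exact (continuous_subtype_val.comp hA).matrix_adjugate

theorem continuous_repr_symm {g : X → Par E P} (hg : Continuous fun x => parMat e (g x))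
    (y : E ⊗[F] V) (j : Fin (Module.finrank F V)) :
    Continuous fun x => (e.baseChange E).repr ((g x).1.symm y) j := by
  have h : ∀ x, (e.baseChange E).repr ((g x).1.symm y) j =
      ((parMat e (g x)).det⁻¹ • (parMat e (g x)).adjugate).mulVec ((e.baseChange E).repr y) j := by
    intro x
    have h1 := parMat_mulVec (e := e) (g x)⁻¹ y
    rw [← Matrix.inv_eq_left_inv (parMat_inv_mul (g x)), Matrix.inv_def, Ring.inverse_eq_inv'] at h1
    rw [h1]
    rfl
  simp only [h]
  have hdet : ∀ x, (parMat e (g x)).det ≠ 0 := fun x =>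
    (Matrix.isUnit_det_of_left_inverse (parMat_inv_mul (g x))).ne_zero
  exact (continuous_apply j).comp
    (((hg.matrix_det.inv₀ hdet).smul hg.matrix_adjugate).matrix_mulVec continuous_const)

theorem continuous_grN (hP : Adapted e P) (W : P.Steps) {g : X → Par E P}
    (hg : Continuous fun x => parMat e (g x)) {ρ : X → Pos (Fin (Module.finrank F V))}
    (hρ : Continuous ρ) : Continuous fun x => grN hP W (g x) (ρ x) := by
  refine continuous_induced_rng.2 (continuous_pi fun y => ?_)
  obtain ⟨⟨y, hy⟩, rfl⟩ := Submodule.mkQ_surjective _ y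
  change Continuous fun x => (grN hP W (g x) (ρ x)).1 (Submodule.mkQ _ ⟨y, hy⟩)
  simp only [grN_apply]
  refine (continuous_osum E _).comp (continuous_pi fun j => ?_)
  exact ((continuous_apply j).comp (continuous_subtype_val.comp hρ)).mul
    (LocField.continuous_nabs.comp (continuous_repr_symm hg y j))

theorem continuous_offFlag {t : X → RSp e P}
    (ht : ∀ k : Fin (Module.finrank F V - 1), stdSub e (k.1 + 1) ∉ P.carrier →
      Continuous fun x => (t x).1 k) : Continuous fun x => offFlag P (t x) := by
  refine continuous_induced_rng.2 (continuous_pi fun k => ?_)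
  by_cases hk : stdSub e (k.1 + 1) ∈ P.carrier
  · have h : ∀ x, (offFlag P (t x)).1 k = 1 := fun x => offFlag_of_mem (t x) hk
    change Continuous fun x => (offFlag P (t x)).1 k
    simp only [h]
    exact continuous_const
  · have h : ∀ x, (offFlag P (t x)).1 k = (t x).1 k := fun x => offFlag_of_notMem (t x) hk
    change Continuous fun x => (offFlag P (t x)).1 k
    simp only [h]
    exact ht k hk

/-- The Borel–Serre chart as a map to `X̄_{F,v}(P)`. -/
def chart (g : Par E P) (t : RSp e P) : XBarP E P :=
  g • ⟨stdPoint E e t.1, flagOf_subset e P t⟩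

theorem continuous_phi_chart (hP : Adapted e P) {g : X → Par E P}
    (hg : Continuous fun x => parMat e (g x)) {t : X → RSp e P}
    (ht : ∀ k : Fin (Module.finrank F V - 1), stdSub e (k.1 + 1) ∉ P.carrier →
      Continuous fun x => (t x).1 k) : Continuous fun x => phi E P (chart (g x) (t x)) := by
  refine continuous_pi fun W => ?_
  have h : ∀ x, phi E P (chart (g x) (t x)) W =
      NormClass.mk (grN hP W (g x) (rho (offFlag P (t x)))) := fun x => phi_piBar hP _ _ _
  simp only [h]
  exact isOpenQuotientMap_mk.continuous.comp
    (continuous_grN hP W hg (continuous_rho.comp (continuous_offFlag ht)))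

/-- The quotient of a coordinate `φ'` and the corresponding coordinate of a Borel–Serre chart. -/
def chartFac (hP : Adapted e P) (b : GrBases E P) (W : P.Inner) (g : Par E P) (t : RSp e P) :
    ℝ≥0 :=
  hAbs (b (P.lower W)) (grN hP (P.lower W) g (rho (offFlag P t))).1 /
    hAbs (b (P.upper W)) (grN hP (P.upper W) g (rho (offFlag P t))).1

theorem phi'_chart (hP : Adapted e P) (b : GrBases E P) (g : Par E P) (t : RSp e P) (W : P.Inner)
    {k : Fin (Module.finrank F V - 1)} (hk : W.1 = stdSub e (k.1 + 1)) :
    phi' E P b (chart g t) W = t.1 k * chartFac hP b W g t := by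
  rw [chart, phi'_piBar hP b g t W hk, chartFac, hAbs_grN, hAbs_grN, tFactor_eq, wgtRatio]
  simp only [div_eq_mul_inv, mul_inv, inv_inv]
  ring

theorem chartFac_pos (hP : Adapted e P) (b : GrBases E P) (W : P.Inner) (g : Par E P)
    (t : RSp e P) : 0 < chartFac hP b W g t :=
  div_pos (hAbs_pos _ (grN hP _ _ _).2) (hAbs_pos _ (grN hP _ _ _).2)

theorem continuous_chartFac (hP : Adapted e P) (b : GrBases E P) (W : P.Inner) {g : X → Par E P}
    (hg : Continuous fun x => parMat e (g x)) {t : X → RSp e P}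
    (ht : ∀ k : Fin (Module.finrank F V - 1), stdSub e (k.1 + 1) ∉ P.carrier →
      Continuous fun x => (t x).1 k) : Continuous fun x => chartFac hP b W (g x) (t x) := by
  have hρ := continuous_rho.comp (continuous_offFlag ht)
  exact ((continuous_hAbs _).comp (continuous_grN hP _ hg hρ)).div₀
    ((continuous_hAbs _).comp (continuous_grN hP _ hg hρ)) fun _ =>
      (hAbs_pos _ (grN hP _ _ _).2).ne'

/-! ### The Borel–Serre topology -/

theorem isOpen_bsTop_iff {U : Set (XBar E F V)} :
    IsOpen[bsTop F V E] U ↔ ∀ (R : ParFlag F V) (e : Module.Basis (Fin (Module.finrank F V)) F V),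
      Adapted e R → @IsOpen _ (@instTopologicalSpaceProd _ _ (parTop E e R) inferInstance)
        (piBar E e R ⁻¹' U) := by
  simp only [isOpen_iSup_iff, isOpen_coinduced]

theorem continuous_bsTop (hP : Adapted e P) {g : X → Par E P}
    (hg : Continuous fun x => parMat e (g x)) {t : X → RSp e P} (ht : Continuous t) :
    @Continuous _ _ _ (bsTop F V E) fun x => piBar E e P (g x, t x) := by
  refine (@continuous_def _ _ _ (bsTop F V E) _).2 fun U hU => ?_
  have h := isOpen_bsTop_iff.1 hU P e hP
  let _ := parTop E e P
  have hg' : Continuous g := (continuous_induced_rng (f := parMat e)).2 hg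
  have hc : Continuous fun x => (g x, t x) := hg'.prodMk ht
  exact h.preimage hc

/-- The map `ψ` at one place. -/
def psi (P : ParFlag F V) (b : GrBases E P) (x : XBarP E P) : ZSp E P × (P.Inner → ℝ≥0) :=
  (phi E P x, phi' E P b x)

/-- Continuity of `ψ` along charts of smaller flags. -/
theorem continuous_psi_chart (h : R.carrier ⊆ P.carrier) (hR : Adapted e R) (b : GrBases E P)
    {g : X → Par E R} (hg : Continuous fun x => parMat e (g x)) {t : X → RSp e R}
    (ht : Continuous t) (f : X → XBarP E P) (hf : ∀ x, (f x).1 = piBar E e R (g x, t x)) :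
    Continuous fun x => psi P b (f x) := by
  have hfR : ∀ x, (f x).1.flag.carrier ⊆ R.carrier := by
    intro x
    rw [hf]
    exact flagOf_subset e R (t x)
  have hfc : ∀ x, (⟨(f x).1, hfR x⟩ : XBarP E R) = chart (g x) (t x) := fun x => Subtype.ext (hf x)
  have ht' : ∀ k, Continuous fun x => (t x).1 k := fun k =>
    (continuous_apply k).comp (continuous_subtype_val.comp ht)
  have hphi := continuous_phi_chart hR hg (t := t) fun k _ => ht' k
  refine Continuous.prodMk ?_ (continuous_pi fun W => ?_)
  · have h1 : ∀ x, phi E P (f x) = phi E P (ptOf h (phi E R (chart (g x) (t x)))) := by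
      intro x
      rw [phi_eq_phi_ptOf h (f x) (hfR x), hfc]
    simp only [h1]
    exact (continuous_phi_ptOf h).comp hphi
  · let b' : GrBases E R := fun W => Module.finBasis E _
    by_cases hW : W.1 ∈ R.carrier
    · obtain ⟨k, hk⟩ := hR.exists_index ⟨W.1, hW, W.2.2⟩
      have h1 : ∀ x, phi' E P b (f x) W = relFac h b b' W (phi E R (chart (g x) (t x))) *
          ((t x).1 k * chartFac hR b' ⟨W.1, hW, W.2.2⟩ (g x) (t x)) := by
        intro x
        rw [phi'_eq_of_mem h b b' (f x) (hfR x) W hW, hfc, phi'_chart hR b' _ _ _ hk]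
      simp only [h1]
      exact ((continuous_relFac h b b' W).comp hphi).mul
        ((ht' k).mul (continuous_chartFac hR b' _ hg fun k _ => ht' k))
    · have h1 : ∀ x, phi' E P b (f x) W = relFac h b b' W (phi E R (chart (g x) (t x))) := by
        intro x
        rw [phi'_eq_of_notMem h b b' (f x) (hfR x) W hW, hfc]
      simp only [h1]
      exact (continuous_relFac h b b' W).comp hphi

theorem isOpen_nonvanishing {n : ℕ} (T : Set (Fin n)) :
    IsOpen {t : Fin n → ℝ≥0 | ∀ k ∈ T, t k ≠ 0} := by
  have h : {t : Fin n → ℝ≥0 | ∀ k ∈ T, t k ≠ 0} = ⋂ k ∈ T, (fun t : Fin n → ℝ≥0 => t k) ⁻¹' {0}ᶜ := by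
    ext t
    simp
  rw [h]
  exact T.toFinite.isOpen_biInter fun k _ => isOpen_compl_singleton.preimage (continuous_apply k)

/-- The image of the preimage of an open set is tested in the chart of an arbitrary flag `R`. Near a
point with coordinates `t₀`, no nonzero coordinate becomes zero, so all flags are contained in the
one of `t₀`, which lies in both `R` and `P`. The chart can be read there as a chart of the flag of
`t₀`, along which ψ is continuous. In particular, X̄(P) is open. -/
theorem continuous_psi_bsTop (b : GrBases E P) :
    @Continuous _ _ (TopologicalSpace.induced Subtype.val (bsTop F V E)) _
      (psi P b : XBarP E P → _) := by
  refine continuous_def.2 fun O hO => ?_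
  refine (isOpen_induced_iff (t := bsTop F V E)).2
    ⟨Subtype.val '' (psi P b ⁻¹' O), ?_, Set.preimage_image_eq _ Subtype.val_injective⟩
  rw [isOpen_bsTop_iff]
  intro R e hR
  let _ := parTop E e R
  rw [isOpen_iff_mem_nhds]
  rintro ⟨g₀, t₀⟩ hmem
  have hR' : (flagOf e t₀.1).carrier ⊆ R.carrier := flagOf_subset e R t₀
  have hP' : (flagOf e t₀.1).carrier ⊆ P.carrier := by
    obtain ⟨x, -, hx⟩ := hmem
    have h1 := x.2
    rw [hx] at h1
    exact h1
  let N : Set (Par E R × RSp e R) := {y | ∀ k ∈ {k | t₀.1 k ≠ 0}, y.2.1 k ≠ 0}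
  have hN : IsOpen N := (isOpen_nonvanishing {k | t₀.1 k ≠ 0}).preimage
    (continuous_subtype_val.comp continuous_snd)
  have ht : ∀ y : N, ∀ k, y.1.2.1 k = 0 → stdSub e (k.1 + 1) ∈ (flagOf e t₀.1).carrier := by
    intro y k hk
    rw [stdSub_mem_flagOf]
    by_contra h0
    exact y.2 k h0 hk
  let g : N → Par E (flagOf e t₀.1) := fun y => Subgroup.inclusion (Par_mono E hR') y.1.1
  let t : N → RSp e (flagOf e t₀.1) := fun y => ⟨y.1.2.1, ht y⟩
  have hg : Continuous fun y => parMat e (g y) :=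
    (continuous_induced_dom (t := inferInstance) (f := fun g : Par E R => parMat e g)).comp
      (continuous_fst.comp continuous_subtype_val)
  have htv : Continuous fun y : N => y.1.2.1 :=
    continuous_subtype_val.comp (continuous_snd.comp continuous_subtype_val)
  have htc : Continuous t := htv.subtype_mk _
  let f : N → XBarP E P := fun y => ⟨piBar E e R y.1, (flagOf_subset e _ (t y)).trans hP'⟩
  have hf := continuous_psi_chart hP' (adapted_flagOf e t₀.1) b hg htc f fun _ => rfl
  have hO' := hN.isOpenMap_subtype_val _ (hO.preimage hf)
  refine Filter.mem_of_superset (hO'.mem_nhds ?_) ?_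
  · obtain ⟨x, hx, hx'⟩ := hmem
    refine ⟨⟨(g₀, t₀), fun k hk => hk⟩, ?_, rfl⟩
    have : f ⟨(g₀, t₀), fun k hk => hk⟩ = x := Subtype.ext hx'.symm
    change psi P b (f _) ∈ O
    rw [this]
    exact hx
  · rintro _ ⟨y, hy, rfl⟩
    exact ⟨f y, hy, rfl⟩

end Charts

section YFacTopology

/-! ### The topologies of `Y_0` -/

variable {S : Type*}

theorem YFac.pos_of_ne_zero {t : YFac S} (h : t.1 ≠ 0) (v : S) : 0 < t.1 v :=
  (t.2.resolve_right h) v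

theorem YFac.eq_zero_iff [Nonempty S] (t : YFac S) (v : S) : t.1 v = 0 ↔ t.1 = 0 := by
  refine ⟨fun h => ?_, fun h => congrFun h v⟩
  by_contra h0
  exact (YFac.pos_of_ne_zero h0 v).ne' h

variable [Fintype S] {X : Type*} [TopologicalSpace X]

theorem YFac.isOpen_ne_zero_usual : IsOpen[YFac.usual S] {t : YFac S | t.1 ≠ 0} := by
  let _ := YFac.usual S
  have h : IsOpen {x : S → ℝ≥0 | x ≠ 0} := isOpen_ne
  exact h.preimage (continuous_subtype_val (p := fun t : S → ℝ≥0 => (∀ v, 0 < t v) ∨ t = 0))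

theorem YFac.isOpen_ne_zero : IsOpen[YFac.weak S] {t : YFac S | t.1 ≠ 0} := by
  refine ⟨?_, fun ⟨t, h, h0⟩ => absurd h0 h⟩
  have h := YFac.isOpen_ne_zero_usual (S := S)
  convert h using 1
  ext t
  simp

theorem YFac.isOpen_weak_of_usual {U : Set (YFac S)} (hU : IsOpen[YFac.usual S] U)
    (h0 : ∀ t ∈ U, t.1 ≠ 0) : IsOpen[YFac.weak S] U := by
  refine ⟨?_, fun ⟨t, h, h'⟩ => absurd h' (h0 t h)⟩
  convert hU using 1
  ext t
  exact ⟨fun h => h.1, fun h => ⟨h, h0 t h⟩⟩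

theorem YFac.continuousOn_weak :
    @ContinuousOn _ _ (YFac.weak S) _ (fun t : YFac S => t.1) {t | t.1 ≠ 0} := by
  let _ := YFac.weak S
  rw [continuousOn_open_iff YFac.isOpen_ne_zero]
  intro O hO
  refine YFac.isOpen_weak_of_usual ?_ fun t h => h.1
  let _ := YFac.usual S
  exact YFac.isOpen_ne_zero_usual.inter (hO.preimage
    (continuous_subtype_val (p := fun t : S → ℝ≥0 => (∀ v, 0 < t v) ∨ t = 0)))

/-- Away from the origin the weak topology is the usual one. At the origin, the sublevel sets of the
product are its basic neighborhoods. -/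
theorem YFac.continuous_prod [Nonempty S] :
    @Continuous _ _ (YFac.weak S) _ fun t : YFac S => ∏ v, t.1 v := by
  let _ := YFac.weak S
  rw [continuous_iff_continuousAt]
  intro t
  have hz : ∀ t : YFac S, t.1 = 0 → ∏ v, t.1 v = 0 := by
    intro t ht
    rw [ht]
    exact Finset.prod_eq_zero (Finset.mem_univ (Classical.arbitrary S)) rfl
  by_cases ht : t.1 = 0
  · have h0 := nhds_bot_basis_Iic (α := ℝ≥0)
    rw [bot_eq_zero] at h0
    rw [ContinuousAt, hz t ht, h0.tendsto_right_iff]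
    intro c hc
    have hU : IsOpen ({s : YFac S | ∏ v, s.1 v < c} : Set (YFac S)) := by
      refine ⟨?_, fun _ => ?_⟩
      · let _ := YFac.usual S
        have hc : Continuous fun s : YFac S => ∏ v, s.1 v :=
          continuous_finsetProd _ fun v _ => (continuous_apply v).comp
            (continuous_subtype_val (p := fun t : S → ℝ≥0 => (∀ v, 0 < t v) ∨ t = 0))
        exact (isOpen_lt hc continuous_const).inter YFac.isOpen_ne_zero_usual
      -- Basic neighborhoods of zero are given by `≤` and the target set by `<`, so half the bound
      -- is used.
      · refine ⟨c / 2, half_pos hc, fun s hs => ?_⟩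
        rcases hs with hs | hs
        · change _ < c
          rw [hz s hs]
          exact hc
        · exact hs.trans_lt (NNReal.half_lt_self (ne_of_gt hc))
    filter_upwards [hU.mem_nhds (show ∏ v, t.1 v < c by rw [hz t ht]; exact hc)] with s hs
    exact le_of_lt hs
  · have h1 := YFac.continuousOn_weak.continuousAt (YFac.isOpen_ne_zero.mem_nhds ht)
    exact (continuous_finsetProd Finset.univ
      fun v _ => continuous_apply v : Continuous fun s : S → ℝ≥0 => ∏ v, s v).continuousAt.comp h1

theorem YFac.continuousAt_of_ne_zero {f : X → YFac S} {x : X} (hx : (f x).1 ≠ 0)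
    (h : ContinuousAt (fun x => (f x).1) x) : @ContinuousAt _ _ _ (YFac.weak S) f x := by
  have h' : @ContinuousAt _ _ _ (YFac.usual S) f x := by
    let _ := YFac.usual S
    exact (Topology.IsInducing.continuousAt_iff ⟨rfl⟩).2 h
  let _ := YFac.weak S
  rw [ContinuousAt, tendsto_nhds]
  intro U hU hxU
  let _ := YFac.usual S
  have h1 := h'.preimage_mem_nhds (hU.1.mem_nhds ⟨hxU, hx⟩)
  filter_upwards [h1] with y hy using hy.1

/-- A weak neighborhood of the origin constrains only the product over the places. This is why the
Satake topology, which records just this product, suffices at points where the coordinate vanishes.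
-/
theorem YFac.continuousAt_of_eq_zero [Nonempty S] {f : X → YFac S} {x : X} (hx : (f x).1 = 0)
    (h : ContinuousAt (fun x => ∏ v, (f x).1 v) x) : @ContinuousAt _ _ _ (YFac.weak S) f x := by
  let _ := YFac.weak S
  rw [ContinuousAt, tendsto_nhds]
  intro U hU hxU
  obtain ⟨c, hc, hcU⟩ := hU.2 ⟨f x, hxU, hx⟩
  have h0 : ∏ v, (f x).1 v = 0 := by
    rw [hx]
    exact Finset.prod_eq_zero (Finset.mem_univ (Classical.arbitrary S)) rfl
  have h1 : ∀ᶠ y in 𝓝 x, ∏ v, (f y).1 v < c := by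
    exact h.eventually (isOpen_Iio.mem_nhds (h0.trans_lt hc))
  filter_upwards [h1] with y hy using hcU _ (Or.inr hy.le)

end YFacTopology

/-! ### Homeomorphisms from quotients -/

/-- A bijection `Ψ` from a quotient of `X` is a homeomorphism if it is induced by a continuous map and
there is a continuous map to `X` whose composite with it is a quotient map. -/
theorem isHomeomorph_of_section {X B D : Type*} (s : Setoid X) (TX : TopologicalSpace X)
    (TB : TopologicalSpace B) [TopologicalSpace D] (Ψ : Quotient s ≃ B) {ψ : X → B}
    (hψ : ∀ x, Ψ (Quotient.mk s x) = ψ x) {C : D → X} {ζ : D → B}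
    (hζ : Topology.IsQuotientMap ζ) (hC : ∀ d, ψ (C d) = ζ d) (h1 : Continuous ψ)
    (h2 : Continuous C) :
    @IsHomeomorph _ _ (TopologicalSpace.coinduced (Quotient.mk s) TX) TB Ψ := by
  let _ : TopologicalSpace (Quotient s) := TopologicalSpace.coinduced (Quotient.mk s) TX
  have hmk : Continuous (Quotient.mk s) := continuous_coinduced_rng
  have c1 : Continuous Ψ := by
    refine continuous_coinduced_dom.2 ?_
    have : Ψ ∘ Quotient.mk s = ψ := funext hψ
    rw [this]
    exact h1
  have c2 : Continuous Ψ.symm := by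
    rw [hζ.continuous_iff]
    have : Ψ.symm ∘ ζ = Quotient.mk s ∘ C := by
      funext d
      rw [Function.comp_apply, ← hC, ← hψ, Equiv.symm_apply_apply]
      rfl
    rw [this]
    exact hmk.comp h2
  exact (Homeomorph.mk Ψ c1 c2).isHomeomorph

section InverseChart

open scoped Classical

variable {F V : Type*} [Field F] [AddCommGroup V] [Module F V] [FiniteDimensional F V]
  {e : Module.Basis (Fin (Module.finrank F V)) F V} {P Q R : ParFlag F V}
  {E : Type*} [NormedField E] [LocField E] [Algebra F E]

/-! ### The inverse of `ψ` on parameters -/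

/-- The quotients of successive weights. -/
def posRatio {n : ℕ} (r : Pos (Fin n)) : Pos (Fin (n - 1)) :=
  ⟨fun k => r.1 ⟨k.1, by omega⟩ / r.1 ⟨k.1 + 1, by omega⟩, fun _ => div_pos (r.2 _) (r.2 _)⟩

theorem continuous_posRatio {n : ℕ} : Continuous (posRatio : Pos (Fin n) → _) := by
  refine Continuous.subtype_mk (continuous_pi fun k => ?_) _
  exact ((continuous_apply _).comp continuous_subtype_val).div₀
    ((continuous_apply _).comp continuous_subtype_val) fun r => (r.2 _).ne'

/-- The successive quotients determine weights up to a common factor, here normalized by making the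
first weight 1. -/
theorem exists_rho_posRatio {n : ℕ} (r : Pos (Fin n)) :
    ∃ c : ℝ≥0, 0 < c ∧ ∀ j, (rho (posRatio r)).1 j = c * r.1 j := by
  rcases Nat.eq_zero_or_pos n with rfl | hn
  · exact ⟨1, one_pos, fun j => j.elim0⟩
  refine ⟨(r.1 ⟨0, hn⟩)⁻¹, inv_pos.2 (r.2 _), ?_⟩
  have key : ∀ m (hm : m < n), (rho (posRatio r)).1 ⟨m, hm⟩ = (r.1 ⟨0, hn⟩)⁻¹ * r.1 ⟨m, hm⟩ := by
    intro m
    induction m with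
    | zero =>
      intro hm
      rw [inv_mul_cancel₀ (r.2 _).ne']
      unfold rho
      dsimp only
      refine Finset.prod_eq_one fun k hk => ?_
      exact absurd (Finset.mem_filter.1 hk).2 (Nat.not_lt_zero _)
    | succ m ih =>
      intro hm
      have h1 := rho_succ (posRatio r) (i := ⟨m, by omega⟩) (j := ⟨m + 1, hm⟩) ⟨m, by omega⟩ rfl rfl
      rw [ih] at h1
      change _ * (r.1 ⟨m, _⟩ / r.1 ⟨m + 1, hm⟩) = _ at h1
      rw [mul_div_assoc', div_eq_iff (r.2 _).ne', mul_right_comm] at h1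
      exact mul_right_cancel₀ (r.2 _).ne' h1
  exact fun j => key j.1 j.2

variable (P) in
/-- The coordinates of a Borel–Serre chart that do not belong to the flag, in terms of weights. -/
def weightCoord (e : Module.Basis (Fin (Module.finrank F V)) F V)
    (r : Pos (Fin (Module.finrank F V))) : RSp e P :=
  ⟨fun k => if stdSub e (k.1 + 1) ∈ P.carrier then 1 else (posRatio r).1 k, fun k hk => by
    beta_reduce at hk
    split_ifs at hk with h
    · exact h
    · exact absurd hk ((posRatio r).2 k).ne'⟩

/-- The inner member of the flag given by an index. -/
def innerOf {k : Fin (Module.finrank F V - 1)} (h : stdSub e (k.1 + 1) ∈ P.carrier) : P.Inner :=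
  ⟨stdSub e (k.1 + 1), h, stdSub_ne_bot e k, stdSub_ne_top e k⟩

/-- The coordinates of a Borel–Serre chart of a point with given values of `φ'`. -/
def invCoord (hP : Adapted e P) (b : GrBases E P) (y : Frm e P E) (u : P.Inner → ℝ≥0) : RSp e P :=
  ⟨fun k => if h : stdSub e (k.1 + 1) ∈ P.carrier then
      u (innerOf h) / chartFac hP b (innerOf h) (utPar hP (frmUT y)) (weightCoord P e (frmPos y))
    else (weightCoord P e (frmPos y)).1 k, fun k hk => by
    beta_reduce at hk
    split_ifs at hk with h
    · exact h
    · exact (weightCoord P e (frmPos y)).2 k hk⟩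

theorem invCoord_of_mem (hP : Adapted e P) (b : GrBases E P) (y : Frm e P E) (u : P.Inner → ℝ≥0)
    {k : Fin (Module.finrank F V - 1)} (h : stdSub e (k.1 + 1) ∈ P.carrier) :
    (invCoord hP b y u).1 k = u (innerOf h) /
      chartFac hP b (innerOf h) (utPar hP (frmUT y)) (weightCoord P e (frmPos y)) := dif_pos h

theorem invCoord_of_notMem (hP : Adapted e P) (b : GrBases E P) (y : Frm e P E)
    (u : P.Inner → ℝ≥0) {k : Fin (Module.finrank F V - 1)} (h : stdSub e (k.1 + 1) ∉ P.carrier) :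
    (invCoord hP b y u).1 k = (posRatio (frmPos y)).1 k := (dif_neg h).trans (if_neg h)

theorem weightCoord_of_notMem (r : Pos (Fin (Module.finrank F V)))
    {k : Fin (Module.finrank F V - 1)} (h : stdSub e (k.1 + 1) ∉ P.carrier) :
    (weightCoord P e r).1 k = (posRatio r).1 k := if_neg h

/-- The factor `chartFac` sees a chart coordinate only through `offFlag`. It is therefore the same
for `invCoord` as for `weightCoord`, and using it inside the definition of `invCoord` is not
circular. -/
theorem offFlag_invCoord (hP : Adapted e P) (b : GrBases E P) (y : Frm e P E)
    (u : P.Inner → ℝ≥0) :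
    offFlag P (invCoord hP b y u) = offFlag P (weightCoord P e (frmPos y)) := by
  apply Subtype.ext
  funext k
  by_cases h : stdSub e (k.1 + 1) ∈ P.carrier
  · rw [offFlag_of_mem _ h, offFlag_of_mem _ h]
  · rw [offFlag_of_notMem _ h, offFlag_of_notMem _ h, invCoord_of_notMem _ _ _ _ h,
      weightCoord_of_notMem _ h]

theorem phi_chart_of_weights (hP : Adapted e P) (g : Par E P) {t : RSp e P}
    {r : Pos (Fin (Module.finrank F V))}
    (h : ∀ k, stdSub e (k.1 + 1) ∉ P.carrier → t.1 k = (posRatio r).1 k) (W : P.Steps) :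
    phi E P (chart g t) W = NormClass.mk (grN hP W g r) := by
  obtain ⟨c, hc, h1⟩ := exists_rho_posRatio r
  rw [chart, phi_piBar hP, mk_grN_rho hP W g (s := posRatio r) (s' := offFlag P t),
    mk_grN_of_proportional hP W g hc fun j => h1 j.1]
  intro k hk
  rw [offFlag_of_notMem _ hk, h k hk]

/-- The point with given values of `φ` (in terms of parameters) and `φ'`. -/
def invPoint (hP : Adapted e P) (b : GrBases E P) (y : Frm e P E) (u : P.Inner → ℝ≥0) :
    XBarP E P := chart (utPar hP (frmUT y)) (invCoord hP b y u)

/-- For φ only the coordinates off the flag matter, and these are the quotients of the given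
weights. For φ' the division by `chartFac` in `invCoord` cancels the factor by which φ' differs from
the chart coordinate. -/
theorem psi_invPoint (hP : Adapted e P) (b : GrBases E P) (y : Frm e P E) (u : P.Inner → ℝ≥0) :
    psi P b (invPoint hP b y u) = (zeta hP y, u) := by
  refine Prod.ext (funext fun W => ?_) (funext fun W => ?_)
  · change phi E P (chart _ _) W = _
    rw [phi_chart_of_weights hP _ (fun k hk => invCoord_of_notMem hP b y u hk), ← zeta_eq]
  · obtain ⟨W, hW⟩ := W
    obtain ⟨k, hk⟩ := hP.exists_index ⟨W, hW⟩
    obtain rfl : W = stdSub e (k.1 + 1) := hk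
    change phi' E P b (chart _ _) _ = u _
    rw [phi'_chart hP b _ _ ⟨stdSub e (k.1 + 1), hW⟩ (k := k) rfl, invCoord_of_mem _ _ _ _ hW.1]
    have h1 : chartFac hP b ⟨stdSub e (k.1 + 1), hW⟩ (utPar hP (frmUT y)) (invCoord hP b y u) =
        chartFac hP b (innerOf hW.1) (utPar hP (frmUT y)) (weightCoord P e (frmPos y)) := by
      rw [chartFac, chartFac, offFlag_invCoord]
      rfl
    rw [h1, div_mul_cancel₀ _ (chartFac_pos _ _ _ _ _).ne']
    rfl

variable {X : Type*} [TopologicalSpace X]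

theorem continuous_weightCoord {k : Fin (Module.finrank F V - 1)} {y : X → Frm e P E}
    (hy : Continuous y) : Continuous fun x => (weightCoord P e (frmPos (y x))).1 k := by
  by_cases h : stdSub e (k.1 + 1) ∈ P.carrier
  · have h1 : ∀ x, (weightCoord P e (frmPos (y x))).1 k = 1 := fun x => if_pos h
    simp only [h1]
    exact continuous_const
  · simp only [weightCoord_of_notMem _ h]
    exact (continuous_apply k).comp (continuous_subtype_val.comp
      (continuous_posRatio.comp (continuous_frmPos.comp hy)))

theorem continuous_chartFac_weightCoord (hP : Adapted e P) (b : GrBases E P) (W : P.Inner)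
    {y : X → Frm e P E} (hy : Continuous y) : Continuous fun x =>
      chartFac hP b W (utPar hP (frmUT (y x))) (weightCoord P e (frmPos (y x))) :=
  continuous_chartFac hP b W (continuous_parMat_utPar hP (continuous_frmUT.comp hy))
    fun _ _ => continuous_weightCoord hy

theorem continuous_invCoord_of_notMem (hP : Adapted e P) (b : GrBases E P) {y : X → Frm e P E}
    (hy : Continuous y) (u : X → P.Inner → ℝ≥0) {k : Fin (Module.finrank F V - 1)}
    (h : stdSub e (k.1 + 1) ∉ P.carrier) :
    Continuous fun x => (invCoord hP b (y x) (u x)).1 k := by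
  simp only [invCoord_of_notMem _ _ _ _ h]
  exact (continuous_apply k).comp (continuous_subtype_val.comp
    (continuous_posRatio.comp (continuous_frmPos.comp hy)))

theorem continuous_invCoord_of_mem (hP : Adapted e P) (b : GrBases E P) {y : X → Frm e P E}
    (hy : Continuous y) {u : X → P.Inner → ℝ≥0} {k : Fin (Module.finrank F V - 1)}
    (h : stdSub e (k.1 + 1) ∈ P.carrier) (hu : Continuous fun x => u x (innerOf h)) :
    Continuous fun x => (invCoord hP b (y x) (u x)).1 k := by
  simp only [invCoord_of_mem _ _ _ _ h]
  exact hu.div₀ (continuous_chartFac_weightCoord hP b _ hy) fun _ => (chartFac_pos _ _ _ _ _).ne'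

theorem continuous_invPoint (hP : Adapted e P) (b : GrBases E P) {y : X → Frm e P E}
    (hy : Continuous y) {u : X → P.Inner → ℝ≥0} (hu : Continuous u) :
    @Continuous _ _ _ (bsTop F V E) fun x => (invPoint hP b (y x) (u x)).1 := by
  refine continuous_bsTop hP (continuous_parMat_utPar hP (continuous_frmUT.comp hy))
    (t := fun x => invCoord hP b (y x) (u x)) ?_
  refine continuous_induced_rng.2 (continuous_pi fun k => ?_)
  by_cases h : stdSub e (k.1 + 1) ∈ P.carrier
  · exact continuous_invCoord_of_mem hP b hy h ((continuous_apply _).comp hu)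
  · exact continuous_invCoord_of_notMem hP b hy u h

end InverseChart

section SeveralPlaces

open scoped Classical

variable {S : Type*} [Fintype S] [Nonempty S] {F V : Type*} [Field F] [AddCommGroup V] [Module F V]
  [FiniteDimensional F V] {e : Module.Basis (Fin (Module.finrank F V)) F V} {P Q R : ParFlag F V}
  {E : S → Type*} [∀ v, NormedField (E v)] [∀ v, LocField (E v)] [∀ v, Algebra F (E v)]

/-! ### The map `ψ` for several places -/

/-- All components have the same flag, so a coordinate vanishes at one place exactly when it
vanishes at all of them. -/
theorem phi'_pos_or_zero (b : ∀ v, GrBases (E v) P) (x : XBarSP E P) (W : P.Inner) :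
    (∀ v, 0 < phi' (E v) P (b v) (x.comp v) W) ∨
      (fun v => phi' (E v) P (b v) (x.comp v) W) = 0 := by
  by_cases h : ∃ v, phi' (E v) P (b v) (x.comp v) W = 0
  · obtain ⟨v, hv⟩ := h
    rw [phi'_eq_zero_iff] at hv
    refine Or.inr (funext fun w => phi'_of_mem (b w) (x.comp w) W ?_)
    change W.1 ∈ (x.1.1 v).flag.carrier at hv
    change W.1 ∈ (x.1.1 w).flag.carrier
    rwa [x.1.2 w v]
  · exact Or.inl fun v => pos_of_ne_zero fun hv => h ⟨v, hv⟩

/-- The map `ψ_{P,S}`. -/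
def psiS (b : ∀ v, GrBases (E v) P) (x : XBarSP E P) : ZSpS E P × YSp S P :=
  (phiS E P x, fun W => ⟨fun v => phi' (E v) P (b v) (x.comp v) W, phi'_pos_or_zero b x W⟩)

theorem psiS_eq_iff (b : ∀ v, GrBases (E v) P) (x x' : XBarSP E P) :
    psiS b x = psiS b x' ↔ MulAction.orbitRel (UniRadS E P) (XBarSP E P) x x' := by
  rw [MulAction.orbitRel_apply]
  constructor
  · intro h
    have h1 : ∀ v, ∃ u ∈ UniRad (E v) P, u • x'.comp v = x.comp v := by
      intro v
      refine exists_uniRad_of_eq (b v) (congrFun (congrArg Prod.fst h) v).symm (funext fun W => ?_)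
      exact (congrFun (congrArg Subtype.val (congrFun (congrArg Prod.snd h) W)) v).symm
    choose u hu hx using h1
    refine ⟨⟨u, fun v _ => hu v⟩, ?_⟩
    apply Subtype.ext
    apply Subtype.ext
    funext v
    exact congrArg Subtype.val (hx v)
  · rintro ⟨⟨u, hu⟩, rfl⟩
    have h1 : ∀ v, u v ∈ UniRad (E v) P := fun v => hu v (Set.mem_univ v)
    refine Prod.ext (funext fun v => ?_) (funext fun W => Subtype.ext (funext fun v => ?_))
    · exact phi_uniRad_smul (h1 v) (x'.comp v)
    · exact congrFun (phi'_uniRad_smul (b v) (h1 v) (x'.comp v)) W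

/-- The point with given values of `φ` (in terms of parameters) and `φ'`. -/
def invPointS (hP : Adapted e P) (b : ∀ v, GrBases (E v) P)
    (d : (∀ v, Frm e P (E v)) × YSp S P) : XBarSP E P :=
  ⟨⟨fun v => (invPoint hP (b v) (d.1 v) fun W => (d.2 W).1 v).1, fun v w => by
    -- The flag of each component is read off from the zeros of its φ', that is, from the zeros of
    -- the prescribed coordinates. For an element of Y_0 these do not depend on the place.
    refine ParFlag.eq_of_inner (invPoint hP (b v) (d.1 v) fun W => (d.2 W).1 v).2
      (invPoint hP (b w) (d.1 w) fun W => (d.2 W).1 w).2 fun W => ?_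
    rw [← phi'_eq_zero_iff (b v) (invPoint hP (b v) (d.1 v) fun W => (d.2 W).1 v) W,
      ← phi'_eq_zero_iff (b w) (invPoint hP (b w) (d.1 w) fun W => (d.2 W).1 w) W]
    have h1 := congrFun (congrArg Prod.snd
      (psi_invPoint hP (b v) (d.1 v) fun W => (d.2 W).1 v)) W
    have h2 := congrFun (congrArg Prod.snd
      (psi_invPoint hP (b w) (d.1 w) fun W => (d.2 W).1 w)) W
    exact (Eq.congr_left h1).trans (((d.2 W).eq_zero_iff v).trans
      (((d.2 W).eq_zero_iff w).symm.trans (Eq.congr_left h2).symm))⟩,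
    fun v => (invPoint hP (b v) (d.1 v) fun W => (d.2 W).1 v).2⟩

theorem psiS_invPointS (hP : Adapted e P) (b : ∀ v, GrBases (E v) P)
    (d : (∀ v, Frm e P (E v)) × YSp S P) :
    psiS b (invPointS hP b d) =
      Prod.map (fun (y : ∀ v, Frm e P (E v)) v => zeta hP (y v)) id d := by
  have h := fun v => psi_invPoint hP (b v) (d.1 v) fun W => (d.2 W).1 v
  refine Prod.ext (funext fun v => ?_) (funext fun W => Subtype.ext (funext fun v => ?_))
  · exact congrArg Prod.fst (h v)
  · exact congrFun (congrArg Prod.snd (h v)) W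

theorem psiS_surjective (b : ∀ v, GrBases (E v) P) : Function.Surjective (psiS b) := by
  rintro ⟨z, u⟩
  obtain ⟨e, hP⟩ := exists_adapted P
  choose y hy using fun v => (isQuotientMap_zeta (E := E v) hP).surjective (z v)
  exact ⟨invPointS hP b (y, u), (psiS_invPointS hP b (y, u)).trans (Prod.ext (funext hy) rfl)⟩

/-- The bijection induced by `ψ_{P,S}`. -/
def psiEquivS (b : ∀ v, GrBases (E v) P) : QuotSP E P ≃ ZSpS E P × YSp S P :=
  Equiv.ofBijective (Quotient.lift (psiS b) fun x x' h => (psiS_eq_iff b x x').2 h) <| by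
    constructor
    · intro q q'
      induction q using Quotient.inductionOn
      induction q' using Quotient.inductionOn
      intro h
      exact Quotient.sound ((psiS_eq_iff b _ _).1 h)
    · intro z
      obtain ⟨x, rfl⟩ := psiS_surjective b z
      exact ⟨Quotient.mk _ x, rfl⟩

theorem psiEquivS_mk (b : ∀ v, GrBases (E v) P) (x : XBarSP E P) :
    psiEquivS b (QuotSP.mk x) = psiS b x := rfl

/-! ### The Borel–Serre topology for several places -/

/-- The topologies of X̄_{F,S} and Y_0 are induced from products over the places, so both continuity
claims reduce to a single place. -/
theorem isHomeomorph_psiEquivS_bsTopS (b : ∀ v, GrBases (E v) P) :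
    @IsHomeomorph _ _ (quotTopS E P (bsTopS E F V)) (prodTop P _ (YFac.usual S))
      (psiEquivS b) := by
  obtain ⟨e, hP⟩ := exists_adapted P
  let _ : ∀ v, TopologicalSpace (XBar (E v) F V) := fun v => bsTop F V (E v)
  let _ := YFac.usual S
  refine isHomeomorph_of_section _ _ _ (psiEquivS b) (fun x => psiEquivS_mk b x)
    (isQuotientMap_zetaS E hP (YSp S P)) (psiS_invPointS hP b) ?_ ?_
  · have h1 : ∀ v, Continuous fun x : XBarSP E P => x.1.1 v := fun v =>
      (continuous_apply v).comp (continuous_subtype_val.comp continuous_subtype_val)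
    have h2 : ∀ v, Continuous fun x : XBarSP E P => psi P (b v) (x.comp v) := fun v =>
      (continuous_psi_bsTop (b v)).comp (continuous_induced_rng.2 (h1 v))
    refine Continuous.prodMk (continuous_pi fun v => continuous_fst.comp (h2 v))
      (continuous_pi fun W => continuous_induced_rng.2 (continuous_pi fun v => ?_))
    exact (continuous_apply W).comp (continuous_snd.comp (h2 v))
  · refine continuous_induced_rng.2 (continuous_induced_rng.2 (continuous_pi fun v => ?_))
    refine continuous_invPoint hP (b v) ((continuous_apply v).comp continuous_fst)
      (continuous_pi fun W => ?_)
    have h1 : Continuous fun t : YFac S => t.1 := continuous_induced_dom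
    exact (continuous_apply v).comp (h1.comp ((continuous_apply W).comp continuous_snd))

/-! ### The Satake topology -/

/-- The map defining the Satake topology. -/
def satData (b : ∀ v, GrBases (E v) P) (x : XBarSP E P) : ZSpS E P × (P.Inner → ℝ≥0) :=
  (phiS E P x, fun W => ∏ v, phi' (E v) P (b v) (x.comp v) W)

theorem continuous_satData (b : ∀ v, GrBases (E v) P) :
    @Continuous _ _ (TopologicalSpace.induced Subtype.val (satakeTopS E F V)) _ (satData b) := by
  refine continuous_def.2 fun O hO => ?_
  refine (isOpen_induced_iff (t := satakeTopS E F V)).2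
    ⟨Subtype.val '' (satData b ⁻¹' O), ?_, Set.preimage_image_eq _ Subtype.val_injective⟩
  exact TopologicalSpace.isOpen_generateFrom_of_mem ⟨P, b, O, hO, rfl⟩

/-- This is the generating open set belonging to the whole target space; the choice of bases is
irrelevant. -/
theorem isOpen_satakeTopS (P : ParFlag F V) :
    IsOpen[satakeTopS E F V] {x : XBarS E F V | ∀ v, (x.1 v).flag.carrier ⊆ P.carrier} := by
  have h : {x : XBarS E F V | ∀ v, (x.1 v).flag.carrier ⊆ P.carrier} =
      Subtype.val '' (satData (fun v W => Module.finBasis (E v) (Gr (E v) P W)) ⁻¹' Set.univ) := by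
    rw [Set.preimage_univ, Set.image_univ]
    ext x
    refine ⟨fun hx => ⟨⟨x, hx⟩, rfl⟩, ?_⟩
    rintro ⟨y, rfl⟩
    exact y.2
  rw [h]
  exact TopologicalSpace.isOpen_generateFrom_of_mem ⟨P, _, _, isOpen_univ, rfl⟩

variable {X : Type*} [TopologicalSpace X]

theorem continuous_phiS_of_subset (h : R.carrier ⊆ P.carrier) (f : X → XBarSP E P)
    (hf : ∀ x v, ((f x).1.1 v).flag.carrier ⊆ R.carrier)
    (hc : Continuous fun x => phiS E R ⟨(f x).1, hf x⟩) : Continuous fun x => phiS E P (f x) := by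
  refine continuous_pi fun v => ?_
  have h1 : ∀ x, phiS E P (f x) v = phi (E v) P (ptOf h (phiS E R ⟨(f x).1, hf x⟩ v)) :=
    fun x => phi_eq_phi_ptOf h ((f x).comp v) (hf x v)
  simp only [h1]
  exact (continuous_phi_ptOf h).comp ((continuous_apply v).comp hc)

/-- The transition formulas are multiplicative, so they can be multiplied over the places. The
product of the coordinates for `P` is a continuous function of φ for `R`, times the corresponding
product for `R` if `W` belongs to `R`. -/
theorem continuous_prod_phi'_of_subset (h : R.carrier ⊆ P.carrier) (b : ∀ v, GrBases (E v) P)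
    (b' : ∀ v, GrBases (E v) R) (f : X → XBarSP E P)
    (hf : ∀ x v, ((f x).1.1 v).flag.carrier ⊆ R.carrier)
    (hc : Continuous fun x => satData b' ⟨(f x).1, hf x⟩) (W : P.Inner) :
    Continuous fun x => ∏ v, phi' (E v) P (b v) ((f x).comp v) W := by
  have hfac : ∀ v, Continuous fun x =>
      relFac h (b v) (b' v) W (phiS E R ⟨(f x).1, hf x⟩ v) := fun v =>
    (continuous_relFac h (b v) (b' v) W).comp ((continuous_apply v).comp (continuous_fst.comp hc))
  by_cases hW : W.1 ∈ R.carrier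
  · have h1 : ∀ x, ∏ v, phi' (E v) P (b v) ((f x).comp v) W =
        (∏ v, relFac h (b v) (b' v) W (phiS E R ⟨(f x).1, hf x⟩ v)) *
          (satData b' ⟨(f x).1, hf x⟩).2 ⟨W.1, hW, W.2.2⟩ := by
      intro x
      change _ = _ * ∏ v, _
      rw [← Finset.prod_mul_distrib]
      exact Finset.prod_congr rfl fun v _ =>
        phi'_eq_of_mem h (b v) (b' v) ((f x).comp v) (hf x v) W hW
    simp only [h1]
    exact (continuous_finsetProd _ fun v _ => hfac v).mul
      ((continuous_apply _).comp (continuous_snd.comp hc))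
  · have h1 : ∀ x, ∏ v, phi' (E v) P (b v) ((f x).comp v) W =
        ∏ v, relFac h (b v) (b' v) W (phiS E R ⟨(f x).1, hf x⟩ v) := fun x =>
      Finset.prod_congr rfl fun v _ =>
        phi'_eq_of_notMem h (b v) (b' v) ((f x).comp v) (hf x v) W hW
    simp only [h1]
    exact continuous_finsetProd _ fun v _ => hfac v

theorem continuous_satData_of_subset (h : R.carrier ⊆ P.carrier) (b : ∀ v, GrBases (E v) P)
    (b' : ∀ v, GrBases (E v) R) (f : X → XBarSP E P)
    (hf : ∀ x v, ((f x).1.1 v).flag.carrier ⊆ R.carrier)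
    (hc : Continuous fun x => satData b' ⟨(f x).1, hf x⟩) :
    Continuous fun x => satData b (f x) :=
  (continuous_phiS_of_subset h f hf (continuous_fst.comp hc)).prodMk
    (continuous_pi fun W => continuous_prod_phi'_of_subset h b b' f hf hc W)

/-- At a point whose flag is exactly `R`, a coordinate belonging to `R` vanishes, and for it the
product over the places is enough. Any other coordinate is, at each place separately, a positive
continuous function of φ for `R`. -/
theorem continuousAt_psiS_of_subset (h : R.carrier ⊆ P.carrier) (b : ∀ v, GrBases (E v) P)
    (b' : ∀ v, GrBases (E v) R) (f : X → XBarSP E P)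
    (hf : ∀ x v, ((f x).1.1 v).flag.carrier ⊆ R.carrier)
    (hc : Continuous fun x => satData b' ⟨(f x).1, hf x⟩) (x₀ : X)
    (hx₀ : ∀ v, ((f x₀).1.1 v).flag = R) :
    @ContinuousAt _ _ _ (prodTop P _ (YFac.weak S)) (fun x => psiS b (f x)) x₀ := by
  let _ := YFac.weak S
  suffices h2 : ContinuousAt (fun x => (psiS b (f x)).2) x₀ from ContinuousAt.prodMk
    (continuous_phiS_of_subset h f hf (continuous_fst.comp hc)).continuousAt h2
  refine continuousAt_pi.2 fun W => ?_
  by_cases hW : W.1 ∈ R.carrier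
  · refine YFac.continuousAt_of_eq_zero (funext fun v => ?_)
      (continuous_prod_phi'_of_subset h b b' f hf hc W).continuousAt
    refine phi'_of_mem (b v) ((f x₀).comp v) W ?_
    change W.1 ∈ ((f x₀).1.1 v).flag.carrier
    rwa [hx₀]
  · have h1 : ∀ x v, phi' (E v) P (b v) ((f x).comp v) W =
        relFac h (b v) (b' v) W (phiS E R ⟨(f x).1, hf x⟩ v) := fun x v =>
      phi'_eq_of_notMem h (b v) (b' v) ((f x).comp v) (hf x v) W hW
    refine YFac.continuousAt_of_ne_zero (fun h0 => ?_) (continuousAt_pi.2 fun v => ?_)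
    · have h2 := congrFun h0 (Classical.arbitrary S)
      exact (relFac_pos h _ (b' _) W _).ne' ((h1 x₀ _).symm.trans h2)
    · change ContinuousAt (fun x => phi' (E v) P (b v) ((f x).comp v) W) x₀
      simp only [h1]
      exact ((continuous_relFac h (b v) (b' v) W).comp
        ((continuous_apply v).comp (continuous_fst.comp hc))).continuousAt

/-- Continuity at `x₀` is tested on the open set of points whose flag is contained in that of `x₀`,
where the Satake data of the latter flag are available. -/
theorem continuous_psiS_satakeTopS (b : ∀ v, GrBases (E v) P) :
    @Continuous _ _ (TopologicalSpace.induced Subtype.val (satakeTopS E F V))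
      (prodTop P _ (YFac.weak S)) (psiS b) := by
  let _ := satakeTopS E F V
  let _ := YFac.weak S
  rw [continuous_iff_continuousAt]
  intro x₀
  let v₀ : S := Classical.arbitrary S
  have h : (x₀.1.1 v₀).flag.carrier ⊆ P.carrier := x₀.2 v₀
  let N : Set (XBarSP E P) :=
    {x | ∀ v, (x.1.1 v).flag.carrier ⊆ (x₀.1.1 v₀).flag.carrier}
  have hN : IsOpen N := (isOpen_satakeTopS (E := E) (x₀.1.1 v₀).flag).preimage
    continuous_subtype_val
  have hx₀ : x₀ ∈ N := fun v => (congrArg ParFlag.carrier (x₀.1.2 v v₀)).subset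
  refine (hN.isOpenEmbedding_subtypeVal.continuousAt_iff (x := ⟨x₀, hx₀⟩)).1 ?_
  refine continuousAt_psiS_of_subset h b (fun v W => Module.finBasis (E v) _)
    (fun x : N => x.1) (fun x => x.2) ?_ ⟨x₀, hx₀⟩ fun v => x₀.1.2 v v₀
  have hval : Continuous fun x : N => x.1.1 := continuous_subtype_val.comp continuous_subtype_val
  exact (continuous_satData _).comp (continuous_induced_rng.2 hval)

end SeveralPlaces

/-! ### Continuity of the inverse for the Satake topology -/

section SatakeInverse

open scoped Classical

variable {S : Type*} [Fintype S] [Nonempty S] {F V : Type*} [Field F] [AddCommGroup V] [Module F V]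
  [FiniteDimensional F V] {e : Module.Basis (Fin (Module.finrank F V)) F V} {P Q R : ParFlag F V}
  {E : S → Type*} [∀ v, NormedField (E v)] [∀ v, LocField (E v)] [∀ v, Algebra F (E v)]
  {X : Type*} [TopologicalSpace X]

theorem ParFlag.finite_inner (P : ParFlag F V) : Finite P.Inner := by
  obtain ⟨e, hP⟩ := exists_adapted P
  choose k hk using hP.exists_index
  refine Finite.of_injective k fun W W' h => Subtype.ext ?_
  rw [hk W, hk W', h]

/-- Continuity of the Satake data along Borel–Serre charts at all places. -/
theorem continuous_satData_chart (hR : Adapted e R) (b : ∀ v, GrBases (E v) R)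
    {g : ∀ v, X → Par (E v) R} (hg : ∀ v, Continuous fun x => parMat e (g v x))
    {t : S → X → RSp e R}
    (ht : ∀ v (k : Fin (Module.finrank F V - 1)), stdSub e (k.1 + 1) ∉ R.carrier →
      Continuous fun x => (t v x).1 k)
    (ht' : ∀ k : Fin (Module.finrank F V - 1), stdSub e (k.1 + 1) ∈ R.carrier →
      Continuous fun x => ∏ v, (t v x).1 k)
    (f : X → XBarSP E R) (hf : ∀ x v, (f x).comp v = chart (g v x) (t v x)) :
    Continuous fun x => satData b (f x) := by
  suffices h2 : Continuous fun x => (satData b (f x)).2 by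
    refine Continuous.prodMk (continuous_pi fun v => ?_) h2
    have h1 : ∀ x, phiS E R (f x) v = phi (E v) R (chart (g v x) (t v x)) := fun x =>
      congrArg _ (hf x v)
    simp only [h1]
    exact continuous_phi_chart hR (hg v) (ht v)
  refine continuous_pi fun W => ?_
  obtain ⟨k, hk⟩ := hR.exists_index W
  have h1 : ∀ x, (satData b (f x)).2 W =
      (∏ v, (t v x).1 k) * ∏ v, chartFac hR (b v) W (g v x) (t v x) := by
    intro x
    rw [← Finset.prod_mul_distrib]
    refine Finset.prod_congr rfl fun v _ => ?_
    rw [← phi'_chart hR (b v) _ _ W hk, hf]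
  simp only [h1]
  exact (ht' k (hk ▸ W.2.1)).mul
    (continuous_finsetProd _ fun v _ => continuous_chartFac hR (b v) W (hg v) (ht v))

/-- Chart coordinates belonging to `R` may tend to zero, but only their product over the places
enters, and that is weakly continuous. Those of `P` that do not belong to `R` come from nonzero
elements, near which the weak topology is the usual one. Those outside `P` depend on the weights
alone. -/
theorem invPointS_satakeTopS_aux (hP : Adapted e P) (b : ∀ v, GrBases (E v) P)
    (h : R.carrier ⊆ P.carrier) (b' : ∀ v, GrBases (E v) R)
    (y : X → ∀ v, Frm e P (E v)) (hy : Continuous y) (u : X → YSp S P)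
    (hu : @Continuous _ _ _ (@Pi.topologicalSpace P.Inner _ fun _ => YFac.weak S) u)
    (hne : ∀ x W, W.1 ∉ R.carrier → (u x W).1 ≠ 0)
    (hf : ∀ x v, ((invPointS hP b (y x, u x)).1.1 v).flag.carrier ⊆ R.carrier) :
    Continuous fun x => satData b' ⟨(invPointS hP b (y x, u x)).1, hf x⟩ := by
  let _ := YFac.weak S
  have hyv : ∀ v, Continuous fun x => y x v := fun v => (continuous_apply v).comp hy
  have huW : ∀ W, Continuous fun x => u x W := fun W => (continuous_apply W).comp hu
  have ht0 : ∀ v x k, (invCoord hP (b v) (y x v) fun W => (u x W).1 v).1 k = 0 →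
      stdSub e (k.1 + 1) ∈ R.carrier := fun v x k hk => hf x v (stdSub_mem_flagOf.2 hk)
  refine continuous_satData_chart (hP.mono h) b'
    (g := fun v x => Subgroup.inclusion (Par_mono (E v) h) (utPar hP (frmUT (y x v))))
    (t := fun v x => ⟨(invCoord hP (b v) (y x v) fun W => (u x W).1 v).1, ht0 v x⟩) ?_ ?_ ?_ _
    fun x v => rfl
  · exact fun v => continuous_parMat_utPar hP (continuous_frmUT.comp (hyv v))
  · intro v k hk
    change Continuous fun x => (invCoord hP (b v) (y x v) fun W => (u x W).1 v).1 k
    by_cases hkP : stdSub e (k.1 + 1) ∈ P.carrier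
    · refine continuous_invCoord_of_mem hP (b v) (hyv v) (u := fun x W => (u x W).1 v) hkP ?_
      have h1 : Continuous fun x => (u x (innerOf hkP)).1 := by
        rw [continuous_iff_continuousAt]
        intro x
        have h2 := YFac.continuousOn_weak.continuousAt
          (YFac.isOpen_ne_zero.mem_nhds (hne x (innerOf hkP) hk))
        exact ContinuousAt.comp (f := fun x => u x (innerOf hkP)) h2 (huW (innerOf hkP)).continuousAt
      exact (continuous_apply v).comp h1
    · exact continuous_invCoord_of_notMem hP (b v) (hyv v) (fun x W => (u x W).1 v) hkP
  · intro k hk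
    have h1 : ∀ x, ∏ v, (invCoord hP (b v) (y x v) fun W => (u x W).1 v).1 k =
        (∏ v, (u x (innerOf (h hk))).1 v) / ∏ v, chartFac hP (b v) (innerOf (h hk))
          (utPar hP (frmUT (y x v))) (weightCoord P e (frmPos (y x v))) := by
      intro x
      rw [← Finset.prod_div_distrib]
      exact Finset.prod_congr rfl fun v _ => invCoord_of_mem _ _ _ _ (h hk)
    change Continuous fun x => ∏ v, (invCoord hP (b v) (y x v) fun W => (u x W).1 v).1 k
    simp only [h1]
    refine (YFac.continuous_prod.comp (huW (innerOf (h hk)))).div₀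
      (continuous_finsetProd _ fun v _ => continuous_chartFac_weightCoord hP (b v) _ (hyv v))
      fun x => ?_
    exact (Finset.prod_pos fun v _ => chartFac_pos _ _ _ _ _).ne'

/-- A generating open set may belong to any flag `P'`. With `R` the flag of the image of `d₀`, which
is contained in both `P` and `P'`, the finitely many conditions defining `N` are weakly open and
keep all flags inside `R`. There the data for `P'` are continuous functions of those for `R`. -/
theorem continuous_invPointS_satakeTopS (hP : Adapted e P) (b : ∀ v, GrBases (E v) P) :
    @Continuous _ _ (prodTop P (∀ v, Frm e P (E v)) (YFac.weak S)) (satakeTopS E F V)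
      fun d => (invPointS hP b d).1 := by
  let _ := YFac.weak S
  refine continuous_generateFrom_iff.2 ?_
  rintro _ ⟨P', b', O, hO, rfl⟩
  rw [isOpen_iff_mem_nhds]
  rintro d₀ ⟨x₀, hx₀, hd₀⟩
  let v₀ : S := Classical.arbitrary S
  let R := ((invPointS hP b d₀).1.1 v₀).flag
  have hRP : R.carrier ⊆ P.carrier := (invPointS hP b d₀).2 v₀
  have hRP' : R.carrier ⊆ P'.carrier := by
    have h1 := x₀.2 v₀
    rw [hd₀] at h1
    exact h1
  have hmem : ∀ d (W : P.Inner) v, W.1 ∈ ((invPointS hP b d).1.1 v).flag.carrier ↔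
      (d.2 W).1 = 0 := by
    intro d W v
    have h1 := congrArg (fun z : ZSpS E P × YSp S P => (z.2 W).1 v) (psiS_invPointS hP b d)
    have h2 := phi'_eq_zero_iff (b v) ((invPointS hP b d).comp v) W
    exact h2.symm.trans ((Eq.congr_left h1).trans ((d.2 W).eq_zero_iff v))
  let N : Set ((∀ v, Frm e P (E v)) × YSp S P) := {d | ∀ W : P.Inner, W.1 ∉ R.carrier → (d.2 W).1 ≠ 0}
  have hN : IsOpen N := by
    have h1 : N = ⋂ W ∈ {W : P.Inner | W.1 ∉ R.carrier}, {d | (d.2 W).1 ≠ 0} := by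
      ext d
      simp [N]
    have := P.finite_inner
    rw [h1]
    refine (Set.toFinite _).isOpen_biInter fun W _ => ?_
    have h2 : Continuous fun d : (∀ v, Frm e P (E v)) × YSp S P => d.2 W :=
      (continuous_apply W).comp continuous_snd
    exact YFac.isOpen_ne_zero.preimage h2
  have hNR : ∀ d : N, ∀ v, ((invPointS hP b d.1).1.1 v).flag.carrier ⊆ R.carrier := by
    intro d v U hU
    by_cases hb : U = ⊥
    · rw [hb]
      exact R.bot_mem
    by_cases ht : U = ⊤
    · rw [ht]
      exact R.top_mem
    by_contra hUR
    let W : P.Inner := ⟨U, (invPointS hP b d.1).2 v hU, hb, ht⟩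
    exact d.2 W hUR ((hmem d.1 W v).1 hU)
  have hcont := invPointS_satakeTopS_aux hP b hRP (fun v W => Module.finBasis (E v) _)
    (fun d : N => d.1.1) (continuous_fst.comp continuous_subtype_val) (fun d : N => d.1.2)
    (continuous_snd.comp continuous_subtype_val) (fun d => d.2) hNR
  let f : N → XBarSP E P' := fun d => ⟨(invPointS hP b d.1).1, fun v => (hNR d v).trans hRP'⟩
  have hf : Continuous fun d => satData b' (f d) :=
    continuous_satData_of_subset hRP' b' (fun v W => Module.finBasis (E v) _) f hNR hcont
  have hopen := hN.isOpenMap_subtype_val _ (hO.preimage hf)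
  refine Filter.mem_of_superset (hopen.mem_nhds ?_) ?_
  · have hd₀N : d₀ ∈ N := fun W hW h0 => hW ((hmem d₀ W v₀).2 h0)
    refine ⟨⟨d₀, hd₀N⟩, ?_, rfl⟩
    have h1 : f ⟨d₀, hd₀N⟩ = x₀ := Subtype.ext hd₀.symm
    change satData b' (f _) ∈ O
    rw [h1]
    exact hx₀
  · rintro _ ⟨d, hd, rfl⟩
    exact ⟨f d, hd, rfl⟩

theorem isHomeomorph_psiEquivS_satakeTopS (b : ∀ v, GrBases (E v) P) :
    @IsHomeomorph _ _ (quotTopS E P (satakeTopS E F V)) (prodTop P _ (YFac.weak S))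
      (psiEquivS b) := by
  obtain ⟨e, hP⟩ := exists_adapted P
  let _ := YFac.weak S
  let _ := satakeTopS E F V
  exact isHomeomorph_of_section _ _ _ (psiEquivS b) (fun x => psiEquivS_mk b x)
    (isQuotientMap_zetaS E hP (YSp S P)) (psiS_invPointS hP b) (continuous_psiS_satakeTopS b)
    (continuous_induced_rng.2 (continuous_invPointS_satakeTopS hP b))

end SatakeInverse

section SinglePlace

open scoped Classical

variable {F V : Type*} [Field F] [AddCommGroup V] [Module F V]
  [FiniteDimensional F V] {e : Module.Basis (Fin (Module.finrank F V)) F V} {P Q R : ParFlag F V}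
  {E : Type*} [NormedField E] [LocField E] [Algebra F E]

/-! ### A single place -/

theorem psi_eq_iff (b : GrBases E P) (x x' : XBarP E P) :
    psi P b x = psi P b x' ↔ MulAction.orbitRel (UniRad E P) (XBarP E P) x x' := by
  rw [MulAction.orbitRel_apply]
  constructor
  · intro h
    obtain ⟨u, hu, hx⟩ := exists_uniRad_of_eq b (congrArg Prod.fst h).symm
      (congrArg Prod.snd h).symm
    exact ⟨⟨u, hu⟩, hx⟩
  · rintro ⟨⟨u, hu⟩, rfl⟩
    exact Prod.ext (phi_uniRad_smul hu x') (phi'_uniRad_smul b hu x')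

theorem psi_surjective (b : GrBases E P) : Function.Surjective (psi P b) := by
  rintro ⟨z, u⟩
  obtain ⟨e, hP⟩ := exists_adapted P
  obtain ⟨y, rfl⟩ := (isQuotientMap_zeta (E := E) hP).surjective z
  exact ⟨invPoint hP b y u, psi_invPoint hP b y u⟩

/-- The bijection induced by `ψ` at one place. -/
def psiEquiv (b : GrBases E P) : QuotP E P ≃ ZSp E P × (P.Inner → ℝ≥0) :=
  Equiv.ofBijective (Quotient.lift (psi P b) fun x x' h => (psi_eq_iff b x x').2 h) <| by
    constructor
    · intro q q'
      induction q using Quotient.inductionOn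
      induction q' using Quotient.inductionOn
      intro h
      exact Quotient.sound ((psi_eq_iff b _ _).1 h)
    · intro z
      obtain ⟨x, rfl⟩ := psi_surjective b z
      exact ⟨Quotient.mk _ x, rfl⟩

theorem psiEquiv_mk (b : GrBases E P) (x : XBarP E P) : psiEquiv b (QuotP.mk x) = psi P b x := rfl

theorem isQuotientMap_zeta_prod (hP : Adapted e P) (T : Type*) [TopologicalSpace T] :
    Topology.IsQuotientMap (Prod.map (zeta hP : Frm e P E → ZSp E P) (id : T → T)) :=
  isQuotientMap_prodMap_id (IsOpenQuotientMap.piMap fun _ : P.Steps => isOpenQuotientMap_mk)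
    (IsProperMap.pi_map fun W : P.Steps => isProperMap_utNorm (grB E hP W))
    (Function.Surjective.piMap fun W => utNorm_surjective (grB E hP W)) T

theorem isHomeomorph_psiEquiv (b : GrBases E P) (hP : Adapted e P)
    (T : TopologicalSpace (XBar E F V))
    (h1 : @Continuous _ _ (TopologicalSpace.induced Subtype.val T) _ (psi P b : XBarP E P → _))
    (h2 : Continuous fun d : Frm e P E × (P.Inner → ℝ≥0) => (invPoint hP b d.1 d.2).1) :
    @IsHomeomorph _ _ (quotTop E P T) instTopologicalSpaceProd (psiEquiv b) := by
  have hC : ∀ d, psi P b ((fun d : Frm e P E × (P.Inner → ℝ≥0) => invPoint hP b d.1 d.2) d) =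
      Prod.map (zeta hP) id d := fun d => psi_invPoint hP b d.1 d.2
  have h2 : Continuous fun d : Frm e P E × (P.Inner → ℝ≥0) => invPoint hP b d.1 d.2 :=
    continuous_induced_rng.2 h2
  exact isHomeomorph_of_section _ _ instTopologicalSpaceProd (psiEquiv b)
    (fun x => psiEquiv_mk b x) (isQuotientMap_zeta_prod hP (P.Inner → ℝ≥0)) hC h1 h2

theorem isHomeomorph_psiEquiv_bsTop (b : GrBases E P) :
    @IsHomeomorph _ _ (quotTop E P (bsTop F V E)) instTopologicalSpaceProd (psiEquiv b) := by
  obtain ⟨e, hP⟩ := exists_adapted P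
  exact isHomeomorph_psiEquiv b hP _ (continuous_psi_bsTop b)
    (continuous_invPoint hP b continuous_fst continuous_snd)

/-- A nonnegative real number as an element of `Y_0` for a single place. -/
def YFac.single (x : ℝ≥0) : YFac Unit :=
  ⟨fun _ => x, by
    rcases eq_or_ne x 0 with rfl | hx
    · exact Or.inr rfl
    · exact Or.inl fun _ => _root_.pos_of_ne_zero hx⟩

/-- For one place the product over the places is the coordinate itself, so the weak topology is no
coarser or finer than the usual one on the half-line; this is one of the two directions. -/
theorem YFac.continuous_single : @Continuous _ _ _ (YFac.weak Unit) YFac.single := by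
  let _ := YFac.weak Unit
  rw [continuous_iff_continuousAt]
  intro x
  rcases eq_or_ne x 0 with rfl | hx
  · refine YFac.continuousAt_of_eq_zero rfl ?_
    have h : ∀ x : ℝ≥0, ∏ v : Unit, (YFac.single x).1 v = x := fun x =>
      Fintype.prod_unique (fun v : Unit => (YFac.single x).1 v)
    simp only [h]
    exact continuousAt_id
  · refine YFac.continuousAt_of_ne_zero (fun h => hx (congrFun h ())) ?_
    exact (continuous_pi fun _ => continuous_id).continuousAt

/-- This is the result for a one-element set of places, the coordinate being recovered as the weakly
continuous product over that set. -/
theorem continuous_psi_satakeTop (b : GrBases E P) :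
    @Continuous _ _ (TopologicalSpace.induced Subtype.val (satakeTop E F V)) _
      (psi P b : XBarP E P → _) := by
  let TU := satakeTopS (fun _ : Unit => E) F V
  let T1 := satakeTop E F V
  let j : XBarP E P → XBarSP (fun _ : Unit => E) P := fun x =>
    ⟨⟨fun _ => x.1, fun _ _ => rfl⟩, fun _ => x.2⟩
  have hi : Continuous fun x : XBar E F V =>
      (⟨fun _ => x, fun _ _ => rfl⟩ : XBarS (fun _ : Unit => E) F V) :=
    continuous_induced_dom (t := TU)
  have hval : Continuous fun x : XBarP E P => x.1 := continuous_subtype_val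
  have hj : Continuous j := continuous_induced_rng.2 (hi.comp hval)
  let _ := YFac.weak Unit
  have h1 : Continuous fun x => psiS (fun _ : Unit => b) (j x) :=
    (continuous_psiS_satakeTopS fun _ : Unit => b).comp hj
  refine Continuous.prodMk ((continuous_apply ()).comp (continuous_fst.comp h1))
    (continuous_pi fun W => ?_)
  have h2 := YFac.continuous_prod.comp ((continuous_apply W).comp (continuous_snd.comp h1))
  have h3 : ∀ x, phi' E P b x W =
      ∏ v : Unit, ((psiS (fun _ : Unit => b) (j x)).2 W).1 v := fun x =>
    (Fintype.prod_unique fun v : Unit => ((psiS (fun _ : Unit => b) (j x)).2 W).1 v).symm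
  exact (continuous_congr h3).2 h2

theorem continuous_invPoint_satakeTop (hP : Adapted e P) (b : GrBases E P) :
    @Continuous _ _ _ (satakeTop E F V) fun d : Frm e P E × (P.Inner → ℝ≥0) =>
      (invPoint hP b d.1 d.2).1 := by
  let TU := satakeTopS (fun _ : Unit => E) F V
  refine (continuous_induced_rng (t₂ := TU)).2 ?_
  let _ := YFac.weak Unit
  have h1 : Continuous fun d : Frm e P E × (P.Inner → ℝ≥0) =>
      (((fun _ => d.1, fun W => YFac.single (d.2 W)) : (Unit → Frm e P E) × YSp Unit P)) :=
    Continuous.prodMk (continuous_pi fun _ => continuous_fst)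
      (continuous_pi fun W => YFac.continuous_single.comp
        ((continuous_apply W).comp continuous_snd))
  have h2 := @Continuous.comp _ _ _ _ _ TU _ _
    (continuous_invPointS_satakeTopS hP fun _ : Unit => b) h1
  have h3 : ∀ d : Frm e P E × (P.Inner → ℝ≥0),
      (invPointS hP (fun _ : Unit => b) (fun _ => d.1, fun W => YFac.single (d.2 W))).1 =
        ⟨fun _ => (invPoint hP b d.1 d.2).1, fun _ _ => rfl⟩ := fun d => rfl
  exact (@continuous_congr _ _ _ TU _ _ h3).1 h2

theorem isHomeomorph_psiEquiv_satakeTop (b : GrBases E P) :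
    @IsHomeomorph _ _ (quotTop E P (satakeTop E F V)) instTopologicalSpaceProd (psiEquiv b) := by
  obtain ⟨e, hP⟩ := exists_adapted P
  exact isHomeomorph_psiEquiv b hP _ (continuous_psi_satakeTop b)
    (continuous_invPoint_satakeTop hP b)

end SinglePlace

/-! ### The archimedean local fields -/

section Archimedean

variable {E : Type*} [NormedField E]

theorem nabs_of_isoReal (h : IsoReal E) : ∃ f : E ≃+* ℝ, Continuous f ∧ Continuous f.symm ∧
    ∀ a, nabs E a = ‖f a‖₊ :=
  ⟨h.choose, h.choose_spec.1, h.choose_spec.2, fun a => by rw [nabs, dif_pos h]⟩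

theorem nabs_of_isoComplex (h : IsoComplex E) (h' : ¬ IsoReal E) :
    ∃ f : E ≃+* ℂ, Continuous f ∧ Continuous f.symm ∧ ∀ a, nabs E a = ‖f a‖₊ ^ 2 :=
  ⟨h.choose, h.choose_spec.1, h.choose_spec.2, fun a => by rw [nabs, dif_neg h', dif_pos h]⟩

theorem LocField.of_isoReal (h : IsoReal E) : LocField E := by
  obtain ⟨f, hf, hf', hn⟩ := nabs_of_isoReal h
  constructor
  · simp [hn]
  · simp [hn]
  · simp [hn]
  · rw [funext hn]; fun_prop
  · intro C
    have : {a : E | nabs E a ≤ C} = f.symm '' Metric.closedBall 0 C := by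
      ext a
      rw [RingEquiv.image_symm_eq_preimage]
      simp only [hn, Set.mem_ofPred_eq, Set.mem_preimage, mem_closedBall_zero_iff]
      rw [← NNReal.coe_le_coe, coe_nnnorm]
    rw [this]
    exact (isCompact_closedBall _ _).image hf'
  · exact ⟨f.symm 2, by rw [hn, RingEquiv.apply_symm_apply]; simp⟩
  · intro a b
    rw [hn, hn, hn, map_add]
    refine (nnnorm_add_le _ _).trans ?_
    exact le_mul_of_one_le_left zero_le one_le_two
  · intro a b r s hr hs hab
    set α := f a with hα
    set β := f b with hβ
    have hQ : 0 < (r : ℝ) ^ 2 * α ^ 2 + s ^ 2 * β ^ 2 := by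
      have hr' : (0 : ℝ) < r := hr
      have hs' : (0 : ℝ) < s := hs
      rcases hab with h | h
      · have : α ≠ 0 := by simpa [hα] using h
        positivity
      · have : β ≠ 0 := by simpa [hβ] using h
        positivity
    set Q : ℝ := (r : ℝ) ^ 2 * α ^ 2 + s ^ 2 * β ^ 2 with hQd
    obtain ⟨q, hq⟩ : ∃ q : ℝ≥0, (q : ℝ) = (Real.sqrt Q)⁻¹ := ⟨⟨_, by positivity⟩, rfl⟩
    have hq0 : 0 < q := by
      rw [← NNReal.coe_pos, hq]; positivity
    have hqq : (q : ℝ) ^ 2 * Q = 1 := by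
      rw [hq, inv_pow, Real.sq_sqrt hQ.le]
      exact inv_mul_cancel₀ hQ.ne'
    -- The first row is the inner product with the given vector, the second is a functional killing
    -- it. The determinant is the squared length `Q`, and `q` is the inverse of the length.
    -- Invariance of the norm is Lagrange's identity.
    refine ⟨f.symm (r ^ 2 * α), f.symm (s ^ 2 * β), -b, a, q, r * s * q, hq0,
      by positivity, by ring, ?_, ?_⟩
    · rw [hn]
      apply NNReal.coe_injective
      simp only [map_sub, map_mul, map_neg, RingEquiv.apply_symm_apply, ← hα, ← hβ,
        NNReal.coe_mul, coe_nnnorm]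
      have : (r : ℝ) ^ 2 * α * α - s ^ 2 * β * -β = Q := by rw [hQd]; ring
      rw [this, Real.norm_eq_abs, abs_of_pos hQ]
      linear_combination (r : ℝ) * s * hqq
    · intro x y
      simp only [oadd, if_pos h, hn]
      congr 1
      apply NNReal.coe_injective
      simp only [map_add, map_mul, map_neg, RingEquiv.apply_symm_apply, ← hα, ← hβ,
        NNReal.coe_mul, coe_nnnorm, NNReal.coe_add, NNReal.coe_pow, mul_pow, Real.norm_eq_abs,
        sq_abs]
      rw [hQd] at hqq
      linear_combination ((r : ℝ) ^ 2 * f x ^ 2 + s ^ 2 * f y ^ 2) * hqq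

theorem LocField.of_isoComplex (h : IsoComplex E) : LocField E := by
  by_cases h' : IsoReal E
  · exact .of_isoReal h'
  obtain ⟨f, hf, hf', hn⟩ := nabs_of_isoComplex h h'
  constructor
  · simp [hn]
  · simp [hn, mul_pow]
  · simp [hn]
  · rw [funext hn]; fun_prop
  · intro C
    have : {a : E | nabs E a ≤ C} = f.symm '' Metric.closedBall 0 (NNReal.sqrt C) := by
      ext a
      rw [RingEquiv.image_symm_eq_preimage]
      simp only [hn, Set.mem_ofPred_eq, Set.mem_preimage, mem_closedBall_zero_iff]
      rw [← coe_nnnorm, NNReal.coe_le_coe, NNReal.le_sqrt_iff_sq_le]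
    rw [this]
    exact (isCompact_closedBall _ _).image hf'
  · refine ⟨f.symm 2, ?_⟩
    rw [hn, RingEquiv.apply_symm_apply, RCLike.nnnorm_ofNat]; norm_num
  · intro a b
    rw [hn, hn, hn, map_add]
    have := nnnorm_add_le (f a) (f b)
    rw [← NNReal.coe_le_coe] at this ⊢
    push_cast at this ⊢
    nlinarith [norm_nonneg (f a + f b), sq_nonneg (‖f a‖ - ‖f b‖)]
  · intro a b r s hr hs hab
    set α := f a with hα
    set β := f b with hβ
    have hQ : 0 < (r : ℝ) * Complex.normSq α + s * Complex.normSq β := by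
      have hr' : (0 : ℝ) < r := hr
      have hs' : (0 : ℝ) < s := hs
      have h1 := Complex.normSq_nonneg α
      have h2 := Complex.normSq_nonneg β
      rcases hab with h | h
      · have : 0 < Complex.normSq α := Complex.normSq_pos.2 (by simpa [hα] using h)
        positivity
      · have : 0 < Complex.normSq β := Complex.normSq_pos.2 (by simpa [hβ] using h)
        positivity
    set Q : ℝ := (r : ℝ) * Complex.normSq α + s * Complex.normSq β with hQd
    obtain ⟨q, hq⟩ : ∃ q : ℝ≥0, (q : ℝ) = Q⁻¹ := ⟨⟨_, by positivity⟩, rfl⟩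
    have hq0 : 0 < q := by
      rw [← NNReal.coe_pos, hq]; positivity
    have hqq : (q : ℝ) * Q = 1 := by rw [hq, inv_mul_cancel₀ hQ.ne']
    -- As in the real case, with the Hermitian form. Since the normalized absolute value is the
    -- squared modulus, that of the determinant is Q², so `q` is now the inverse of `Q` rather than
    -- of its square root.
    refine ⟨f.symm ((r : ℝ) * star α), f.symm ((s : ℝ) * star β), -b, a, q, r * s * q, hq0,
      by positivity, by ring, ?_, ?_⟩
    · rw [hn]
      apply NNReal.coe_injective
      simp only [map_sub, map_mul, map_neg, RingEquiv.apply_symm_apply, ← hα, ← hβ,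
        NNReal.coe_mul, coe_nnnorm, NNReal.coe_pow]
      have : ((r : ℝ) : ℂ) * star α * α - (s : ℝ) * star β * -β = (Q : ℂ) := by
        rw [hQd]
        push_cast
        rw [Complex.normSq_eq_conj_mul_self, Complex.normSq_eq_conj_mul_self, starRingEnd_apply,
          starRingEnd_apply]
        ring
      rw [this, Complex.norm_real, Real.norm_eq_abs, abs_of_pos hQ]
      linear_combination (r : ℝ) * s * (q * Q + 1) * hqq
    · intro x y
      simp only [oadd, if_neg h', if_pos h, hn]
      apply NNReal.coe_injective
      simp only [map_add, map_mul, map_neg, RingEquiv.apply_symm_apply, ← hα, ← hβ,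
        NNReal.coe_mul, coe_nnnorm, NNReal.coe_add, NNReal.coe_pow, ← Complex.normSq_eq_norm_sq]
      have key : Complex.normSq ((r : ℝ) * star α * f x + (s : ℝ) * star β * f y) +
          r * s * Complex.normSq (-β * f x + α * f y) =
          Q * (r * Complex.normSq (f x) + s * Complex.normSq (f y)) := by
        rw [hQd]
        simp only [Complex.normSq_apply, Complex.add_re, Complex.mul_re, Complex.ofReal_re,
          Complex.ofReal_im, Complex.add_im, Complex.mul_im, Complex.neg_re, Complex.neg_im,
          Complex.star_def, Complex.conj_re, Complex.conj_im]
        ring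
      linear_combination q * key + ((r : ℝ) * Complex.normSq (f x) + s * Complex.normSq (f y)) * hqq

end Archimedean

/-! ### The nonarchimedean local fields -/

section Nonarchimedean

variable {E : Type*} [NormedField E] [IsUltrametricDist E]

/-- The powers of 1/2 would tend to zero in `E`, but in an ultrametric field 2 has norm at most 1.
-/
theorem not_continuous_ringEquiv {K : Type*} [NormedField K] [CharZero K] (hK : ‖(2 : K)⁻¹‖ < 1)
    (f : E ≃+* K) : ¬ Continuous f.symm := by
  intro hf
  have h1 : Filter.Tendsto (fun n : ℕ => f.symm ((2 : K)⁻¹ ^ n)) Filter.atTop (𝓝 (f.symm 0)) :=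
    (hf.tendsto 0).comp (tendsto_pow_atTop_nhds_zero_of_norm_lt_one hK)
  simp only [map_pow, map_inv₀, map_ofNat, map_zero] at h1
  rw [tendsto_pow_atTop_nhds_zero_iff_norm_lt_one] at h1
  have h2 : ‖(2 : E)‖ ≤ 1 := by
    simpa using IsUltrametricDist.norm_natCast_le_one E 2
  have h3 : (2 : E) ≠ 0 := by
    intro h
    have := congrArg f h
    rw [map_ofNat, map_zero] at this
    exact two_ne_zero this
  rw [norm_inv] at h1
  exact absurd h1 (not_lt.2 (one_le_inv₀ (norm_pos_iff.2 h3) |>.2 h2))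

theorem not_isReal : ¬ IsoReal E := by
  rintro ⟨f, -, hf⟩
  exact not_continuous_ringEquiv (by norm_num) f hf

theorem not_isComplex : ¬ IsoComplex E := by
  rintro ⟨f, -, hf⟩
  exact not_continuous_ringEquiv (by norm_num) f hf

theorem mem_valRing {x : E} : x ∈ valRing E ↔ ‖x‖ ≤ 1 := by
  refine ⟨fun h => ?_, fun h => Subring.subset_closure h⟩
  induction h using Subring.closure_induction with
  | mem x hx => exact hx
  | zero => simp
  | one => simp
  | add x y _ _ hx hy => exact (IsUltrametricDist.norm_add_le_max x y).trans (max_le hx hy)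
  | neg x _ hx => simpa using hx
  | mul x y _ _ hx hy => rw [norm_mul]; exact mul_le_one₀ hx (norm_nonneg y) hy

variable (E) in
/-- The additive group of the valuation ring multiplied by `a`. -/
def mulRing (a : E) : AddSubgroup E := (valRing E).toAddSubgroup.map (AddMonoidHom.mulLeft a)

theorem mem_mulRing {a x : E} (ha : a ≠ 0) : x ∈ mulRing E a ↔ ‖x‖ ≤ ‖a‖ := by
  simp only [mulRing, AddSubgroup.mem_map, AddMonoidHom.coe_mulLeft]
  constructor
  · rintro ⟨y, hy, rfl⟩
    rw [norm_mul]
    exact mul_le_of_le_one_right (norm_nonneg a) (mem_valRing.1 hy)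
  · intro h
    refine ⟨a⁻¹ * x, mem_valRing.2 ?_, mul_inv_cancel_left₀ ha x⟩
    rw [norm_mul, norm_inv]
    exact inv_mul_le_one_of_le₀ h (norm_nonneg a)

theorem mulRing_le {a b : E} (ha : a ≠ 0) (hb : b ≠ 0) (h : ‖a‖ ≤ ‖b‖) :
    mulRing E a ≤ mulRing E b :=
  fun _ hx => (mem_mulRing hb).2 (((mem_mulRing ha).1 hx).trans h)

theorem mulRing_congr {a b : E} (ha : a ≠ 0) (hb : b ≠ 0) (h : ‖a‖ = ‖b‖) :
    mulRing E a = mulRing E b :=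
  le_antisymm (mulRing_le ha hb h.le) (mulRing_le hb ha h.ge)

theorem mulRing_one : mulRing E 1 = (valRing E).toAddSubgroup := by
  ext x
  rw [mem_mulRing one_ne_zero, norm_one]
  exact mem_valRing.symm

theorem mulRing_mul (a b : E) :
    mulRing E (a * b) = (mulRing E b).map (AddMonoidHom.mulLeft a) := by
  rw [mulRing, mulRing, AddSubgroup.map_map]
  congr 1
  ext x
  simp [mul_assoc]

theorem relIndex_mulRing_mul {c : E} (hc : c ≠ 0) (a b : E) :
    (mulRing E (c * a)).relIndex (mulRing E (c * b)) = (mulRing E a).relIndex (mulRing E b) := by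
  rw [mulRing_mul, mulRing_mul]
  exact AddSubgroup.relIndex_map_map_of_injective _ _ (mul_right_injective₀ hc)

theorem nabs_eq_relIndex (a : E) :
    nabs E a = ((mulRing E 1).relIndex (mulRing E a) : ℝ≥0) /
      ((mulRing E a).relIndex (mulRing E 1) : ℝ≥0) := by
  rw [nabs, dif_neg not_isReal, dif_neg not_isComplex, mulRing_one]
  rfl

/-- Indices multiply along the chain of the πⁿO, and multiplication by πⁿ identifies each successive
quotient with O/πO. -/
theorem relIndex_mulRing_pow {π : E} (h0 : π ≠ 0) (h1 : ‖π‖ < 1) (n : ℕ) :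
    (mulRing E (π ^ n)).relIndex (mulRing E 1) =
      (mulRing E π).relIndex (mulRing E 1) ^ n := by
  induction n with
  | zero => simp
  | succ n ih =>
    rw [← AddSubgroup.relIndex_mul_relIndex (mulRing E (π ^ (n + 1))) (mulRing E (π ^ n)), ih,
      pow_succ, pow_succ', ← relIndex_mulRing_mul (pow_ne_zero n h0) π 1, mul_one]
    · refine mulRing_le (pow_ne_zero _ h0) (pow_ne_zero _ h0) ?_
      rw [norm_pow, norm_pow]
      exact pow_le_pow_of_le_one (norm_nonneg _) h1.le n.le_succ
    · refine mulRing_le (pow_ne_zero _ h0) one_ne_zero ?_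
      rw [norm_pow, norm_one]
      exact pow_le_one₀ (norm_nonneg _) h1.le

theorem nabs_zpow {π : E} (h0 : π ≠ 0) (h1 : ‖π‖ < 1) (n : ℤ) :
    nabs E (π ^ n) = ((mulRing E π).relIndex (mulRing E 1) : ℝ≥0) ^ (-n) := by
  rw [nabs_eq_relIndex]
  obtain ⟨n, rfl | rfl⟩ := n.eq_nat_or_neg
  · have : (mulRing E 1).relIndex (mulRing E (π ^ n)) = 1 := by
      rw [AddSubgroup.relIndex_eq_one]
      refine mulRing_le (pow_ne_zero _ h0) one_ne_zero ?_
      rw [norm_pow, norm_one]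
      exact pow_le_one₀ (norm_nonneg _) h1.le
    rw [zpow_natCast, this, relIndex_mulRing_pow h0 h1]
    simp
  · have : (mulRing E ((π ^ n)⁻¹)).relIndex (mulRing E 1) = 1 := by
      rw [AddSubgroup.relIndex_eq_one]
      refine mulRing_le one_ne_zero (inv_ne_zero (pow_ne_zero _ h0)) ?_
      rw [norm_inv, norm_pow, norm_one]
      exact (one_le_inv₀ (pow_pos (norm_pos_iff.2 h0) n)).2 (pow_le_one₀ (norm_nonneg _) h1.le)
    rw [zpow_neg, zpow_natCast, this, ← relIndex_mulRing_mul (pow_ne_zero n h0) 1,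
      mul_inv_cancel₀ (pow_ne_zero n h0), mul_one, relIndex_mulRing_pow h0 h1]
    simp

theorem nabs_congr {a b : E} (ha : a ≠ 0) (hb : b ≠ 0) (h : ‖a‖ = ‖b‖) :
    nabs E a = nabs E b := by
  rw [nabs_eq_relIndex, nabs_eq_relIndex, mulRing_congr ha hb h]

/-- The index is finite because πO is open in the compact group O, and not 1 because πO does not
contain 1. -/
theorem one_lt_relIndex_mulRing [ProperSpace E] {π : E} (h0 : π ≠ 0) (h1 : ‖π‖ < 1) :
    1 < (mulRing E π).relIndex (mulRing E 1) := by
  have hne : (mulRing E π).relIndex (mulRing E 1) ≠ 0 := by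
    have hc : CompactSpace (mulRing E (1 : E)) := by
      have hs : ((mulRing E (1 : E) : AddSubgroup E) : Set E) = Metric.closedBall 0 1 := by
        ext x
        simp [mem_mulRing]
      exact isCompact_iff_compactSpace.1 (hs ▸ isCompact_closedBall (0 : E) 1)
    have ho : IsOpen (((mulRing E π).addSubgroupOf (mulRing E 1) :
        AddSubgroup (mulRing E (1 : E))) : Set (mulRing E (1 : E))) := by
      have : IsOpen ((mulRing E π : AddSubgroup E) : Set E) := by
        convert IsUltrametricDist.isOpen_closedBall (0 : E) (norm_pos_iff.2 h0).ne'
        ext x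
        simp [mem_mulRing h0]
      exact this.preimage continuous_subtype_val
    have := AddSubgroup.quotient_finite_of_isOpen _ ho
    exact AddSubgroup.index_ne_zero_of_finite
  have hne1 : (mulRing E π).relIndex (mulRing E 1) ≠ 1 := by
    rw [Ne, AddSubgroup.relIndex_eq_one]
    intro h
    have := (mem_mulRing h0).1 (h ((mem_mulRing (x := (1 : E)) one_ne_zero).2 le_rfl))
    rw [norm_one] at this
    exact absurd h1 (not_lt.2 this)
  omega

theorem exists_uniformizer [ProperSpace E] (h : ∃ a : E, a ≠ 0 ∧ ‖a‖ < 1) :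
    ∃ π : E, π ≠ 0 ∧ ‖π‖ < 1 ∧ ∀ a : E, a ≠ 0 → ∃ n : ℤ, ‖a‖ = ‖π‖ ^ n := by
  obtain ⟨a, ha0, ha1⟩ := h
  have hc : IsCompact (Metric.ball (0 : E) 1) :=
    Metric.isCompact_of_isClosed_isBounded (IsUltrametricDist.isClosed_ball 0 1)
      Metric.isBounded_ball
  obtain ⟨π, hπ, hmax⟩ := hc.exists_isMaxOn ⟨a, by simpa using ha1⟩ continuous_norm.continuousOn
  have hπ1 : ‖π‖ < 1 := by simpa using hπ
  have hmax : ∀ x : E, ‖x‖ < 1 → ‖x‖ ≤ ‖π‖ := fun x hx => hmax (by simpa using hx)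
  have hπ0 : 0 < ‖π‖ := (norm_pos_iff.2 ha0).trans_le (hmax a ha1)
  refine ⟨π, norm_pos_iff.1 hπ0, hπ1, fun x hx => ?_⟩
  -- Here ‖π‖⁻ⁿ ≤ ‖x‖ < ‖π‖⁻ⁿ⁻¹. Then πⁿ⁺¹x lies in the open unit ball, so its norm is at most the
  -- maximal value ‖π‖, and the left inequality becomes an equality.
  obtain ⟨n, hn1, hn2⟩ := exists_mem_Ico_zpow (norm_pos_iff.2 hx) ((one_lt_inv₀ hπ0).2 hπ1)
  refine ⟨-n, ?_⟩
  have h3 : ‖π ^ (n + 1) * x‖ < 1 := by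
    rw [norm_mul, norm_zpow]
    rwa [inv_zpow, lt_inv_comm₀ (norm_pos_iff.2 hx) (zpow_pos hπ0 _), ← one_div, lt_div_iff₀ (norm_pos_iff.2 hx)] at hn2
  have h4 := hmax _ h3
  rw [norm_mul, norm_zpow, zpow_add_one₀ hπ0.ne', mul_right_comm,
    mul_le_iff_le_one_left hπ0, ← le_div_iff₀' (zpow_pos hπ0 _), one_div, ← zpow_neg] at h4
  refine le_antisymm h4 ?_
  rwa [zpow_neg, ← inv_zpow]

/-- On nonzero elements, both sides depend only on the exponent `n` in ‖a‖ = ‖π‖ⁿ and are geometric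
in it. The exponent `s` is chosen to match the bases ‖π‖ and 1/[O : πO]. -/
theorem exists_nabs_eq_rpow [ProperSpace E] (h : ∃ a : E, a ≠ 0 ∧ ‖a‖ < 1) :
    ∃ s : ℝ, 0 < s ∧ ∀ a : E, nabs E a = ‖a‖₊ ^ s := by
  obtain ⟨π, h0, h1, hπ⟩ := exists_uniformizer h
  set q := (mulRing E π).relIndex (mulRing E 1) with hq
  have hq1 : 1 < q := one_lt_relIndex_mulRing h0 h1
  have hq1' : (1 : ℝ) < q := by exact_mod_cast hq1
  have hπ0 : 0 < ‖π‖ := norm_pos_iff.2 h0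
  have hl : Real.log ‖π‖ < 0 := Real.log_neg hπ0 h1
  have hs : 0 < Real.log q / -Real.log ‖π‖ := div_pos (Real.log_pos hq1') (neg_pos.2 hl)
  refine ⟨_, hs, fun a => ?_⟩
  by_cases ha : a = 0
  -- The zero group has infinite index in O, as all powers of `q` would divide a finite index.
  -- `relIndex` is then 0, and division by zero gives `nabs E 0` its correct value.
  · have : (mulRing E (0 : E)).relIndex (mulRing E 1) = 0 := by
      by_contra hne
      have hle : ∀ n : ℕ, q ^ n ≤ (mulRing E (0 : E)).relIndex (mulRing E 1) := by
        intro n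
        rw [← relIndex_mulRing_pow h0 h1]
        refine Nat.le_of_dvd (Nat.pos_of_ne_zero hne) (AddSubgroup.relIndex_dvd_of_le_left _ ?_)
        rintro _ ⟨y, -, rfl⟩
        simp
      exact absurd (hle _) (not_le.2 (Nat.lt_pow_self hq1))
    rw [nabs_eq_relIndex, ha, this]
    simp [NNReal.zero_rpow hs.ne']
  · obtain ⟨n, hn⟩ := hπ a ha
    rw [nabs_congr ha (zpow_ne_zero n h0) (by rw [hn, norm_zpow]), nabs_zpow h0 h1]
    apply NNReal.coe_injective
    rw [NNReal.coe_rpow, coe_nnnorm, hn, ← Real.rpow_intCast, ← Real.rpow_mul hπ0.le]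
    push_cast
    rw [← hq, ← Real.rpow_intCast]
    rw [Real.rpow_def_of_pos hπ0, Real.rpow_def_of_pos (by linarith)]
    congr 1
    push_cast
    field_simp [hl.ne]

theorem LocField.of_ultrametric [ProperSpace E] (h : ∃ a : E, a ≠ 0 ∧ ‖a‖ < 1) : LocField E := by
  obtain ⟨s, hs, hn⟩ := exists_nabs_eq_rpow h
  have hadd : ∀ a b : E, nabs E (a + b) ≤ max (nabs E a) (nabs E b) := by
    intro a b
    simp only [hn]
    have h1 : ‖a + b‖₊ ≤ max ‖a‖₊ ‖b‖₊ := IsUltrametricDist.nnnorm_add_le_max a b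
    rw [← (NNReal.monotone_rpow_of_nonneg hs.le).map_max]
    exact NNReal.rpow_le_rpow h1 hs.le
  have hmul : ∀ a b : E, nabs E (a * b) = nabs E a * nabs E b := by
    simp [hn, NNReal.mul_rpow]
  have hone : nabs E 1 = 1 := by simp [hn]
  have hneg : ∀ a : E, nabs E (-a) = nabs E a := by simp [hn]
  have hzero : ∀ a : E, nabs E a = 0 ↔ a = 0 := by simp [hn, hs.ne']
  refine ⟨hone, hmul, hzero, ?_, ?_, ?_, ?_, ?_⟩
  · rw [funext hn]
    exact (NNReal.continuous_rpow_const hs.le).comp continuous_nnnorm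
  · intro C
    have : {a : E | nabs E a ≤ C} = Metric.closedBall 0 ((C ^ (s⁻¹) : ℝ≥0) : ℝ) := by
      ext a
      simp only [hn, Set.mem_ofPred_eq, mem_closedBall_zero_iff]
      rw [← coe_nnnorm, NNReal.coe_le_coe, NNReal.le_rpow_inv_iff hs]
    rw [this]
    exact isCompact_closedBall _ _
  · obtain ⟨a, ha0, ha1⟩ := h
    refine ⟨a⁻¹, ?_⟩
    rw [hn]
    refine NNReal.one_lt_rpow ?_ hs
    rw [nnnorm_inv]
    exact (one_lt_inv₀ (nnnorm_pos.2 ha0)).2 ha1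
  · intro a b
    refine (hadd a b).trans ?_
    refine (max_le_add_of_nonneg zero_le zero_le).trans (le_mul_of_one_le_left zero_le one_le_two)
  -- A shear leaves the maximum unchanged if the multiple of `x` that it adds has weighted size at
  -- most that of `x`. Eliminating the coordinate of smaller weighted size satisfies this, so the
  -- weights need not change, except for a swap in the second case.
  · have key : ∀ (a b : E) (r s : ℝ≥0), a ≠ 0 → s * nabs E b ≤ r * nabs E a → ∀ x y,
        max (r * nabs E x) (s * nabs E (-(b / a) * x + y)) =
          max (r * nabs E x) (s * nabs E y) := by
      intro a b r s ha hle x y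
      have h1 : s * nabs E (-(b / a) * x) ≤ r * nabs E x := by
        have : 0 < nabs E a := pos_iff_ne_zero.2 ((hzero a).not.2 ha)
        rw [hmul, hneg, ← mul_assoc]
        refine mul_le_mul_of_nonneg_right ?_ zero_le
        refine le_of_mul_le_mul_right ?_ this
        rwa [mul_assoc, ← hmul, div_mul_cancel₀ b ha]
      have h2 : s * nabs E (-(b / a) * x + y) ≤ max (r * nabs E x) (s * nabs E y) := by
        refine (mul_le_mul_of_nonneg_left (hadd _ _) zero_le).trans ?_
        rw [mul_max]
        exact max_le_max h1 le_rfl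
      have h3 : s * nabs E y ≤ max (r * nabs E x) (s * nabs E (-(b / a) * x + y)) := by
        have h4 : y = -(-(b / a) * x) + (-(b / a) * x + y) := by ring
        calc s * nabs E y ≤ s * max (nabs E (-(b / a) * x)) (nabs E (-(b / a) * x + y)) := by
              refine mul_le_mul_of_nonneg_left ?_ zero_le
              conv_lhs => rw [h4]
              exact (hadd _ _).trans (max_le_max (hneg _).le le_rfl)
          _ ≤ _ := by
              rw [mul_max]
              exact max_le_max h1 le_rfl
      exact le_antisymm (max_le (le_max_left _ _) h2) (max_le (le_max_left _ _) h3)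
    intro a b r s hr hs hab
    simp only [oadd, if_neg not_isReal, if_neg not_isComplex]
    rcases le_total (s * nabs E b) (r * nabs E a) with hle | hle
    · have ha : a ≠ 0 := by
        rintro rfl
        rw [(hzero 0).2 rfl, mul_zero] at hle
        have := nonpos_iff_eq_zero.1 hle
        simp [hs.ne', hzero] at this
        simp [this] at hab
      refine ⟨1, 0, -(b / a), 1, r, s, hr, hs, by field_simp; ring, by simp [hone], fun x y => ?_⟩
      have := key a b r s ha hle x y
      simpa using this
    · have hb : b ≠ 0 := by
        rintro rfl
        rw [(hzero 0).2 rfl, mul_zero] at hle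
        have := nonpos_iff_eq_zero.1 hle
        simp [hr.ne', hzero] at this
        simp [this] at hab
      refine ⟨0, 1, 1, -(a / b), s, r, hs, hr, by field_simp; ring, ?_, fun x y => ?_⟩
      · simp [hneg, hone, mul_comm]
      · have := key b a s r hb hle y x
        rw [max_comm (r * nabs E x), ← this]
        simp [add_comm]

end Nonarchimedean

/-! ### Local compactness of completions -/

section Compactness

variable {E : Type*} [NormedField E] [IsUltrametricDist E]

/-- In a monic equation whose coefficients have norm at most 1, the leading term of an element of
norm greater than 1 would strictly dominate the others. -/
theorem norm_le_one_of_isAlgebraic {k F : Type*} [Field k] [Field F] [Algebra k F]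
    [Algebra.IsAlgebraic k F] (ι : F →+* E) (h : ∀ c : k, ‖ι (algebraMap k F c)‖ ≤ 1) (x : F) :
    ‖ι x‖ ≤ 1 := by
  by_contra! hx
  have hint : IsIntegral k x := Algebra.IsIntegral.isIntegral x
  obtain ⟨p, hp, hpx⟩ := hint
  have h0 : (ι x) ^ p.natDegree =
      -∑ i ∈ Finset.range p.natDegree, ι (algebraMap k F (p.coeff i)) * ι x ^ i := by
    rw [Polynomial.eval₂_eq_sum_range, Finset.sum_range_succ, hp.coeff_natDegree, map_one,
      one_mul] at hpx
    have := congrArg ι hpx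
    simp only [map_add, map_sum, map_mul, map_pow, map_zero] at this
    exact eq_neg_of_add_eq_zero_right this
  have hd : p.natDegree ≠ 0 := by
    intro hd
    rw [hd] at h0
    simp at h0
  have h1 : ‖(ι x) ^ p.natDegree‖ ≤ ‖ι x‖ ^ (p.natDegree - 1) := by
    rw [h0, norm_neg]
    refine IsUltrametricDist.norm_sum_le_of_forall_le_of_nonneg (by positivity) fun i hi => ?_
    rw [norm_mul, norm_pow]
    have hi' := Finset.mem_range.1 hi
    calc _ ≤ 1 * ‖ι x‖ ^ i := by gcongr; exact h _
      _ ≤ ‖ι x‖ ^ (p.natDegree - 1) := by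
        rw [one_mul]
        exact pow_le_pow_right₀ hx.le (by omega)
  rw [norm_pow] at h1
  exact absurd h1 (not_le.2 (pow_lt_pow_right₀ hx (by omega)))

variable {R : Type*} [CommRing R] [IsDomain R] [IsPrincipalIdealRing R]

theorem mem_fieldClosure_range (ψ : R →+* E) {x : E}
    (hx : x ∈ Subfield.closure (Set.range ψ)) : ∃ a b, ψ b ≠ 0 ∧ IsCoprime a b ∧ x = ψ a / ψ b := by
  rw [Subfield.mem_closure_iff] at hx
  obtain ⟨y, hy, z, hz, rfl⟩ := hx
  rw [← RingHom.coe_range, Subring.closure_eq] at hy hz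
  obtain ⟨a, rfl⟩ := hy
  obtain ⟨b, rfl⟩ := hz
  -- `ψ` need not be injective; a quotient with vanishing denominator is zero by convention and is
  -- rewritten as 0/1.
  by_cases hb : ψ b = 0
  · exact ⟨0, 1, by simp, isCoprime_one_right, by simp [hb]⟩
  · obtain ⟨a', b', c, hab, rfl, rfl⟩ : ∃ a' b' c, IsCoprime a' b' ∧ c * a' = a ∧ c * b' = b := by
      obtain ⟨a', b', c, hab, h1, h2⟩ := UniqueFactorizationMonoid.exists_reduced_factors' a b
        fun h => hb (by rw [h, map_zero])
      exact ⟨a', b', c, hab.isCoprime, h1, h2⟩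
    rw [map_mul] at hb
    refine ⟨a', b', right_ne_zero_of_mul hb, hab, ?_⟩
    rw [map_mul, map_mul, mul_div_mul_left _ _ (left_ne_zero_of_mul hb)]

/-- The elements of absolute value less than one. -/
def smallIdeal (ψ : R →+* E) (hψ : ∀ r, ‖ψ r‖ ≤ 1) : Ideal R where
  carrier := {r | ‖ψ r‖ < 1}
  zero_mem' := by simp
  add_mem' {a b} ha hb := by
    simp only [Set.mem_ofPred_eq, map_add] at *
    exact (IsUltrametricDist.norm_add_le_max _ _).trans_lt (max_lt ha hb)
  smul_mem' c x hx := by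
    simp only [Set.mem_ofPred_eq, smul_eq_mul, map_mul, norm_mul] at *
    exact mul_lt_one_of_nonneg_of_lt_one_right (hψ c) (norm_nonneg _) hx

theorem isPrime_smallIdeal (ψ : R →+* E) (hψ : ∀ r, ‖ψ r‖ ≤ 1) : (smallIdeal ψ hψ).IsPrime := by
  refine Ideal.isPrime_iff.2 ⟨?_, fun {x y} hxy => ?_⟩
  · rw [Ideal.ne_top_iff_one]
    simp [smallIdeal]
  · by_contra! h
    have h1 : ‖ψ x‖ = 1 := le_antisymm (hψ x) (not_lt.1 h.1)
    have h2 : ‖ψ y‖ = 1 := le_antisymm (hψ y) (not_lt.1 h.2)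
    have h3 : ‖ψ (x * y)‖ < 1 := hxy
    rw [map_mul, norm_mul, h1, h2] at h3
    norm_num at h3

/-- In a reduced fraction of norm at most 1 the denominator is prime to π. A Bézout relation inverts
it modulo πⁿ, and the numerator times this inverse is the approximation. -/
theorem exists_approx (ψ : R →+* E) (hψ : ∀ r, ‖ψ r‖ ≤ 1)
    {π : R} (hπ0 : π ≠ 0) (hπ : Ideal.span {π} = smallIdeal ψ hψ) (n : ℕ) {x : E}
    (hx : x ∈ Subfield.closure (Set.range ψ)) (hx1 : ‖x‖ ≤ 1) :
    ∃ a : R, ‖x - ψ a‖ ≤ ‖ψ π‖ ^ n := by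
  obtain ⟨a, b, hb, hab, rfl⟩ := mem_fieldClosure_range ψ hx
  have hsmall : ∀ {r}, ‖ψ r‖ < 1 ↔ π ∣ r := by
    intro r
    rw [← Ideal.mem_span_singleton, hπ]
    rfl
  have hP : (Ideal.span {π}).IsPrime := hπ ▸ isPrime_smallIdeal ψ hψ
  have hirr : Irreducible π := ((Ideal.span_singleton_prime hπ0).1 hP).irreducible
  have hnb : ¬ π ∣ b := by
    intro hdvd
    have hna : ¬ π ∣ a := fun h => hirr.not_isUnit (hab.isUnit_of_dvd' h hdvd)
    rw [← hsmall] at hdvd hna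
    have : ‖ψ a‖ = 1 := le_antisymm (hψ a) (not_lt.1 hna)
    rw [norm_div, this, div_le_one (norm_pos_iff.2 hb)] at hx1
    exact absurd hdvd (not_lt.2 hx1)
  have hb1 : ‖ψ b‖ = 1 := le_antisymm (hψ b) (not_lt.1 (hsmall.not.2 hnb))
  obtain ⟨w, u, huw⟩ := ((hirr.coprime_iff_not_dvd.2 hnb).pow_left (m := n))
  refine ⟨a * u, ?_⟩
  have h1 : ψ a / ψ b - ψ (a * u) = ψ a / ψ b * ψ w * ψ π ^ n := by
    have h2 := congrArg ψ huw
    simp only [map_add, map_mul, map_pow, map_one] at h2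
    rw [map_mul]
    field_simp
    linear_combination (-(ψ a)) * h2
  rw [h1, norm_mul, norm_mul, norm_pow]
  exact mul_le_of_le_one_left (by positivity) (mul_le_one₀ hx1 (norm_nonneg _) (hψ w))

/-- Representatives of the finite ring R/πⁿ form an ε-net as soon as ‖ψ π‖ⁿ < ε, so the set is
closed and totally bounded. -/
theorem isCompact_closure_range [CompleteSpace E] (ψ : R →+* E) (hψ : ∀ r, ‖ψ r‖ ≤ 1)
    (hfin : ∀ r : R, r ≠ 0 → Finite (R ⧸ Ideal.span {r})) (hnt : ∃ r, ψ r ≠ 0 ∧ ‖ψ r‖ < 1) :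
    IsCompact {x : E | x ∈ (Subfield.closure (Set.range ψ)).topologicalClosure ∧ ‖x‖ ≤ 1} := by
  have hcl : IsClosed {x : E |
      x ∈ (Subfield.closure (Set.range ψ)).topologicalClosure ∧ ‖x‖ ≤ 1} :=
    (Subfield.isClosed_topologicalClosure _).inter (isClosed_le continuous_norm continuous_const)
  refine TotallyBounded.isCompact_of_isClosed (Metric.totallyBounded_iff.2 fun ε hε => ?_) hcl
  obtain ⟨r, hr0, hr1⟩ := hnt
  obtain ⟨π, hπ⟩ := IsPrincipalIdealRing.principal (smallIdeal ψ hψ)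
  have hπ : Ideal.span {π} = smallIdeal ψ hψ := hπ.symm
  have hπ0 : π ≠ 0 := by
    rintro rfl
    have : r ∈ Ideal.span {(0 : R)} := hπ ▸ hr1
    rw [Ideal.mem_span_singleton, zero_dvd_iff] at this
    exact hr0 (by rw [this, map_zero])
  have hπ1 : ‖ψ π‖ < 1 := by
    have : π ∈ smallIdeal ψ hψ := hπ ▸ Ideal.mem_span_singleton_self π
    exact this
  obtain ⟨n, hn⟩ := exists_pow_lt_of_lt_one hε hπ1
  have := hfin (π ^ n) (pow_ne_zero n hπ0)
  refine ⟨Set.range fun q : R ⧸ Ideal.span {π ^ n} => ψ (Quotient.out q), Set.finite_range _, ?_⟩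
  rintro x ⟨hx, hx1⟩
  obtain ⟨y, hy, hxy⟩ := Metric.mem_closure_iff.1 hx (min ε 1) (lt_min hε one_pos)
  rw [dist_eq_norm] at hxy
  have hy1 : ‖y‖ ≤ 1 := by
    have : y = x + -(x - y) := by ring
    rw [this]
    exact (IsUltrametricDist.norm_add_le_max _ _).trans
      (max_le hx1 ((norm_neg _).le.trans (hxy.le.trans (min_le_right _ _))))
  obtain ⟨a, ha⟩ := exists_approx ψ hψ hπ0 hπ n hy hy1
  rw [Set.mem_iUnion₂]
  refine ⟨_, ⟨Ideal.Quotient.mk _ a, rfl⟩, ?_⟩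
  set a' := Quotient.out (Ideal.Quotient.mk (Ideal.span {π ^ n}) a) with ha'
  have hdvd : ‖ψ a - ψ a'‖ ≤ ‖ψ π‖ ^ n := by
    have h1 : Ideal.Quotient.mk (Ideal.span {π ^ n}) a =
        Ideal.Quotient.mk (Ideal.span {π ^ n}) a' := (Quotient.out_eq _).symm
    rw [Ideal.Quotient.eq, Ideal.mem_span_singleton] at h1
    obtain ⟨c, hc⟩ := h1
    rw [← map_sub, hc, map_mul, map_pow, norm_mul, norm_pow]
    exact mul_le_of_le_one_right (by positivity) (hψ c)
  rw [Metric.mem_ball, dist_eq_norm]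
  have : x - ψ a' = (x - y) + ((y - ψ a) + (ψ a - ψ a')) := by ring
  rw [this]
  refine (IsUltrametricDist.norm_add_le_max _ _).trans_lt
    (max_lt (hxy.trans_le (min_le_left _ _)) ?_)
  exact (IsUltrametricDist.norm_add_le_max _ _).trans_lt
    (max_lt (ha.trans_lt hn) (hdvd.trans_lt hn))

end Compactness

/-! ### Local compactness from a dense finite extension -/

section Finite

variable {E : Type*} [NormedField E] [CompleteSpace E]

/-- A complete field is locally compact if it contains a dense finite extension of a subfield whose
closure is locally compact. -/
theorem properSpace_of_dense (K : Subfield E) (hK : IsClosed (K : Set E))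
    (hc : IsCompact {x : E | x ∈ K ∧ ‖x‖ ≤ 1}) (hnt : ∃ x ∈ K, 1 < ‖x‖)
    {k F : Type*} [Field k] [Field F] [Algebra k F] [FiniteDimensional k F] (ι : F →+* E)
    (hι : DenseRange ι) (hk : ∀ c : k, ι (algebraMap k F c) ∈ K) : ProperSpace E := by
  obtain ⟨x, hx, hx1⟩ := hnt
  let _ : NontriviallyNormedField K :=
    { (inferInstance : NormedField K) with non_trivial := ⟨⟨x, hx⟩, hx1⟩ }
  let _ : NormedSpace K E := { norm_smul_le := fun a y => (norm_mul (a : E) y).le }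
  have hcb : IsCompact (Metric.closedBall (0 : K) 1) := by
    rw [Subtype.isCompact_iff]
    convert hc
    ext y
    simp [and_comm]
  have : LocallyCompactSpace K :=
    hcb.locallyCompactSpace_of_mem_nhds_of_addGroup (Metric.closedBall_mem_nhds _ one_pos)
  have : CompleteSpace K := hK.completeSpace_coe
  let b := Module.finBasis k F
  -- A finite-dimensional subspace over a complete field is closed. Since it contains the dense
  -- image of `F`, it is all of `E`.
  let W : Submodule K E := Submodule.span K (Set.range (ι ∘ b))
  have : FiniteDimensional K W := FiniteDimensional.span_of_finite K (Set.finite_range _)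
  have hW : IsClosed (W : Set E) := W.closed_of_finiteDimensional
  have hmem : ∀ y, ι y ∈ W := by
    intro y
    rw [← b.sum_repr y, map_sum]
    refine Submodule.sum_mem _ fun i _ => ?_
    rw [Algebra.smul_def, map_mul]
    exact W.smul_mem (⟨_, hk _⟩ : K) (Submodule.subset_span ⟨i, rfl⟩)
  have htop : W = ⊤ := by
    rw [eq_top_iff]
    rintro y -
    exact hW.closure_subset_iff.2 (Set.range_subset_iff.2 hmem) (hι y)
  have : FiniteDimensional K E :=
    Module.Finite.of_surjective W.subtype (by rw [← LinearMap.range_eq_top]; simpa using htop)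
  exact FiniteDimensional.proper K E

/-- The nonarchimedean case, with an explicit principal ideal ring. -/
theorem properSpace_of_principal [IsUltrametricDist E] {R : Type*} [CommRing R] [IsDomain R]
    [IsPrincipalIdealRing R] (ψ : R →+* E) (hψ : ∀ r, ‖ψ r‖ ≤ 1)
    (hfin : ∀ r : R, r ≠ 0 → Finite (R ⧸ Ideal.span {r}))
    {k F : Type*} [Field k] [Field F] [Algebra k F] [FiniteDimensional k F] (ι : F →+* E)
    (hι : DenseRange ι) (hnt : ∃ x, ι x ≠ 0 ∧ ‖ι x‖ ≠ 1)
    (hk : ∀ c : k, ι (algebraMap k F c) ∈ Subfield.closure (Set.range ψ)) : ProperSpace E := by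
  have hψnt : ∃ r, ψ r ≠ 0 ∧ ‖ψ r‖ < 1 := by
    -- Otherwise the norm would be trivial on the image of `k`. By algebraicity it would be at most
    -- 1 on `F`, and by passage to inverses trivial there.
    by_contra! h
    have h1 : ∀ x : F, ‖ι x‖ ≤ 1 := by
      refine norm_le_one_of_isAlgebraic (k := k) ι fun c => ?_
      obtain ⟨a, b, hb, -, h2⟩ := mem_fieldClosure_range ψ (hk c)
      rw [h2, norm_div]
      exact div_le_one_of_le₀ ((hψ a).trans (h b hb)) (norm_nonneg _)
    obtain ⟨x, hx0, hx1⟩ := hnt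
    refine hx1 (le_antisymm (h1 x) ?_)
    have h3 := h1 x⁻¹
    rw [map_inv₀, norm_inv] at h3
    exact (inv_le_one₀ (norm_pos_iff.2 hx0)).1 h3
  refine properSpace_of_dense _ (Subfield.isClosed_topologicalClosure _)
    (isCompact_closure_range ψ hψ hfin hψnt) ?_ (k := k) ι hι
    fun c => Subfield.le_topologicalClosure _ (hk c)
  obtain ⟨r, hr0, hr1⟩ := hψnt
  refine ⟨(ψ r)⁻¹, Subfield.le_topologicalClosure _
    (inv_mem (Subfield.subset_closure ⟨r, rfl⟩)), ?_⟩
  rw [norm_inv]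
  exact (one_lt_inv₀ (norm_pos_iff.2 hr0)).2 hr1

end Finite

/-! ### The completions of a global field are local fields -/

section Completions

variable {E F : Type*} [NormedField E] [CompleteSpace E] [Field F]

/-- A complete field is `ℝ` or `ℂ` if it has a dense subfield finite over `ℚ` and its norm is
archimedean. -/
theorem isReal_or_isComplex [Algebra ℚ F] [FiniteDimensional ℚ F] (ι : F →+* E)
    (hι : DenseRange ι) (h : ¬ ∀ n : ℕ, ‖(n : E)‖ ≤ 1) : IsoReal E ∨ IsoComplex E := by
  set g : ℚ →+* E := ι.comp (algebraMap ℚ F) with hg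
  -- Ostrowski's theorem: an absolute value on ℚ that is unbounded on the integers is a power of the
  -- usual one.
  have hequiv : (NormedField.toAbsoluteValue E |>.comp g.injective).IsEquiv
      Rat.AbsoluteValue.real := by
    refine Rat.AbsoluteValue.equiv_real_of_unbounded fun hb => h fun n => ?_
    have h1 : ‖g n‖ ≤ 1 := hb n
    rwa [map_natCast] at h1
  obtain ⟨c, hc, hpow⟩ := AbsoluteValue.isEquiv_iff_exists_rpow_eq.1 hequiv
  have hnorm : ∀ q : ℚ, ‖g q‖ = |(q : ℝ)| ^ c⁻¹ := by
    intro q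
    have h1 : ‖g q‖ ^ c = |(q : ℝ)| := congrFun hpow q
    rw [← h1, Real.rpow_rpow_inv (norm_nonneg _) hc.ne']
  have huc : UniformContinuous g := by
    refine uniformContinuous_of_continuousAt_zero g ?_
    rw [ContinuousAt, map_zero, tendsto_zero_iff_norm_tendsto_zero]
    have h1 : Continuous fun q : ℚ => |(q : ℝ)| ^ c⁻¹ :=
      (Real.continuous_rpow_const (inv_pos.2 hc).le).comp
        (continuous_abs.comp Rat.continuous_coe_real)
    have h2 := h1.tendsto 0
    simp only [Rat.cast_zero, abs_zero, Real.zero_rpow (inv_pos.2 hc).ne'] at h2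
    simpa only [hnorm] using h2
  have hue : IsUniformInducing (Rat.castHom ℝ) := Rat.isUniformEmbedding_coe_real.isUniformInducing
  have hdr : DenseRange (Rat.castHom ℝ) := Rat.denseRange_cast
  -- The map ℚ → E is uniformly continuous for the usual absolute value, so it extends to ℝ. This
  -- makes `E` a finite extension of ℝ, hence isomorphic to ℝ or ℂ.
  set σ : ℝ →+* E := IsDenseInducing.extendRingHom hue hdr huc
  have hσ : Continuous σ := (uniformContinuous_uniformly_extend hue hdr huc).continuous
  have hσg : ∀ q : ℚ, σ q = g q :=
    fun q => RingHom.congr_fun (Subsingleton.elim (σ.comp (Rat.castHom ℝ)) g) q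
  let _ : Algebra ℝ E := σ.toAlgebra
  have hsmul : ContinuousSMul ℝ E := ⟨(hσ.comp continuous_fst).mul continuous_snd⟩
  let b := Module.finBasis ℚ F
  let W : Submodule ℝ E := Submodule.span ℝ (Set.range (ι ∘ b))
  have : FiniteDimensional ℝ W := FiniteDimensional.span_of_finite ℝ (Set.finite_range _)
  have hW : IsClosed (W : Set E) := W.closed_of_finiteDimensional
  have hmem : ∀ y, ι y ∈ W := by
    intro y
    rw [← b.sum_repr y, map_sum]
    refine Submodule.sum_mem _ fun i _ => ?_
    rw [Algebra.smul_def, map_mul]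
    have h1 : ι (algebraMap ℚ F (b.repr y i)) = algebraMap ℝ E (b.repr y i : ℝ) :=
      (hσg _).symm
    rw [h1, ← Algebra.smul_def]
    exact W.smul_mem _ (Submodule.subset_span ⟨i, rfl⟩)
  have htop : W = ⊤ := by
    rw [eq_top_iff]
    rintro y -
    exact hW.closure_subset_iff.2 (Set.range_subset_iff.2 hmem) (hι y)
  have : FiniteDimensional ℝ E :=
    Module.Finite.of_surjective W.subtype (by rw [← LinearMap.range_eq_top]; simpa using htop)
  rcases Real.nonempty_algEquiv_or E with ⟨⟨e⟩⟩ | ⟨⟨e⟩⟩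
  · exact .inl ⟨e.toRingEquiv, e.toLinearMap.continuous_of_finiteDimensional,
      e.symm.toLinearMap.continuous_of_finiteDimensional⟩
  · exact .inr ⟨e.toRingEquiv, e.toLinearMap.continuous_of_finiteDimensional,
      e.symm.toLinearMap.continuous_of_finiteDimensional⟩

theorem properSpace_of_finiteDimensional_rat [IsUltrametricDist E] [Algebra ℚ F]
    [FiniteDimensional ℚ F] (ι : F →+* E) (hι : DenseRange ι)
    (hnt : ∃ x, ι x ≠ 0 ∧ ‖ι x‖ ≠ 1) : ProperSpace E := by
  refine properSpace_of_principal (Int.castRingHom E)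
    (fun r => by simpa using IsUltrametricDist.norm_intCast_le_one E r) (fun r hr => ?_)
    (k := ℚ) ι hι hnt fun c => ?_
  · exact Ring.HasFiniteQuotients.finiteQuotient (by simpa using hr)
  · have hint : ∀ n : ℤ, (n : E) ∈ Subfield.closure (Set.range (Int.castRingHom E)) :=
      fun n => Subfield.subset_closure ⟨n, rfl⟩
    have h : ι (algebraMap ℚ F c) = (c.num : E) / ((c.den : ℤ) : E) := by
      conv_lhs => rw [← Rat.num_div_den c]
      simp
    rw [h]
    exact div_mem (hint _) (hint _)

/-- Integers satisfy nᵖ = n in characteristic p, which excludes norms greater than 1. -/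
theorem norm_natCast_le_one_of_zmod {p : ℕ} [Fact p.Prime] (θ : ZMod p →+* E) (n : ℕ) :
    ‖(n : E)‖ ≤ 1 := by
  by_contra! h
  have h1 : (n : E) ^ p = n := by
    have := congrArg θ (ZMod.pow_card (n : ZMod p))
    rwa [map_pow, map_natCast] at this
  have h2 := congrArg norm h1
  rw [norm_pow] at h2
  exact absurd h2 (lt_self_pow₀ h (Fact.out : p.Prime).one_lt).ne'

theorem properSpace_of_finiteDimensional_ratFunc [IsUltrametricDist E] {p : ℕ} [Fact p.Prime]
    [Algebra (RatFunc (ZMod p)) F] [FiniteDimensional (RatFunc (ZMod p)) F] (ι : F →+* E)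
    (hι : DenseRange ι) (hnt : ∃ x, ι x ≠ 0 ∧ ‖ι x‖ ≠ 1) : ProperSpace E := by
  set g : RatFunc (ZMod p) →+* E := ι.comp (algebraMap (RatFunc (ZMod p)) F) with hg
  set θ : ZMod p →+* E := g.comp RatFunc.C with hθ
  have hθ1 : ∀ c, ‖θ c‖ ≤ 1 := by
    intro c
    have : θ c = (c.val : E) := by
      conv_lhs => rw [← ZMod.natCast_zmod_val c]
      exact map_natCast θ _
    rw [this]
    exact norm_natCast_le_one_of_zmod θ _
  -- The place may be the one at infinity, where X has norm greater than 1. Then 1/X is used as the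
  -- variable, so that polynomials in `t` have norm at most 1.
  obtain ⟨t, ht1, ht⟩ : ∃ t : E, ‖t‖ ≤ 1 ∧ (g RatFunc.X = t ∨ g RatFunc.X = t⁻¹) := by
    rcases le_total ‖g RatFunc.X‖ 1 with h | h
    · exact ⟨_, h, .inl rfl⟩
    · exact ⟨(g RatFunc.X)⁻¹, by rw [norm_inv]; exact inv_le_one_of_one_le₀ h,
        .inr (inv_inv _).symm⟩
  set ψ : Polynomial (ZMod p) →+* E := Polynomial.eval₂RingHom θ t with hψ
  refine properSpace_of_principal ψ (fun r => ?_) (fun r hr => ?_)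
    (k := RatFunc (ZMod p)) ι hι hnt fun c => ?_
  · rw [hψ, Polynomial.coe_eval₂RingHom, Polynomial.eval₂_eq_sum_range]
    refine IsUltrametricDist.norm_sum_le_of_forall_le_of_nonneg zero_le_one fun i _ => ?_
    rw [norm_mul, norm_pow]
    exact mul_le_one₀ (hθ1 _) (by positivity) (pow_le_one₀ (norm_nonneg _) ht1)
  · have : Module.Finite (ZMod p) (AdjoinRoot r) := (AdjoinRoot.powerBasis hr).finite
    exact (Module.finite_of_finite (ZMod p) : Finite (AdjoinRoot r))
  · have hC : ∀ c, θ c ∈ Subfield.closure (Set.range ψ) :=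
      fun c => Subfield.subset_closure ⟨Polynomial.C c, by simp [hψ]⟩
    have hX : g RatFunc.X ∈ Subfield.closure (Set.range ψ) := by
      have h : t ∈ Subfield.closure (Set.range ψ) :=
        Subfield.subset_closure ⟨Polynomial.X, by simp [hψ]⟩
      rcases ht with ht | ht
      · rwa [ht]
      · rw [ht]; exact inv_mem h
    have hpoly : ∀ q : Polynomial (ZMod p),
        g (algebraMap _ _ q) ∈ Subfield.closure (Set.range ψ) := by
      intro q
      induction q using Polynomial.induction_on' with
      | add q r hq hr => rw [map_add, map_add]; exact add_mem hq hr
      | monomial n a =>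
        rw [← Polynomial.C_mul_X_pow_eq_monomial, map_mul, map_mul, map_pow, map_pow,
          RatFunc.algebraMap_X, RatFunc.algebraMap_C]
        exact mul_mem (hC a) (pow_mem hX n)
    change g c ∈ _
    rw [← RatFunc.num_div_denom c, map_div₀]
    exact div_mem (hpoly _) (hpoly _)

/-- The completion is ultrametric exactly when the integers have norm at most 1, which is automatic
in characteristic p. So only number fields contribute to the archimedean case. -/
theorem locField_compl (hF : IsGlobalField F) (v : Place F) : LocField v.Compl := by
  set ι : F →+* v.Compl :=
    UniformSpace.Completion.coeRingHom.comp (WithAbs.equiv v.abs).symm.toRingHom with hιd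
  have hι : DenseRange ι := UniformSpace.Completion.denseRange_coe.comp
    (WithAbs.equiv v.abs).symm.surjective.denseRange (UniformSpace.Completion.continuous_coe _)
  have hn : ∀ x, ‖ι x‖ = v.abs x := fun x => UniformSpace.Completion.norm_coe _
  have hnt : ∃ x, ι x ≠ 0 ∧ ‖ι x‖ ≠ 1 := by
    obtain ⟨x, hx0, hx1⟩ := (Quotient.out (s := placeSetoid F) v).2
    exact ⟨x, (map_ne_zero ι).2 hx0, by rw [hn]; exact hx1⟩
  by_cases h : ∀ n : ℕ, ‖(n : v.Compl)‖ ≤ 1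
  · have : IsUltrametricDist v.Compl := IsUltrametricDist.isUltrametricDist_of_forall_norm_natCast_le_one h
    have : ProperSpace v.Compl := by
      rcases hF with hF | ⟨p, _, _, _⟩
      · exact properSpace_of_finiteDimensional_rat ι hι hnt
      · exact properSpace_of_finiteDimensional_ratFunc (p := p) ι hι hnt
    refine .of_ultrametric ?_
    obtain ⟨x, hx0, hx1⟩ := hnt
    rcases hx1.lt_or_gt with hx | hx
    · exact ⟨_, hx0, hx⟩
    · exact ⟨(ι x)⁻¹, inv_ne_zero hx0, by rw [norm_inv]; exact inv_lt_one_of_one_lt₀ hx⟩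
  · rcases hF with hF | ⟨p, _, _, _⟩
    · exact (isReal_or_isComplex ι hι h).elim .of_isoReal .of_isoComplex
    · exact absurd (norm_natCast_le_one_of_zmod
        (ι.comp ((algebraMap (RatFunc (ZMod p)) F).comp RatFunc.C))) h

end Completions

end RatCompact

end

theorem proposition3p4p3 {F : Type*} [Field F] (hF : IsGlobalField F)
    {V : Type*} [AddCommGroup V] [Module F V] [FiniteDimensional F V] [Nontrivial V]
    (P : ParFlag F V) :
    -- the induced functions on the graded pieces are norms, so the maps `φ` are well defined
    (∀ (v : Place F) (x : XBarP v.Compl P) (W : P.Steps),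
      IsNorm v.Compl (x.1.induced v.Compl (x.1.flag.cover W.1 W.2.2) P W)) ∧
    -- a nonempty finite set of places
    (∀ (S : Finset (Place F)), S.Nonempty → ∀ e : (∀ v : S, GrBases v.1.Compl P),
      ∃ Ψ : QuotSP (fun v : S => v.1.Compl) P ≃ ZSpS (fun v : S => v.1.Compl) P × YSp S P,
        (∀ x, (Ψ (QuotSP.mk x)).1 = phiS (fun v : S => v.1.Compl) P x ∧
          ∀ W v, ((Ψ (QuotSP.mk x)).2 W).1 v = phi' v.1.Compl P (e v) (x.comp v) W) ∧
        (∀ (g : ParS (fun v : S => v.1.Compl) P) (x : XBarSP (fun v : S => v.1.Compl) P),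
          (∀ v W, (Ψ (QuotSP.mk (g • x))).1 v W =
            grHom v.1.Compl P W (g v) • (Ψ (QuotSP.mk x)).1 v W) ∧
          ∀ W v, ((Ψ (QuotSP.mk (g • x))).2 W).1 v =
            tFactor v.1.Compl P (g v) W * ((Ψ (QuotSP.mk x)).2 W).1 v) ∧
        @IsHomeomorph _ _ (quotTopS _ P (bsTopS (fun v : S => v.1.Compl) F V))
          (prodTop P _ (YFac.usual S)) Ψ ∧
        @IsHomeomorph _ _ (quotTopS _ P (satakeTopS (fun v : S => v.1.Compl) F V))
          (prodTop P _ (YFac.weak S)) Ψ) ∧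
    -- a single place
    (∀ (v : Place F) (e : GrBases v.Compl P),
      ∃ Ψ : QuotP v.Compl P ≃ ZSp v.Compl P × (P.Inner → ℝ≥0),
        (∀ x, Ψ (QuotP.mk x) = (phi v.Compl P x, phi' v.Compl P e x)) ∧
        @IsHomeomorph _ _ (quotTop _ P (bsTop F V v.Compl)) inferInstance Ψ ∧
        @IsHomeomorph _ _ (quotTop _ P (satakeTop v.Compl F V)) inferInstance Ψ) := by
  have hloc : ∀ v : Place F, LocField v.Compl := fun v => locField_compl hF v
  refine ⟨fun v x W => isNorm_induced x W, fun S hS b => ?_, fun v b => ?_⟩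
  · have : Nonempty S := hS.to_subtype
    refine ⟨psiEquivS b, fun x => ⟨rfl, fun W v => rfl⟩, fun g x => ⟨fun v W => ?_, fun W v => ?_⟩,
      isHomeomorph_psiEquivS_bsTopS b, isHomeomorph_psiEquivS_satakeTopS b⟩
    · exact phi_smul (g v) (x.comp v) W
    · exact phi'_smul (b v) (g v) (x.comp v) W
  · exact ⟨psiEquiv b, fun x => rfl, isHomeomorph_psiEquiv_bsTop b,
      isHomeomorph_psiEquiv_satakeTop b⟩
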